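/- Let $q\in\mathbb C^\times$ be not a root of unity and put $\{x\}=x-x^{-1}$, $[k]_q=\{q^k\}/\{q\}$. Fix square roots $\sqrt{[3]_q}$ and $\sqrt{q^2+q^{-2}}$ (any choice; both radicands are unchanged under $q\to-1/q$, and the same roots are used there). For a Young diagram $Q$ let $$S_Q^*(q,A)=\prod_{c\in Q}\frac{\{A\,q^{\,\mathrm{col}(c)-\mathrm{row}(c)}\}}{\{q^{\,\mathrm{hook}(c)}\}} .$$ Let $\mathbb C^N$ ($N\ge1$) have basis $T_1,\dots,T_N$ and let $\mathcal R$ act on $\mathbb C^N\otimes\mathbb C^N$ by $T_{ii}\mapsto qT_{ii}$, $T_{ij}\mapsto T_{ji}+(q-q^{-1})T_{ij}$ for $i<j$, $T_{ij}\mapsto T_{ji}$ for $i>j$. On $(\mathbb C^N)^{\otimes4}$ put $\mathcal R_1=\mathcal R\otimes I\otimes I$, $\mathcal R_2=I\otimes\mathcal R\otimes I$, $\mathcal R_3=I\otimes I\otimes\mathcal R$; these are invertible. For a 4-strand braid given by integers $(a_1,b_1,c_1|a_2,b_2,c_2|\dots)$, the polynomial $H_{[1]}$ is the Laurent polynomial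 in $A$ whose value at $A=q^N$ is, for every $N\ge 1$, $$\mathrm{Tr}\Big((q^\rho)^{\otimes 4}\,\mathcal R_1^{a_1}\mathcal R_2^{b_1}\mathcal R_3^{c_1}\mathcal R_1^{a_2}\mathcal R_2^{b_2}\mathcal R_3^{c_2}\cdots\Big),\qquad q^\rho=\mathrm{diag}(q^{N-1},q^{N-3},\dots,q^{1-N}).$$ Define matrices as follows. For $[4]$: $R_1=(q)$, $U=V=(1)$. For $[31]$: $R_1=\mathrm{diag}(q,q,-1/q)$, $$U=\begin{pmatrix}1&0&0\\0&\frac1{[2]_q}&\frac{\sqrt{[3]_q}}{[2]_q}\\0&-\frac{\sqrt{[3]_q}}{[2]_q}&\frac1{[2]_q}\end{pmatrix},\quad V=\begin{pmatrix}\frac1{[3]_q}&\frac{[2]_q\sqrt{q^2+q^{-2}}}{[3]_q}&0\\-\frac{[2]_q\sqrt{q^2+q^{-2}}}{[3]_q}&\frac1{[3]_q}&0\\0&0&1\end{pmatrix}.$$ For $[22]$: $R_1=\mathrm{diag}(q,-1/q)$, $$U=\begin{pmatrix}\frac1{[2]_q}&\frac{\sqrt{[3]_q}}{[2]_q}\\-\frac{\sqrt{[3]_q}}{[2]_q}&\frac1{[2]_q}\end{pmatrix},\quad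 V=\begin{pmatrix}-\frac{[4]_q}{[2]_q^3}&-\frac{2\sqrt{[3]_q}}{[2]_q^2}\\ \frac{2\sqrt{[3]_q}}{[2]_q^2}&-\frac{[4]_q}{[2]_q^3}\end{pmatrix}.$$ For $[211]$ and $[1111]$ take the matrices of $[31]$ and $[4]$ with $q$ replaced by $-1/q$. In each sector put $R_2=UR_1U^T$ and $R_3=(UV)R_2(UV)^T$. Then: 1. All $U$ and $V$ are orthogonal. For every $Q\in\{[4],[31],[22],[211],[1111]\}$ and every $N$ not smaller than the number of rows of $Q$, let $\mathcal M_Q\subset(\mathbb C^N)^{\otimes4}$ be the multiplicity space of $Q$, i.e. the space of highest weight vectors of weight $Q$ for $U_q(\mathfrak{gl}_N)$, where $E_i$ maps $T_{i+1}\mapsto T_i$ on $\mathbb C^N$ and the coproduct is $\Delta(E_i)=I\otimes E_i+E_i\otimes q^{-2H_i}$, with $q^{-2H_i}$ multiplying $T_i$ by $q^{-1}$, $T_{i+1}$ by $q$ and fixing the other $T_j$. Then $\mathcal M_Q$ has a basis, orthonormal for the bilinear form in which the $T_{ijkl}$ are orthonormal, in which $\mathcal R_1,\mathcal R_2,\mathcal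 R_3$ act by the matrices $R_1,R_2,R_3$ of the sector $Q$. 2. In the sector $[31]$, $$R_2=\begin{pmatrix}q&0&0\\0&-\frac1{q^2[2]_q}&-\frac{\sqrt{[3]_q}}{[2]_q}\\0&-\frac{\sqrt{[3]_q}}{[2]_q}&\frac{q^2}{[2]_q}\end{pmatrix},\quad R_3=\begin{pmatrix}-\frac1{q^3[3]_q}&-\frac{[2]_q\sqrt{q^2+q^{-2}}}{[3]_q}&0\\-\frac{[2]_q\sqrt{q^2+q^{-2}}}{[3]_q}&\frac{q^3}{[3]_q}&0\\0&0&q\end{pmatrix}.$$ In the sector $[22]$, $V=U^{-2}$, $R_3=R_1$, and $$R_2=\begin{pmatrix}-\frac1{q^2[2]_q}&-\frac{\sqrt{[3]_q}}{[2]_q}\\-\frac{\sqrt{[3]_q}}{[2]_q}&\frac{q^2}{[2]_q}\end{pmatrix}.$$ 3. $S^*_{[211]}(q,A)=S^*_{[31]}(-1/q,A)$ and $S^*_{[1111]}(q,A)=S^*_{[4]}(-1/q,A)$ for all $A\neq 0$. 4. For every 4-strand braid, $H_{[1]}$ exists, is unique, and for all $A\ne0$ $$H_{[1]}(A)=\sum_{Q}S_Q^*(q,A)\,\mathrm{tr}\Big(R_1^{a_1}R_2^{b_1}R_3^{c_1}R_1^{a_2}R_2^{b_2}R_3^{c_2}\cdots\Big)_Q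 ,$$ the sum running over $Q\in\{[4],[31],[22],[211],[1111]\}$ and the trace being taken with the matrices of the sector $Q$. Moreover, in every sector the product under the trace equals $\prod_i R_1^{a_i}\,U\,R_1^{b_i}\,V\,U\,R_1^{c_i}\,U^TV^TU^T$. -/

import Mathlib

open Matrix

noncomputable section

namespace FourStrand

/-- `{x} = x - x⁻¹`. -/
def br (x : ℂ) : ℂ := x - x⁻¹

/-- The `q`-number `[k]_q = (q^k - q^(-k)) / (q - q⁻¹)`. -/
def qNum (k : ℕ) (q : ℂ) : ℂ := br (q ^ k) / br q

/-! ### Schur functions at the special point -/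

/-- Hook length of the cell `c = (row, column)`: arm plus leg plus one. -/
def hookLength (Q : YoungDiagram) (c : ℕ × ℕ) : ℕ :=
  (Q.rowLen c.1 - (c.2 + 1)) + (Q.colLen c.2 - (c.1 + 1)) + 1

/-- `S_Q^*`, the product over the cells of `{A q^(column - row)} / {q^hook}`. -/
def schurStar (Q : YoungDiagram) (q A : ℂ) : ℂ :=
  ∏ c ∈ Q.cells, br (A * q ^ ((c.2 : ℤ) - (c.1 : ℤ))) / br (q ^ hookLength Q c)

/-- The Young diagrams with four boxes. -/
def Y4 : YoungDiagram := YoungDiagram.ofRowLens [4] (by decide)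
def Y31 : YoungDiagram := YoungDiagram.ofRowLens [3, 1] (by decide)
def Y22 : YoungDiagram := YoungDiagram.ofRowLens [2, 2] (by decide)
def Y211 : YoungDiagram := YoungDiagram.ofRowLens [2, 1, 1] (by decide)
def Y1111 : YoungDiagram := YoungDiagram.ofRowLens [1, 1, 1, 1] (by decide)

/-! ### The space `(ℂ^N)^{⊗4}` and the quantum `R`-matrices

Vectors of `(ℂ^N)^{⊗4}` are given by their coordinates in the basis `T_x`,
`x : Fin 4 → Fin N`, and operators by their matrices in this basis. -/

/-- The index set of the standard basis of `(ℂ^N)^{⊗4}`. -/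
abbrev Idx (N : ℕ) : Type := Fin 4 → Fin N

/-- The (braiding) `R`-matrix of the vector representation of `U_q(gl_N)`:
`T_ii ↦ q T_ii`, `T_ij ↦ T_ji + (q - q⁻¹) T_ij` for `i < j` and `T_ij ↦ T_ji` for `i > j`.
Columns are inputs, rows are outputs. -/
def rMatrix (N : ℕ) (q : ℂ) : Matrix (Fin N × Fin N) (Fin N × Fin N) ℂ :=
  fun x y =>
    if y.1 = y.2 then (if x = y then q else 0)
    else (if x = y.swap then 1 else 0) + (if x = y ∧ y.1 < y.2 then q - q⁻¹ else 0)

/-- `R` acting on the adjacent strands `μ, μ + 1` (counted from `0`) and as the identity on the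
others: for `μ = 0, 1, 2` these are `R ⊗ I ⊗ I`, `I ⊗ R ⊗ I`, `I ⊗ I ⊗ R`. -/
def strandR (N : ℕ) (q : ℂ) (μ : Fin 3) : Matrix (Idx N) (Idx N) ℂ :=
  fun x y =>
    if ∀ k : Fin 4, k ≠ μ.castSucc → k ≠ μ.succ → x k = y k then
      rMatrix N q (x μ.castSucc, x μ.succ) (y μ.castSucc, y μ.succ)
    else 0

/-- A four-strand braid is given by a sequence `(a₁, b₁, c₁), (a₂, b₂, c₂), …` of triples of
integers; its value on `R₁, R₂, R₃` is `R₁^a₁ R₂^b₁ R₃^c₁ R₁^a₂ R₂^b₂ R₃^c₂ ⋯`. -/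
def braidValue {M : Type*} [DivInvMonoid M] (R : Fin 3 → M) (w : List (ℤ × ℤ × ℤ)) : M :=
  (w.map fun t => R 0 ^ t.1 * R 1 ^ t.2.1 * R 2 ^ t.2.2).prod

/-- The weighted trace `Tr ((q^ρ)^{⊗4} M)`, where `q^ρ` is the diagonal matrix with entries
`q^(N-1), q^(N-3), …, q^(1-N)`. -/
def qTrace (N : ℕ) (q : ℂ) (M : Matrix (Idx N) (Idx N) ℂ) : ℂ :=
  ∑ x : Idx N, (∏ k, q ^ ((N : ℤ) - 1 - 2 * ((x k : ℕ) : ℤ))) * M x x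

/-- `H`, a Laurent polynomial in `A`, is the HOMFLY polynomial `H_[1]` of the braid `w`: at
`A = q^N` it is the weighted trace of the product of `R`-matrices along `w`, for every `N ≥ 1`. -/
def IsHomfly (q : ℂ) (w : List (ℤ × ℤ × ℤ)) (H : LaurentPolynomial ℂ) : Prop :=
  ∀ N : ℕ, 1 ≤ N → ∀ A : ℂˣ, (A : ℂ) = q ^ N →
    LaurentPolynomial.eval₂ (RingHom.id ℂ) A H = qTrace N q (braidValue (strandR N q) w)

/-! ### Multiplicity spaces -/

/-- The generator `E_i : T_{i+1} ↦ T_i` on `ℂ^N` (zero if `i + 1 ≥ N`). -/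
def raise (N i : ℕ) : Matrix (Fin N) (Fin N) ℂ :=
  fun a b => if (a : ℕ) = i ∧ (b : ℕ) = i + 1 then 1 else 0

/-- `q^(-2 H_i)` on `ℂ^N`: the diagonal matrix with entry `q⁻¹` at `i`, `q` at `i + 1`, and `1`
elsewhere. -/
def cartanInv (N : ℕ) (q : ℂ) (i : ℕ) : Matrix (Fin N) (Fin N) ℂ :=
  Matrix.diagonal fun a => if (a : ℕ) = i then q⁻¹ else if (a : ℕ) = i + 1 then q else 1

/-- The tensor product of four operators on `ℂ^N`. -/
def tensorOp {N : ℕ} (B : Fin 4 → Matrix (Fin N) (Fin N) ℂ) : Matrix (Idx N) (Idx N) ℂ :=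
  fun x y => ∏ k, B k (x k) (y k)

/-- `E_i` on `(ℂ^N)^{⊗4}`, through the iterated coproduct `Δ(E) = I ⊗ E + E ⊗ q^(-2H)`. -/
def raiseTensor (N : ℕ) (q : ℂ) (i : ℕ) : Matrix (Idx N) (Idx N) ℂ :=
  ∑ k : Fin 4, tensorOp fun l =>
    if l < k then 1 else if l = k then raise N i else cartanInv N q i

/-- The multiplicity space `M_Q` of the irreducible representation `Q` in `(ℂ^N)^{⊗4}`, realized
as the space of highest weight vectors of weight `Q`: those supported on the `T_x` in which each
`i` occurs `Q_i` times, and killed by all `E_i`. -/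
def multSpace (N : ℕ) (q : ℂ) (Q : YoungDiagram) : Submodule ℂ (Idx N → ℂ) where
  carrier := {v | (∀ x : Idx N,
      (∃ i : Fin N, (Finset.univ.filter fun k => x k = i).card ≠ Q.rowLen i) → v x = 0) ∧
    ∀ i : ℕ, raiseTensor N q i *ᵥ v = 0}
  add_mem' := by
    rintro v u ⟨hv, hv'⟩ ⟨hu, hu'⟩
    refine ⟨fun x hx => ?_, fun i => ?_⟩
    · rw [Pi.add_apply, hv x hx, hu x hx, add_zero]
    · rw [Matrix.mulVec_add, hv' i, hu' i, add_zero]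
  zero_mem' := ⟨fun _ _ => rfl, fun i => Matrix.mulVec_zero _⟩
  smul_mem' := by
    rintro c v ⟨hv, hv'⟩
    refine ⟨fun x hx => ?_, fun i => ?_⟩
    · rw [Pi.smul_apply, hv x hx, smul_zero]
    · rw [Matrix.mulVec_smul, hv' i, smul_zero]

/-! ### The explicit matrices -/

/-- The first `R`-matrix and the mixing matrices `U`, `V` of one sector. -/
structure Mixing (n : ℕ) where
  R1 : Matrix (Fin n) (Fin n) ℂ
  U : Matrix (Fin n) (Fin n) ℂ
  V : Matrix (Fin n) (Fin n) ℂ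

/-- The matrices `R₁`, `R₂ = U R₁ Uᵀ`, `R₃ = (U V) R₂ (U V)ᵀ` of a sector. -/
def Mixing.hatR {n : ℕ} (D : Mixing n) : Fin 3 → Matrix (Fin n) (Fin n) ℂ :=
  ![D.R1, D.U * D.R1 * D.Uᵀ, (D.U * D.V) * (D.U * D.R1 * D.Uᵀ) * (D.U * D.V)ᵀ]

/-- The product of `R₁^a U R₁^b V U R₁^c Uᵀ Vᵀ Uᵀ` along the braid. -/
def Mixing.mixedValue {n : ℕ} (D : Mixing n) (w : List (ℤ × ℤ × ℤ)) :
    Matrix (Fin n) (Fin n) ℂ :=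
  (w.map fun t => D.R1 ^ t.1 * D.U * D.R1 ^ t.2.1 * D.V * D.U * D.R1 ^ t.2.2 *
    D.Uᵀ * D.Vᵀ * D.Uᵀ).prod

/-- The one-dimensional sector `[4]`. -/
def sector4 (q : ℂ) : Mixing 1 where
  R1 := !![q]
  U := 1
  V := 1

/-- The sector `[31]`; here `s` stands for `√[3]_q` and `t` for `√(q² + q⁻²)`. -/
def sector31 (q s t : ℂ) : Mixing 3 where
  R1 := !![q, 0, 0; 0, q, 0; 0, 0, -1 / q]
  U := !![1, 0, 0;
          0, 1 / qNum 2 q, s / qNum 2 q;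
          0, -(s / qNum 2 q), 1 / qNum 2 q]
  V := !![1 / qNum 3 q, qNum 2 q * t / qNum 3 q, 0;
          -(qNum 2 q * t / qNum 3 q), 1 / qNum 3 q, 0;
          0, 0, 1]

/-- The sector `[22]`; here `s` stands for `√[3]_q`. -/
def sector22 (q s : ℂ) : Mixing 2 where
  R1 := !![q, 0; 0, -1 / q]
  U := !![1 / qNum 2 q, s / qNum 2 q;
          -(s / qNum 2 q), 1 / qNum 2 q]
  V := !![-(qNum 4 q / qNum 2 q ^ 3), -(2 * s / qNum 2 q ^ 2);
          2 * s / qNum 2 q ^ 2, -(qNum 4 q / qNum 2 q ^ 3)]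

/-- `U` and `V` are orthogonal. -/
def Mixing.Orthogonal {n : ℕ} (D : Mixing n) : Prop :=
  D.U * D.Uᵀ = 1 ∧ D.V * D.Vᵀ = 1

/-- In a basis of the multiplicity space `M_Q` that is orthonormal for the bilinear form
`⟨T_x, T_y⟩ = δ_{xy}`, the operators `R₁, R₂, R₃` on `(ℂ^N)^{⊗4}` act by the matrices of `D`. -/
def Mixing.Represents {n : ℕ} (D : Mixing n) (N : ℕ) (q : ℂ) (Q : YoungDiagram) : Prop :=
  ∃ e : Module.Basis (Fin n) ℂ (multSpace N q Q),
    (∀ i j, (e i : Idx N → ℂ) ⬝ᵥ (e j : Idx N → ℂ) = if i = j then 1 else 0) ∧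
    ∀ μ j, strandR N q μ *ᵥ (e j : Idx N → ℂ) = ∑ i, D.hatR μ i j • (e i : Idx N → ℂ)

end FourStrand

end

open Matrix

noncomputable section

namespace FourStrand

/-! ### The `R`-matrices on tensor space and the Hecke relations. -/

section

/-! The operators `strandR` satisfy the relations of the Hecke algebra H_4(q), and so do the
explicit matrices of each of the five sectors. For the sectors `[211]` and `[1111]` this uses that
the relations depend on `q` only through `q - q⁻¹`, which is invariant under `q → -1/q`.

The trace formula needs no decomposition of tensor space. A trace functional on a quotient of H_4(q)
is determined by its values on 1, g₀, g₀g₁, g₀g₂ and g₀g₁g₂, one element for each conjugacy class of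
S_4 (`IsHecke.trace_eq_zero`). The reason is the double coset form H_4 = H_3 + H_3 g₂ H_3. For the
weighted trace these five values follow from the Markov property: removing a strand costs the factor
`q ^ N / [N]` (`qTrace_strandR_mul`). For the sectors they are read off the matrices. The two sides
of the formula therefore agree on every braid as soon as five rational identities in `q` and `A = q
^ N` hold (`sum_schurStar_mul_classValues`). Each `S_Q^*` is a Laurent polynomial in `A`, which
gives existence of the HOMFLY polynomial; uniqueness holds because the powers of `q` are infinitely
many points.

For the multiplicity spaces, `R` commutes with the raising operators, so each M_Q is stable under
the `R`-matrices. A few words whose coordinates determine a highest weight vector bound the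
dimension of M_Q from above; an orthonormal system of that size is then a basis
(`Mixing.represents_of_orthonormal`). In the one-dimensional sectors a single vector is enough. In
the others one starts from an explicit unit vector that is an eigenvector of two of the generators,
and the Hecke relations with the symmetry of `R` produce the remaining basis vectors and all matrix
entries (`IsHecke.exists_basis_sector31`, `IsHecke.exists_basis_sector22`). The sector `[211]` is
the case `p = -1/q` of the first of these. -/

/-- The word `x` with the letters at positions `μ`, `μ + 1` exchanged. -/
def swapAt {N : ℕ} (μ : Fin 3) (x : Idx N) : Idx N := x ∘ Equiv.swap μ.castSucc μ.succ

/-- The diagonal entry of the `R`-matrix at `T_ab`. -/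
def rDiag {N : ℕ} (q : ℂ) (a b : Fin N) : ℂ := if a = b then q else if a < b then q - q⁻¹ else 0

/-- A row of `R` has at most two nonzero entries, at the word itself and at its swap. This reduces
the later identities on tensor space to coordinates, case by case in the order of the letters. -/
lemma strandR_apply (N : ℕ) (q : ℂ) (μ : Fin 3) (x y : Idx N) :
    strandR N q μ x y = (if x = y then rDiag q (x μ.castSucc) (x μ.succ) else 0) +
      (if swapAt μ x = y then (if x μ.castSucc = x μ.succ then 0 else 1) else 0) := by
  have hne : μ.castSucc ≠ μ.succ := (Fin.castSucc_lt_succ).ne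
  have hxy : x = y ↔ (∀ k : Fin 4, k ≠ μ.castSucc → k ≠ μ.succ → x k = y k) ∧
      x μ.castSucc = y μ.castSucc ∧ x μ.succ = y μ.succ := by
    constructor
    · rintro rfl; simp
    · rintro ⟨h, h1, h2⟩
      ext1 k
      by_cases k1 : k = μ.castSucc
      · rw [k1, h1]
      by_cases k2 : k = μ.succ
      · rw [k2, h2]
      exact h k k1 k2
  have hsw : swapAt μ x = y ↔ (∀ k : Fin 4, k ≠ μ.castSucc → k ≠ μ.succ → x k = y k) ∧
      x μ.castSucc = y μ.succ ∧ x μ.succ = y μ.castSucc := by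
    constructor
    · rintro rfl
      refine ⟨fun k h1 h2 => ?_, ?_, ?_⟩
      · simp [swapAt, Equiv.swap_apply_of_ne_of_ne h1 h2]
      · simp [swapAt]
      · simp [swapAt]
    · rintro ⟨h, h1, h2⟩
      ext1 k
      by_cases k1 : k = μ.castSucc
      · simp [swapAt, k1, h2]
      by_cases k2 : k = μ.succ
      · simp [swapAt, k2, h1]
      rw [← h k k1 k2]
      simp [swapAt, Equiv.swap_apply_of_ne_of_ne k1 k2]
  unfold strandR
  simp only [hxy, hsw]
  by_cases H : ∀ k : Fin 4, k ≠ μ.castSucc → k ≠ μ.succ → x k = y k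
  · rw [if_pos H]
    simp only [iff_true_intro H, true_and, rMatrix, rDiag, Prod.ext_iff, Prod.fst_swap,
      Prod.snd_swap]
    clear hxy hsw H
    generalize x μ.castSucc = a
    generalize x μ.succ = b
    generalize y μ.castSucc = c
    generalize y μ.succ = d
    split_ifs <;> grind
  · simp only [H, if_false, false_and, add_zero]

lemma strandR_mulVec (N : ℕ) (q : ℂ) (μ : Fin 3) (v : Idx N → ℂ) (x : Idx N) :
    (strandR N q μ *ᵥ v) x = rDiag q (x μ.castSucc) (x μ.succ) * v x +
      (if x μ.castSucc = x μ.succ then 0 else v (swapAt μ x)) := by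
  simp only [mulVec, dotProduct, strandR_apply, add_mul, Finset.sum_add_distrib, ite_mul, zero_mul,
    one_mul, Finset.sum_ite_eq, Finset.mem_univ, if_true]

lemma eq_cons {N : ℕ} (x : Idx N) : x = ![x 0, x 1, x 2, x 3] := by
  ext1 k; fin_cases k <;> rfl

lemma swapAt_zero {N : ℕ} (a b c d : Fin N) : swapAt 0 ![a, b, c, d] = ![b, a, c, d] := by
  ext1 k; fin_cases k <;> rfl

lemma swapAt_one {N : ℕ} (a b c d : Fin N) : swapAt 1 ![a, b, c, d] = ![a, c, b, d] := by
  ext1 k; fin_cases k <;> rfl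

lemma swapAt_two {N : ℕ} (a b c d : Fin N) : swapAt 2 ![a, b, c, d] = ![a, b, d, c] := by
  ext1 k; fin_cases k <;> rfl

lemma strandR_zero_mulVec {N : ℕ} (q : ℂ) (v : Idx N → ℂ) (a b c d : Fin N) :
    (strandR N q 0 *ᵥ v) ![a, b, c, d] = rDiag q a b * v ![a, b, c, d] +
      (if a = b then 0 else v ![b, a, c, d]) := by
  rw [strandR_mulVec, swapAt_zero]; rfl

lemma strandR_one_mulVec {N : ℕ} (q : ℂ) (v : Idx N → ℂ) (a b c d : Fin N) :
    (strandR N q 1 *ᵥ v) ![a, b, c, d] = rDiag q b c * v ![a, b, c, d] +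
      (if b = c then 0 else v ![a, c, b, d]) := by
  rw [strandR_mulVec, swapAt_one]; rfl

lemma strandR_two_mulVec {N : ℕ} (q : ℂ) (v : Idx N → ℂ) (a b c d : Fin N) :
    (strandR N q 2 *ᵥ v) ![a, b, c, d] = rDiag q c d * v ![a, b, c, d] +
      (if c = d then 0 else v ![a, b, d, c]) := by
  rw [strandR_mulVec, swapAt_two]; rfl

/-- Three elements that satisfy the relations of the generators of the Hecke algebra `H_4(q)`,
with `(g - q) (g + q⁻¹) = 0`. -/
structure IsHecke {B : Type*} [Ring B] [Algebra ℂ B] (q : ℂ) (g : Fin 3 → B) : Prop where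
  sq (μ : Fin 3) : g μ * g μ = 1 + (q - q⁻¹) • g μ
  comm : g 0 * g 2 = g 2 * g 0
  braid_zero_one : g 0 * g 1 * g 0 = g 1 * g 0 * g 1
  braid_one_two : g 1 * g 2 * g 1 = g 2 * g 1 * g 2

lemma matrix_ext_mulVec {N : ℕ} {M M' : Matrix (Idx N) (Idx N) ℂ}
    (h : ∀ v a b c d, (M *ᵥ v) ![a, b, c, d] = (M' *ᵥ v) ![a, b, c, d]) : M = M' := by
  refine ext_of_mulVec_single fun i => ?_
  ext1 x
  rw [eq_cons x]
  exact h _ _ _ _ _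

theorem isHecke_strandR (N : ℕ) {q : ℂ} (hq : q ≠ 0) : IsHecke q (strandR N q) where
  sq μ := by
    refine matrix_ext_mulVec fun v a b c d => ?_
    rw [add_mulVec, smul_mulVec, one_mulVec, ← mulVec_mulVec]
    fin_cases μ
    · rcases lt_trichotomy a b with h | rfl | h
      all_goals
        simp [strandR_zero_mulVec, rDiag, LT.lt.ne, LT.lt.ne', LT.lt.not_gt, *]
        try field_simp
        try ring
    · rcases lt_trichotomy b c with h | rfl | h
      all_goals
        simp [strandR_one_mulVec, rDiag, LT.lt.ne, LT.lt.ne', LT.lt.not_gt, *]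
        try field_simp
        try ring
    · rcases lt_trichotomy c d with h | rfl | h
      all_goals
        simp [strandR_two_mulVec, rDiag, LT.lt.ne, LT.lt.ne', LT.lt.not_gt, *]
        try field_simp
        try ring
  comm := by
    refine matrix_ext_mulVec fun v a b c d => ?_
    simp only [← mulVec_mulVec, strandR_zero_mulVec, strandR_two_mulVec]
    split_ifs <;> ring
  braid_zero_one := by
    refine matrix_ext_mulVec fun v a b c d => ?_
    simp only [← mulVec_mulVec, strandR_zero_mulVec, strandR_one_mulVec]
    -- Only the relative order of the three letters matters; the inconsistent combinations are
    -- refuted by `order`.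
    rcases lt_trichotomy a b with h | h | h <;> rcases lt_trichotomy b c with h' | h' | h' <;>
    rcases lt_trichotomy a c with h'' | h'' | h''
    all_goals first
      | (exfalso; order)
      | (try subst h
         try subst h'
         try subst h'')
    all_goals
      simp [rDiag, LT.lt.ne, LT.lt.ne', LT.lt.not_gt, *]
      try field_simp
      try ring
  braid_one_two := by
    refine matrix_ext_mulVec fun v z a b c => ?_
    simp only [← mulVec_mulVec, strandR_one_mulVec, strandR_two_mulVec]
    rcases lt_trichotomy a b with h | h | h <;> rcases lt_trichotomy b c with h' | h' | h' <;>
    rcases lt_trichotomy a c with h'' | h'' | h''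
    all_goals first
      | (exfalso; order)
      | (try subst h
         try subst h'
         try subst h'')
    all_goals
      simp [rDiag, LT.lt.ne, LT.lt.ne', LT.lt.not_gt, *]
      try field_simp
      try ring

end

/-! ### Trace functionals on quotients of H_4(q). -/

section

namespace IsHecke

variable {B : Type*} [Ring B] [Algebra ℂ B] {q : ℂ} {g : Fin 3 → B}

/-- This and the following identities are rewriting rules for words associated to the right. -/
lemma sq_mul (h : IsHecke q g) (μ : Fin 3) (x : B) :
    g μ * (g μ * x) = x + (q - q⁻¹) • (g μ * x) := by
  rw [← mul_assoc, h.sq, add_mul, one_mul, smul_mul_assoc]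

lemma comm_mul (h : IsHecke q g) (x : B) : g 2 * (g 0 * x) = g 0 * (g 2 * x) := by
  rw [← mul_assoc, ← h.comm, mul_assoc]

lemma braid_one_zero (h : IsHecke q g) : g 1 * (g 0 * g 1) = g 0 * (g 1 * g 0) := by
  rw [← mul_assoc, ← mul_assoc, h.braid_zero_one]

lemma braid_one_zero_mul (h : IsHecke q g) (x : B) :
    g 1 * (g 0 * (g 1 * x)) = g 0 * (g 1 * (g 0 * x)) := by
  rw [← mul_assoc, ← mul_assoc, ← h.braid_zero_one, mul_assoc, mul_assoc]

lemma braid_two_one (h : IsHecke q g) : g 2 * (g 1 * g 2) = g 1 * (g 2 * g 1) := by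
  rw [← mul_assoc, ← mul_assoc, h.braid_one_two]

lemma braid_two_one_mul (h : IsHecke q g) (x : B) :
    g 2 * (g 1 * (g 2 * x)) = g 1 * (g 2 * (g 1 * x)) := by
  rw [← mul_assoc, ← mul_assoc, ← h.braid_one_two, mul_assoc, mul_assoc]

/-- The standard basis words of the subalgebra generated by `g 0`, `g 1`. -/
def threeWords (g : Fin 3 → B) : Set B :=
  {1, g 0, g 1, g 0 * g 1, g 1 * g 0, g 0 * (g 1 * g 0)}

/-- The span of the products of `g 0` and `g 1`. -/
def threeSpan (g : Fin 3 → B) : Submodule ℂ B := Submodule.span ℂ (threeWords g)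

/-- The span of the products of `g 0`, `g 1`, `g 2`. -/
def fourSpan (g : Fin 3 → B) : Submodule ℂ B :=
  threeSpan g ⊔ Submodule.span ℂ {x | ∃ a ∈ threeWords g, ∃ b ∈ threeSpan g, x = a * (g 2 * b)}


lemma forall_threeWords {P : B → Prop} (h1 : P 1) (h2 : P (g 0)) (h3 : P (g 1))
    (h4 : P (g 0 * g 1)) (h5 : P (g 1 * g 0)) (h6 : P (g 0 * (g 1 * g 0))) :
    ∀ x ∈ threeWords g, P x := by
  rintro x (rfl | rfl | rfl | rfl | rfl | rfl) <;> assumption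

lemma mul_mem_of_forall {S T : Submodule ℂ B} {W : Set B} (a : B) (hS : S = Submodule.span ℂ W)
    (h : ∀ x ∈ W, a * x ∈ T) {x : B} (hx : x ∈ S) : a * x ∈ T := by
  subst hS
  exact (Submodule.span_le (p := T.comap (LinearMap.mulLeft ℂ a))).2 h hx

lemma mem_threeSpan_of_mem {x : B} (h : x ∈ threeWords g) : x ∈ threeSpan g :=
  Submodule.subset_span h

lemma zero_mul_mem_threeSpan (h : IsHecke q g) {x : B} (hx : x ∈ threeSpan g) :
    g 0 * x ∈ threeSpan g := by
  have hw : ∀ y ∈ threeWords g, y ∈ threeSpan g := fun y => mem_threeSpan_of_mem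
  refine mul_mem_of_forall _ rfl (forall_threeWords ?_ ?_ ?_ ?_ ?_ ?_) hx
  · rw [mul_one]; exact hw _ (by simp [threeWords])
  · rw [h.sq]
    exact add_mem (hw _ (by simp [threeWords])) (Submodule.smul_mem _ _ (hw _ (by simp [threeWords])))
  · exact hw _ (by simp [threeWords])
  all_goals first
    | (rw [h.sq_mul]
       exact add_mem (hw _ (by simp [threeWords]))
         (Submodule.smul_mem _ _ (hw _ (by simp [threeWords]))))
    | exact hw _ (by simp [threeWords])

lemma one_mul_mem_threeSpan (h : IsHecke q g) {x : B} (hx : x ∈ threeSpan g) :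
    g 1 * x ∈ threeSpan g := by
  have hw : ∀ y ∈ threeWords g, y ∈ threeSpan g := fun y => mem_threeSpan_of_mem
  refine mul_mem_of_forall _ rfl (forall_threeWords ?_ ?_ ?_ ?_ ?_ ?_) hx
  · rw [mul_one]; exact hw _ (by simp [threeWords])
  · exact hw _ (by simp [threeWords])
  · rw [h.sq]
    exact add_mem (hw _ (by simp [threeWords])) (Submodule.smul_mem _ _ (hw _ (by simp [threeWords])))
  · rw [h.braid_one_zero]
    exact hw _ (by simp [threeWords])
  · rw [h.sq_mul]
    exact add_mem (hw _ (by simp [threeWords])) (Submodule.smul_mem _ _ (hw _ (by simp [threeWords])))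
  · rw [h.braid_one_zero_mul, h.sq, mul_add, mul_add, mul_one, mul_smul_comm, mul_smul_comm]
    exact add_mem (hw _ (by simp [threeWords])) (Submodule.smul_mem _ _ (hw _ (by simp [threeWords])))

lemma mul_mem_threeSpan (h : IsHecke q g) {x y : B} (hx : x ∈ threeSpan g)
    (hy : y ∈ threeSpan g) : x * y ∈ threeSpan g := by
  have h0 := @h.zero_mul_mem_threeSpan
  have h1 := @h.one_mul_mem_threeSpan
  refine (Submodule.span_le (p := (threeSpan g).comap (LinearMap.mulRight ℂ y))).2
    (forall_threeWords ?_ ?_ ?_ ?_ ?_ ?_) hx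
  all_goals simp only [SetLike.mem_coe, Submodule.mem_comap, LinearMap.mulRight_apply, one_mul,
    mul_assoc]
  · exact hy
  · exact h0 hy
  · exact h1 hy
  · exact h0 (h1 hy)
  · exact h1 (h0 hy)
  · exact h0 (h1 (h0 hy))

lemma mul_two_mul_mem_fourSpan {a b : B} (ha : a ∈ threeSpan g)
    (hb : b ∈ threeSpan g) : a * (g 2 * b) ∈ fourSpan g := by
  refine (Submodule.span_le (p := (fourSpan g).comap (LinearMap.mulRight ℂ (g 2 * b)))).2 ?_ ha
  exact fun a ha => Submodule.mem_sup_right (Submodule.subset_span ⟨a, ha, b, hb, rfl⟩)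

lemma mul_mem_fourSpan_of_three (h : IsHecke q g) {a x : B} (ha : a ∈ threeSpan g)
    (hx : x ∈ fourSpan g) : a * x ∈ fourSpan g := by
  obtain ⟨y, hy, z, hz, rfl⟩ := Submodule.mem_sup.1 hx
  rw [mul_add]
  refine add_mem (Submodule.mem_sup_left (h.mul_mem_threeSpan ha hy)) ?_
  refine mul_mem_of_forall _ rfl ?_ hz
  rintro _ ⟨c, hc, b, hb, rfl⟩
  rw [← mul_assoc]
  exact mul_two_mul_mem_fourSpan (h.mul_mem_threeSpan ha (mem_threeSpan_of_mem hc)) hb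

/-- This is the heart of H_4 = H_3 + H_3 g₂ H_3. For each of the six basis words `a` of H_3, the
element `g 2 * a * g 2` is rewritten with at most one `g 2` per term, by the quadratic, commutation
or braid relation. -/
lemma two_mul_mem_fourSpan (h : IsHecke q g) {x : B} (hx : x ∈ fourSpan g) :
    g 2 * x ∈ fourSpan g := by
  have one_mem : (1 : B) ∈ threeSpan g := mem_threeSpan_of_mem (by simp [threeWords])
  have h0 := @h.zero_mul_mem_threeSpan
  have h1 := @h.one_mul_mem_threeSpan
  have m0 : g 0 ∈ threeSpan g := mem_threeSpan_of_mem (by simp [threeWords])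
  have m1 : g 1 ∈ threeSpan g := mem_threeSpan_of_mem (by simp [threeWords])
  have m01 : g 0 * g 1 ∈ threeSpan g := h0 m1
  have key : ∀ b ∈ threeSpan g, g 2 * b ∈ fourSpan g := fun b hb => by
    simpa using mul_two_mul_mem_fourSpan one_mem hb
  have key2 : ∀ b ∈ threeSpan g, g 2 * (g 2 * b) ∈ fourSpan g := fun b hb => by
    rw [h.sq_mul]
    exact add_mem (Submodule.mem_sup_left hb) (Submodule.smul_mem _ _ (key b hb))
  obtain ⟨y, hy, z, hz, rfl⟩ := Submodule.mem_sup.1 hx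
  rw [mul_add]
  refine add_mem (key y hy) (mul_mem_of_forall _ rfl ?_ hz)
  rintro _ ⟨a, ha, b, hb, rfl⟩
  revert a
  refine forall_threeWords ?_ ?_ ?_ ?_ ?_ ?_
  · rw [one_mul]
    exact key2 b hb
  · rw [h.comm_mul]
    exact h.mul_mem_fourSpan_of_three m0 (key2 b hb)
  · rw [h.braid_two_one_mul]
    exact mul_two_mul_mem_fourSpan m1 (h1 hb)
  · rw [mul_assoc, h.comm_mul, h.braid_two_one_mul, ← mul_assoc]
    exact mul_two_mul_mem_fourSpan m01 (h1 hb)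
  · rw [mul_assoc, ← h.comm_mul, h.braid_two_one_mul]
    exact mul_two_mul_mem_fourSpan m1 (h1 (h0 hb))
  · rw [mul_assoc, mul_assoc, ← h.comm_mul, h.comm_mul, h.braid_two_one_mul, ← mul_assoc]
    exact mul_two_mul_mem_fourSpan m01 (h1 (h0 hb))

lemma mem_fourSpan_of_mem_adjoin (h : IsHecke q g) {x : B}
    (hx : x ∈ Algebra.adjoin ℂ (Set.range g)) : x ∈ fourSpan g := by
  have one_mem : (1 : B) ∈ threeSpan g := mem_threeSpan_of_mem (by simp [threeWords])
  suffices ∀ y ∈ fourSpan g, x * y ∈ fourSpan g by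
    simpa using this 1 (Submodule.mem_sup_left one_mem)
  induction hx using Algebra.adjoin_induction with
  | mem x hx =>
    obtain ⟨μ, rfl⟩ := hx
    intro y hy
    fin_cases μ
    · exact h.mul_mem_fourSpan_of_three (mem_threeSpan_of_mem (by simp [threeWords])) hy
    · exact h.mul_mem_fourSpan_of_three (mem_threeSpan_of_mem (by simp [threeWords])) hy
    · exact h.two_mul_mem_fourSpan hy
  | algebraMap r =>
    intro y hy
    rw [← Algebra.smul_def]
    exact Submodule.smul_mem _ _ hy
  | add x y _ _ hx hy =>
    intro z hz
    rw [add_mul]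
    exact add_mem (hx z hz) (hy z hz)
  | mul x y _ _ hx hy =>
    intro z hz
    rw [mul_assoc]
    exact hx _ (hy z hz)

/-- A trace functional on a quotient of the Hecke algebra `H_4(q)` that vanishes on the five minimal
representatives of the conjugacy classes of `S_4` is zero. -/
theorem trace_eq_zero (h : IsHecke q g) (τ : B →ₗ[ℂ] ℂ) (hτ : ∀ μ x, τ (g μ * x) = τ (x * g μ))
    (t1 : τ 1 = 0) (t0 : τ (g 0) = 0) (t01 : τ (g 0 * g 1) = 0) (t02 : τ (g 0 * g 2) = 0)
    (t012 : τ (g 0 * (g 1 * g 2)) = 0) {x : B} (hx : x ∈ Algebra.adjoin ℂ (Set.range g)) :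
    τ x = 0 := by
  -- Taking the trace of both sides of the braid relation and using the quadratic relation gives
  -- τ(g₀) = τ(g₁); the terms in τ(g₀g₁) agree.
  have tone : τ (g 1) = 0 := by
    have e1 : τ (g 0 * (g 1 * g 0)) = τ (g 1) + (q - q⁻¹) * τ (g 0 * g 1) := by
      rw [hτ, mul_assoc, h.sq, mul_add, mul_one, mul_smul_comm, map_add, map_smul, hτ 0 (g 1),
        smul_eq_mul]
    have e2 : τ (g 1 * (g 0 * g 1)) = τ (g 0) + (q - q⁻¹) * τ (g 0 * g 1) := by
      rw [hτ, mul_assoc, h.sq, mul_add, mul_one, mul_smul_comm, map_add, map_smul, smul_eq_mul]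
    rw [h.braid_one_zero, e1, t0, t01] at e2
    simpa using e2
  have ttwo : τ (g 2) = 0 := by
    have e1 : τ (g 1 * (g 2 * g 1)) = τ (g 2) + (q - q⁻¹) * τ (g 1 * g 2) := by
      rw [hτ, mul_assoc, h.sq, mul_add, mul_one, mul_smul_comm, map_add, map_smul, hτ 1 (g 2),
        smul_eq_mul]
    have e2 : τ (g 2 * (g 1 * g 2)) = τ (g 1) + (q - q⁻¹) * τ (g 1 * g 2) := by
      rw [hτ, mul_assoc, h.sq, mul_add, mul_one, mul_smul_comm, map_add, map_smul, smul_eq_mul]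
    rw [h.braid_two_one, e1, tone] at e2
    simpa using e2
  -- Conjugation by the Coxeter element `w` shifts the generators: g₁w = wg₀ and g₂w = wg₁. Hence
  -- g₁g₂ is conjugate to g₀g₁. The inverse `w'` is written as a polynomial in the generators, since
  -- `B` is only a ring.
  have t12 : τ (g 1 * g 2) = 0 := by
    set z := q - q⁻¹
    set w := g 0 * (g 1 * g 2) with hw
    set w' := (g 2 - z • 1) * ((g 1 - z • 1) * (g 0 - z • 1)) with hw'
    have hl : ∀ μ x, (g μ - z • 1) * (g μ * x) = x := fun μ x => by
      rw [sub_mul, h.sq_mul, smul_mul_assoc, one_mul, add_sub_cancel_right]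
    have hr : ∀ μ x, g μ * ((g μ - z • 1) * x) = x := fun μ x => by
      rw [← mul_assoc, mul_sub, h.sq, mul_smul_comm, mul_one, add_sub_cancel_right, one_mul]
    have hc : ∀ μ x, τ ((g μ - z • 1) * x) = τ (x * (g μ - z • 1)) := fun μ x => by
      simp [sub_mul, mul_sub, hτ]
    have hww' : w * w' = 1 := by
      have := hr 0 1
      rw [mul_one] at this
      rw [hw, hw', mul_assoc, mul_assoc, hr, hr, this]
    have hw'w : ∀ x, w' * (w * x) = x := fun x => by
      simp only [hw, hw', mul_assoc, hl]
    have hconj : g 1 * (g 2 * w) = w * (g 0 * g 1) := by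
      have e0 : g 1 * w = w * g 0 := by
        rw [hw, h.braid_one_zero_mul, mul_assoc, mul_assoc, h.comm]
      have e1 : g 2 * w = w * g 1 := by
        rw [hw, h.comm_mul, h.braid_two_one, mul_assoc, mul_assoc]
      rw [e1, ← mul_assoc, e0, mul_assoc]
    have hcw : ∀ x, τ (w' * x) = τ (x * w') := fun x => by
      simp only [hw', mul_assoc, hc]
    calc τ (g 1 * g 2) = τ (g 1 * (g 2 * w) * w') := by
          rw [mul_assoc, mul_assoc, hww', mul_one]
      _ = 0 := by rw [hconj, ← hcw, hw'w, t01]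
  have htw : ∀ a ∈ threeWords g, ∀ y, τ (a * y) = τ (y * a) := by
    refine forall_threeWords ?_ ?_ ?_ ?_ ?_ ?_ <;> intro y
    · simp
    · exact hτ 0 y
    · exact hτ 1 y
    · rw [mul_assoc, hτ, mul_assoc, hτ, mul_assoc]
    · rw [mul_assoc, hτ, mul_assoc, hτ, mul_assoc]
    · rw [mul_assoc, hτ, mul_assoc, mul_assoc, hτ, mul_assoc, mul_assoc, hτ]
      simp only [mul_assoc]
  have hthree : ∀ c ∈ threeSpan g, τ c = 0 ∧ τ (g 2 * c) = 0 := by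
    intro c hc
    have : threeSpan g ≤ LinearMap.ker τ ⊓ LinearMap.ker (τ ∘ₗ LinearMap.mulLeft ℂ (g 2)) := by
      refine Submodule.span_le.2 (forall_threeWords ?_ ?_ ?_ ?_ ?_ ?_)
      all_goals
        simp only [SetLike.mem_coe, Submodule.mem_inf, LinearMap.mem_ker, LinearMap.comp_apply,
          LinearMap.mulLeft_apply]
      · simp [t1, ttwo]
      · exact ⟨t0, by rw [← h.comm, t02]⟩
      · exact ⟨tone, by rw [hτ, t12]⟩
      · exact ⟨t01, by rw [hτ, mul_assoc, t012]⟩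
      · refine ⟨by rw [← hτ, t01], ?_⟩
        rw [hτ, mul_assoc, h.comm, ← mul_assoc, ← hτ, t012]
      · constructor
        · rw [hτ, mul_assoc, h.sq, mul_add, mul_one, mul_smul_comm, map_add, map_smul, ← hτ 0,
            tone, t01, smul_zero, add_zero]
        · rw [hτ, mul_assoc, mul_assoc, h.comm, ← mul_assoc, ← mul_assoc, ← hτ, mul_assoc,
            h.sq_mul, map_add, map_smul, t12, t012, smul_zero, add_zero]
    simpa using this hc
  -- By cyclicity τ(a g₂ b) = τ(g₂ b a), and `b * a` lies in H_3.
  have hfour : fourSpan g ≤ LinearMap.ker τ := by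
    refine sup_le (fun c hc => (hthree c hc).1) (Submodule.span_le.2 ?_)
    rintro _ ⟨a, ha, b, hb, rfl⟩
    rw [SetLike.mem_coe, LinearMap.mem_ker, htw a ha, mul_assoc]
    exact (hthree _ (h.mul_mem_threeSpan hb (mem_threeSpan_of_mem ha))).2
  exact hfour (h.mem_fourSpan_of_mem_adjoin hx)

end IsHecke

end

/-! ### Generic `q`, orthogonality of the mixing matrices, and the explicit matrices of `[31]`. -/

section

/-- `q` is a nonzero complex number that is not a root of unity. -/
structure Generic (q : ℂ) : Prop where
  ne_zero : q ≠ 0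
  pow_ne_one (n : ℕ) (hn : 0 < n) : q ^ n ≠ 1

namespace Generic
variable {q : ℂ}

lemma neg_inv (h : Generic q) : Generic (-1 / q) where
  ne_zero := div_ne_zero (by norm_num) h.ne_zero
  pow_ne_one n hn e := by
    apply h.pow_ne_one (2 * n) (by omega)
    have : ((-1 / q) ^ n) ^ 2 = 1 := by rw [e, one_pow]
    rw [← pow_mul, mul_comm, pow_mul, div_pow, neg_one_sq, one_div, inv_pow, inv_eq_one] at this
    rw [pow_mul, this]

lemma br_pow_ne_zero (h : Generic q) {n : ℕ} (hn : 0 < n) : br (q ^ n) ≠ 0 := by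
  have h0 : q ^ n ≠ 0 := pow_ne_zero _ h.ne_zero
  intro e
  apply h.pow_ne_one (2 * n) (by omega)
  rw [br, sub_eq_zero, ← mul_eq_one_iff_eq_inv₀ h0] at e
  rw [mul_comm, pow_mul, sq, e]

lemma br_ne_zero (h : Generic q) : br q ≠ 0 := by
  simpa using h.br_pow_ne_zero one_pos

lemma qNum_two (h : Generic q) : qNum 2 q = (q ^ 2 + 1) / q := by
  have := h.ne_zero
  rw [qNum, div_eq_iff h.br_ne_zero]; simp only [br]; field_simp; ring

lemma qNum_three (h : Generic q) : qNum 3 q = (q ^ 4 + q ^ 2 + 1) / q ^ 2 := by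
  have := h.ne_zero
  rw [qNum, div_eq_iff h.br_ne_zero]; simp only [br]; field_simp; ring

lemma qNum_four (h : Generic q) : qNum 4 q = (q ^ 2 + 1) * (q ^ 4 + 1) / q ^ 3 := by
  have := h.ne_zero
  rw [qNum, div_eq_iff h.br_ne_zero]; simp only [br]; field_simp; ring

/-- This factor and the next ones divide q⁴ - 1, q⁶ - 1 and q⁸ - 1. They are the denominators and
norms that occur below. -/
lemma two_ne_zero (h : Generic q) : q ^ 2 + 1 ≠ 0 := by
  intro e
  refine h.pow_ne_one 4 (by norm_num) ?_
  linear_combination (q ^ 2 - 1) * e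

lemma three_ne_zero (h : Generic q) : q ^ 4 + q ^ 2 + 1 ≠ 0 := by
  intro e
  refine h.pow_ne_one 6 (by norm_num) ?_
  linear_combination (q ^ 2 - 1) * e

lemma three_ne_zero' (h : Generic q) : q ^ 2 * (q ^ 2 + 1) + 1 ≠ 0 := by
  convert h.three_ne_zero using 1; ring

lemma four_ne_zero (h : Generic q) : q ^ 4 + 1 ≠ 0 := by
  intro e
  refine h.pow_ne_one 8 (by norm_num) ?_
  linear_combination (q ^ 4 - 1) * e

lemma sq_sub_one_ne_zero (h : Generic q) : q ^ 2 - 1 ≠ 0 :=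
  sub_ne_zero.2 (h.pow_ne_one 2 (by norm_num))

lemma qNum_three_neg_inv (h : Generic q) : qNum 3 (-1 / q) = qNum 3 q := by
  have := h.ne_zero
  rw [h.neg_inv.qNum_three, h.qNum_three]; field_simp; ring

end Generic

/-- This is why the same root `t` serves the sectors `[31]` and `[211]`. -/
lemma neg_inv_sq (q : ℂ) : (-1 / q) ^ 2 + ((-1 / q) ^ 2)⁻¹ = q ^ 2 + (q ^ 2)⁻¹ := by
  rw [div_pow, neg_one_sq, one_div, inv_inv, add_comm]

variable {q s t : ℂ}

lemma sq_mul_sq_of_qNum (h : Generic q) (hs : s ^ 2 = qNum 3 q) :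
    s ^ 2 * q ^ 2 = q ^ 4 + q ^ 2 + 1 := by
  rw [hs, h.qNum_three, div_mul_cancel₀ _ (pow_ne_zero 2 h.ne_zero)]

lemma sq_mul_sq_of_add_inv (h : Generic q) (ht : t ^ 2 = q ^ 2 + (q ^ 2)⁻¹) :
    t ^ 2 * q ^ 2 = q ^ 4 + 1 := by
  rw [ht, add_mul, inv_mul_cancel₀ (pow_ne_zero 2 h.ne_zero)]; ring

theorem orthogonal_sector31 (h : Generic q) (hs : s ^ 2 = qNum 3 q)
    (ht : t ^ 2 = q ^ 2 + (q ^ 2)⁻¹) : (sector31 q s t).Orthogonal := by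
  have h0 := h.ne_zero
  have h2 := h.two_ne_zero
  have h3 := h.three_ne_zero
  have h3' := h.three_ne_zero'
  replace hs := sq_mul_sq_of_qNum h hs
  replace ht := sq_mul_sq_of_add_inv h ht
  rw [Mixing.Orthogonal, sector31, h.qNum_two, h.qNum_three]
  constructor
  all_goals
    ext i j
    fin_cases i <;> fin_cases j <;> simp [Matrix.mul_apply, Fin.sum_univ_three] <;> field_simp <;>
      grind

theorem orthogonal_sector22 (h : Generic q) (hs : s ^ 2 = qNum 3 q) :
    (sector22 q s).Orthogonal := by
  have h0 := h.ne_zero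
  have h2 := h.two_ne_zero
  replace hs := sq_mul_sq_of_qNum h hs
  rw [Mixing.Orthogonal, sector22, h.qNum_two, h.qNum_four]
  constructor
  all_goals
    ext i j
    fin_cases i <;> fin_cases j <;> simp [Matrix.mul_apply, Fin.sum_univ_two] <;> field_simp <;>
      grind

theorem sector31_hatR_one (h : Generic q) (hs : s ^ 2 = qNum 3 q) :
    (sector31 q s t).hatR 1 =
      !![q, 0, 0;
         0, -(1 / (q ^ 2 * qNum 2 q)), -(s / qNum 2 q);
         0, -(s / qNum 2 q), q ^ 2 / qNum 2 q] := by
  have h0 := h.ne_zero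
  have h2 := h.two_ne_zero
  replace hs := sq_mul_sq_of_qNum h hs
  simp only [Mixing.hatR, sector31, h.qNum_two, cons_val_one, cons_val_zero]
  ext i j
  fin_cases i <;> fin_cases j <;> simp [Matrix.mul_apply, Fin.sum_univ_three] <;> field_simp <;>
      grind

theorem sector31_hatR_two (h : Generic q) (hs : s ^ 2 = qNum 3 q)
    (ht : t ^ 2 = q ^ 2 + (q ^ 2)⁻¹) :
    (sector31 q s t).hatR 2 =
      !![-(1 / (q ^ 3 * qNum 3 q)), -(qNum 2 q * t / qNum 3 q), 0;
         -(qNum 2 q * t / qNum 3 q), q ^ 3 / qNum 3 q, 0;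
         0, 0, q] := by
  have h1 := sector31_hatR_one (t := t) h hs
  have h0 := h.ne_zero
  have h2 := h.two_ne_zero
  have h3 := h.three_ne_zero
  have h3' := h.three_ne_zero'
  replace hs := sq_mul_sq_of_qNum h hs
  replace ht := sq_mul_sq_of_add_inv h ht
  set D := sector31 q s t with hD
  have hUV : D.U * D.V = !![1 / qNum 3 q, qNum 2 q * t / qNum 3 q, 0;
      -(t / qNum 3 q), 1 / (qNum 2 q * qNum 3 q), s / qNum 2 q;
      s * t / qNum 3 q, -(s / (qNum 2 q * qNum 3 q)), 1 / qNum 2 q] := by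
    simp only [hD, sector31, h.qNum_two, h.qNum_three]
    ext i j
    fin_cases i <;> fin_cases j <;> simp [Matrix.mul_apply, Fin.sum_univ_three] <;> field_simp
  change (D.U * D.V) * D.hatR 1 * (D.U * D.V)ᵀ = _
  rw [hUV, h1, h.qNum_two, h.qNum_three]
  ext i j
  fin_cases i <;> fin_cases j <;> simp [Matrix.mul_apply, Fin.sum_univ_three] <;> field_simp <;>
      grind

end

/-! ### The sectors as representations of H_4(q), and their characters. -/

section

variable {q s t : ℂ}

/-- The relations involve `q` only through `q - q⁻¹`, which is unchanged under `q → -1/q`. -/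
lemma IsHecke.of_neg_inv {B : Type*} [Ring B] [Algebra ℂ B] {g : Fin 3 → B}
    (h : IsHecke (-1 / q) g) : IsHecke q g where
  sq μ := by
    rw [h.sq μ]; congr 2
    rw [inv_div, div_neg, div_one]; ring
  comm := h.comm
  braid_zero_one := h.braid_zero_one
  braid_one_two := h.braid_one_two

/-- `U` is a rotation with cosine 1/[2] and sine √[3]/[2]. The entries of `V` are those of the
doubled angle, since [4] = [2](q² + q⁻²). -/
lemma sector22_V (h : Generic q) (hs : s ^ 2 = qNum 3 q) :
    (sector22 q s).V = (sector22 q s).Uᵀ * (sector22 q s).Uᵀ := by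
  have h0 := h.ne_zero
  have h2 := h.two_ne_zero
  replace hs := sq_mul_sq_of_qNum h hs
  simp only [sector22, h.qNum_two, h.qNum_four]
  ext i j
  fin_cases i <;> fin_cases j <;> simp [Matrix.mul_apply, Fin.sum_univ_two] <;> field_simp <;>
      grind

theorem sector22_V_eq_zpow (h : Generic q) (hs : s ^ 2 = qNum 3 q) :
    (sector22 q s).V = (sector22 q s).U ^ (-2 : ℤ) := by
  have hU := mul_eq_one_comm.1 (orthogonal_sector22 h hs).1
  rw [sector22_V h hs, ← Matrix.inv_eq_left_inv hU, 
    show (-2 : ℤ) = -((2 : ℕ) : ℤ) from rfl, Matrix.zpow_neg_natCast, pow_two,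
    Matrix.mul_inv_rev]

/-- Since V = U⁻², one has UV = Uᵀ, and conjugation by it undoes the conjugation by `U` in R₂. -/
theorem sector22_hatR_two (h : Generic q) (hs : s ^ 2 = qNum 3 q) :
    (sector22 q s).hatR 2 = (sector22 q s).R1 := by
  have hU := (orthogonal_sector22 h hs).1
  have hU' := mul_eq_one_comm.1 hU
  set D := sector22 q s with hD
  have hUV : D.U * D.V = D.Uᵀ := by
    rw [hD, sector22_V h hs, ← hD, ← mul_assoc, hU, one_mul]
  change (D.U * D.V) * (D.U * D.R1 * D.Uᵀ) * (D.U * D.V)ᵀ = _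
  rw [hUV, transpose_transpose, mul_assoc, mul_assoc, hU', mul_one, ← mul_assoc, hU', one_mul]

theorem sector22_hatR_one (h : Generic q) (hs : s ^ 2 = qNum 3 q) :
    (sector22 q s).hatR 1 =
      !![-(1 / (q ^ 2 * qNum 2 q)), -(s / qNum 2 q);
         -(s / qNum 2 q), q ^ 2 / qNum 2 q] := by
  have h0 := h.ne_zero
  have h2 := h.two_ne_zero
  replace hs := sq_mul_sq_of_qNum h hs
  simp only [Mixing.hatR, sector22, h.qNum_two, cons_val_one, cons_val_zero]
  ext i j
  fin_cases i <;> fin_cases j <;> simp [Matrix.mul_apply, Fin.sum_univ_two] <;> field_simp <;>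
      grind

lemma sector31_hatR_zero : (sector31 q s t).hatR 0 = !![q, 0, 0; 0, q, 0; 0, 0, -1 / q] := rfl

lemma sector22_hatR_zero : (sector22 q s).hatR 0 = !![q, 0; 0, -1 / q] := rfl

/-- The relations are checked on the explicit entries, without reference to multiplicity spaces, so
that the trace formula does not depend on the decomposition of tensor space. -/
theorem isHecke_sector31 (h : Generic q) (hs : s ^ 2 = qNum 3 q)
    (ht : t ^ 2 = q ^ 2 + (q ^ 2)⁻¹) : IsHecke q (sector31 q s t).hatR := by
  have r1 := sector31_hatR_one (t := t) h hs
  have r2 := sector31_hatR_two h hs ht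
  have h0 := h.ne_zero
  have h2 := h.two_ne_zero
  have h3 := h.three_ne_zero
  have h3' := h.three_ne_zero'
  replace hs := sq_mul_sq_of_qNum h hs
  replace ht := sq_mul_sq_of_add_inv h ht
  rw [h.qNum_two] at r1
  rw [h.qNum_two, h.qNum_three] at r2
  constructor
  · intro μ
    fin_cases μ
    · simp only [Fin.zero_eta, sector31_hatR_zero]
      ext i j
      fin_cases i <;> fin_cases j <;> simp [Matrix.mul_apply, Fin.sum_univ_three] <;> field_simp <;>
        grind
    · simp only [Fin.mk_one, r1]
      ext i j
      fin_cases i <;> fin_cases j <;> simp [Matrix.mul_apply, Fin.sum_univ_three] <;> field_simp <;>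
        grind
    · simp only [Fin.reduceFinMk, r2]
      ext i j
      fin_cases i <;> fin_cases j <;> simp [Matrix.mul_apply, Fin.sum_univ_three] <;> field_simp <;>
        grind
  · rw [sector31_hatR_zero, r2]
    ext i j
    fin_cases i <;> fin_cases j <;> simp [Matrix.mul_apply, Fin.sum_univ_three] <;> field_simp
  · rw [sector31_hatR_zero, r1]
    ext i j
    fin_cases i <;> fin_cases j <;> simp [Matrix.mul_apply, Fin.sum_univ_three] <;> field_simp <;>
      grind
  · rw [r1, r2]
    ext i j
    fin_cases i <;> fin_cases j <;> simp [Matrix.mul_apply, Fin.sum_univ_three] <;> field_simp <;>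
      grind

theorem isHecke_sector22 (h : Generic q) (hs : s ^ 2 = qNum 3 q) :
    IsHecke q (sector22 q s).hatR := by
  have r1 := sector22_hatR_one h hs
  have r2 : (sector22 q s).hatR 2 = (sector22 q s).hatR 0 := sector22_hatR_two h hs
  have h0 := h.ne_zero
  have h2 := h.two_ne_zero
  replace hs := sq_mul_sq_of_qNum h hs
  rw [h.qNum_two] at r1
  have sq0 : (sector22 q s).hatR 0 * (sector22 q s).hatR 0 =
      1 + (q - q⁻¹) • (sector22 q s).hatR 0 := by
    rw [sector22_hatR_zero]
    ext i j
    fin_cases i <;> fin_cases j <;> simp [Matrix.mul_apply, Fin.sum_univ_two] <;> field_simp <;>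
      grind
  have br : (sector22 q s).hatR 0 * (sector22 q s).hatR 1 * (sector22 q s).hatR 0 =
      (sector22 q s).hatR 1 * (sector22 q s).hatR 0 * (sector22 q s).hatR 1 := by
    rw [sector22_hatR_zero, r1]
    ext i j
    fin_cases i <;> fin_cases j <;> simp [Matrix.mul_apply, Fin.sum_univ_two] <;> field_simp <;>
      grind
  refine ⟨fun μ => ?_, by rw [r2], br, by rw [r2, br]⟩
  fin_cases μ
  · exact sq0
  · simp only [Fin.mk_one, r1]
    ext i j
    fin_cases i <;> fin_cases j <;> simp [Matrix.mul_apply, Fin.sum_univ_two] <;> field_simp <;>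
      grind
  · simp only [Fin.reduceFinMk, r2]
    exact sq0

lemma sector4_hatR (μ : Fin 3) : (sector4 q).hatR μ = !![q] := by
  fin_cases μ <;> simp [Mixing.hatR, sector4]

theorem isHecke_sector4 (hq : q ≠ 0) : IsHecke q (sector4 q).hatR where
  sq μ := by
    rw [sector4_hatR]
    ext i j
    fin_cases i; fin_cases j
    simp; field_simp; ring
  comm := by simp only [sector4_hatR]
  braid_zero_one := by simp only [sector4_hatR]
  braid_one_two := by simp only [sector4_hatR]

lemma orthogonal_sector4 : (sector4 q).Orthogonal := by
  simp [Mixing.Orthogonal, sector4]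

/-- R₂ and R₃ are conjugates of R₁ by the orthogonal matrices `U` and `UVU`, so their integer powers
are conjugates of powers of R₁. Between the two factors `Uᵀ` cancels against `U`. -/
theorem Mixing.braidValue_eq_mixedValue {n : ℕ} {D : Mixing n} (hD : D.Orthogonal)
    (hR : IsUnit D.R1) (w : List (ℤ × ℤ × ℤ)) : braidValue D.hatR w = D.mixedValue w := by
  have hU := hD.1
  have hU' := mul_eq_one_comm.1 hU
  have hV := hD.2
  have hV' := mul_eq_one_comm.1 hV
  have conj : ∀ (A : Matrix (Fin n) (Fin n) ℂ), A * Aᵀ = 1 → ∀ m : ℤ,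
      (A * D.R1 * Aᵀ) ^ m = A * D.R1 ^ m * Aᵀ := by
    intro A hA m
    have hA' := mul_eq_one_comm.1 hA
    have hu : IsUnit A := isUnit_iff_exists.2 ⟨Aᵀ, hA, hA'⟩
    have hu' : IsUnit Aᵀ := isUnit_iff_exists.2 ⟨A, hA', hA⟩
    have := Matrix.SemiconjBy.zpow_right ((isUnit_iff_isUnit_det _).1 hR)
      ((isUnit_iff_isUnit_det _).1 ((hu.mul hR).mul hu'))
      (show SemiconjBy A D.R1 (A * D.R1 * Aᵀ) by
        rw [SemiconjBy, mul_assoc, mul_assoc, hA', mul_one]) m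
    rw [this.eq, mul_assoc _ A, hA, mul_one]
  unfold braidValue Mixing.mixedValue
  congr 2
  funext ⟨a, b, c⟩
  have h2 : D.hatR 2 = (D.U * D.V * D.U) * D.R1 * (D.U * D.V * D.U)ᵀ := by
    simp only [Mixing.hatR, cons_val, transpose_mul, mul_assoc]
  have hW : (D.U * D.V * D.U) * (D.U * D.V * D.U)ᵀ = 1 := by
    simp only [transpose_mul, mul_assoc]
    rw [← mul_assoc D.U D.Uᵀ, hU, one_mul, ← mul_assoc D.V, hV, one_mul, hU]
  rw [h2, conj _ hW, show D.hatR 1 = D.U * D.R1 * D.Uᵀ from rfl, conj _ hU]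
  simp only [transpose_mul, mul_assoc]
  rw [← mul_assoc D.Uᵀ D.U, hU', one_mul]
  rfl

lemma IsHecke.mul_inv {B : Type*} [Ring B] [Algebra ℂ B] {g : Fin 3 → B}
    (h : IsHecke q g) (μ : Fin 3) : g μ * (g μ - (q - q⁻¹) • 1) = 1 := by
  rw [mul_sub, h.sq, mul_smul_comm, mul_one, add_sub_cancel_right]

lemma IsHecke.inv_mul {B : Type*} [Ring B] [Algebra ℂ B] {g : Fin 3 → B}
    (h : IsHecke q g) (μ : Fin 3) : (g μ - (q - q⁻¹) • 1) * g μ = 1 := by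
  rw [sub_mul, h.sq, smul_mul_assoc, one_mul, add_sub_cancel_right]

lemma IsHecke.isUnit {B : Type*} [Ring B] [Algebra ℂ B] {g : Fin 3 → B}
    (h : IsHecke q g) (μ : Fin 3) : IsUnit (g μ) :=
  isUnit_iff_exists.2 ⟨_, h.mul_inv μ, h.inv_mul μ⟩

/-- The values of a functional on the five minimal representatives of the conjugacy classes. -/
def classValues {B : Type*} [Ring B] (τ : B → ℂ) (g : Fin 3 → B) : Fin 5 → ℂ :=
  ![τ 1, τ (g 0), τ (g 0 * g 1), τ (g 0 * g 2), τ (g 0 * (g 1 * g 2))]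

lemma classValues_sector4 :
    classValues trace (sector4 q).hatR = ![1, q, q ^ 2, q ^ 2, q ^ 3] := by
  simp only [classValues, sector4_hatR]
  ext i
  fin_cases i <;> simp [trace] <;> ring

/-- At `q = 1` these values are the character 3, 1, 0, -1, -1 of S_4. -/
lemma classValues_sector31 (h : Generic q) (hs : s ^ 2 = qNum 3 q)
    (ht : t ^ 2 = q ^ 2 + (q ^ 2)⁻¹) :
    classValues trace (sector31 q s t).hatR =
      ![3, 2 * q - q⁻¹, q ^ 2 - 1, q ^ 2 - 2, -q] := by
  have h0 := h.ne_zero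
  have h2 := h.two_ne_zero
  have h3 := h.three_ne_zero
  have h3' := h.three_ne_zero'
  rw [classValues, sector31_hatR_one h hs, sector31_hatR_two h hs ht, sector31_hatR_zero,
    h.qNum_two, h.qNum_three]
  ext i
  fin_cases i <;> simp [trace, Fin.sum_univ_three] <;> field_simp <;> ring

lemma classValues_sector22 (h : Generic q) (hs : s ^ 2 = qNum 3 q) :
    classValues trace (sector22 q s).hatR =
      ![2, q - q⁻¹, -1, q ^ 2 + (q ^ 2)⁻¹, 0] := by
  have h0 := h.ne_zero
  have h2 := h.two_ne_zero
  have r2 : (sector22 q s).hatR 2 = (sector22 q s).hatR 0 := sector22_hatR_two h hs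
  rw [classValues, r2, sector22_hatR_one h hs, sector22_hatR_zero, h.qNum_two]
  ext i
  fin_cases i <;> simp [trace, Fin.sum_univ_two] <;> field_simp <;> ring

end

/-! ### Braids in abstract quotients, and the Markov property of the weighted trace. -/

section

variable {q : ℂ}

section BraidPoly
variable {B C : Type*} [Ring B] [Algebra ℂ B] [Ring C] [Algebra ℂ C]

/-- The power `b ^ n` of an invertible element with `b⁻¹ = b - (q - q⁻¹)`. -/
def heckePow (q : ℂ) (b : B) : ℤ → B
  | Int.ofNat n => b ^ n
  | Int.negSucc n => (b - (q - q⁻¹) • 1) ^ (n + 1)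

/-- The value of a braid in a quotient of the Hecke algebra. -/
def heckeBraid (q : ℂ) (g : Fin 3 → B) (w : List (ℤ × ℤ × ℤ)) : B :=
  (w.map fun t => heckePow q (g 0) t.1 * heckePow q (g 1) t.2.1 * heckePow q (g 2) t.2.2).prod

/-- Inverses are written as polynomials in the generator, hence are preserved by every algebra
homomorphism and stay inside every subalgebra. -/
lemma map_heckePow (f : B →ₐ[ℂ] C) (b : B) (n : ℤ) :
    f (heckePow q b n) = heckePow q (f b) n := by
  cases n <;> simp [heckePow]

lemma map_heckeBraid (f : B →ₐ[ℂ] C) (g : Fin 3 → B) (w : List (ℤ × ℤ × ℤ)) :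
    f (heckeBraid q g w) = heckeBraid q (fun μ => f (g μ)) w := by
  rw [heckeBraid, heckeBraid, map_list_prod, List.map_map]
  congr 2
  funext t
  simp [map_heckePow]

lemma heckePow_mem (S : Subalgebra ℂ B) {b : B} (hb : b ∈ S) (n : ℤ) : heckePow q b n ∈ S := by
  cases n with
  | ofNat n => exact pow_mem hb n
  | negSucc n => exact pow_mem (sub_mem hb (S.smul_mem S.one_mem _)) _

lemma heckeBraid_mem_adjoin (g : Fin 3 → B) (w : List (ℤ × ℤ × ℤ)) :
    heckeBraid q g w ∈ Algebra.adjoin ℂ (Set.range g) := by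
  have hg : ∀ μ, g μ ∈ Algebra.adjoin ℂ (Set.range g) := fun μ =>
    Algebra.subset_adjoin (Set.mem_range_self μ)
  refine list_prod_mem fun x hx => ?_
  obtain ⟨t, -, rfl⟩ := List.mem_map.1 hx
  exact mul_mem (mul_mem (heckePow_mem _ (hg 0) _) (heckePow_mem _ (hg 1) _))
    (heckePow_mem _ (hg 2) _)

lemma IsHecke.heckeBraid_eq_braidValue {n : Type*} [Fintype n] [DecidableEq n]
    {g : Fin 3 → Matrix n n ℂ} (h : IsHecke q g) (w : List (ℤ × ℤ × ℤ)) :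
    heckeBraid q g w = braidValue g w := by
  have hp : ∀ μ k, heckePow q (g μ) k = g μ ^ k := by
    intro μ k
    cases k with
    | ofNat k => simp [heckePow]
    | negSucc k =>
      rw [heckePow, zpow_negSucc, ← Matrix.inv_pow', Matrix.inv_eq_left_inv (h.inv_mul μ)]
  simp only [heckeBraid, braidValue, hp]

/-- In a product of algebras, traces taken in different representations combine into a single
functional. -/
lemma IsHecke.prodMk {g : Fin 3 → B} {g' : Fin 3 → C} (h : IsHecke q g) (h' : IsHecke q g') :
    IsHecke q (fun μ => (g μ, g' μ)) where
  sq μ := by simp [Prod.ext_iff, h.sq μ, h'.sq μ]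
  comm := by simp [h.comm, h'.comm]
  braid_zero_one := by simp [h.braid_zero_one, h'.braid_zero_one]
  braid_one_two := by simp [h.braid_one_two, h'.braid_one_two]

end BraidPoly

/-- The weight of `T_x` under `(q^ρ)^{⊗4}`. -/
def rhoWeight {N : ℕ} (q : ℂ) (x : Idx N) : ℂ := ∏ k, q ^ ((N : ℤ) - 1 - 2 * ((x k : ℕ) : ℤ))

lemma qTrace_eq_trace (N : ℕ) (M : Matrix (Idx N) (Idx N) ℂ) :
    qTrace N q M = trace (diagonal (rhoWeight q) * M) := by
  simp [qTrace, trace, rhoWeight]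

/-- The weight of a word depends only on its letters and not on their order. This makes the weighted
trace cyclic for the `R`-matrices. -/
lemma diagonal_mul_strandR (N : ℕ) (μ : Fin 3) :
    diagonal (rhoWeight q) * strandR N q μ = strandR N q μ * diagonal (rhoWeight q) := by
  ext x y
  rw [diagonal_mul, mul_diagonal, strandR_apply]
  have hw : rhoWeight q (swapAt μ x) = rhoWeight q x :=
    Equiv.prod_comp (Equiv.swap μ.castSucc μ.succ)
      fun k => q ^ ((N : ℤ) - 1 - 2 * ((x k : ℕ) : ℤ))
  by_cases h1 : x = y
  · rw [h1, mul_comm]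
  by_cases h2 : swapAt μ x = y
  · rw [← h2, hw, mul_comm]
  simp [h1, h2]

/-- The weighted trace as a linear functional. -/
def qTraceLinear (N : ℕ) (q : ℂ) : Matrix (Idx N) (Idx N) ℂ →ₗ[ℂ] ℂ :=
  traceLinearMap (Idx N) ℂ ℂ ∘ₗ LinearMap.mulLeft ℂ (diagonal (rhoWeight q))

lemma qTraceLinear_apply (N : ℕ) (M : Matrix (Idx N) (Idx N) ℂ) :
    qTraceLinear N q M = qTrace N q M := by
  rw [qTrace_eq_trace]; rfl

lemma qTrace_strandR_mul_comm (N : ℕ) (μ : Fin 3) (M : Matrix (Idx N) (Idx N) ℂ) :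
    qTrace N q (strandR N q μ * M) = qTrace N q (M * strandR N q μ) := by
  rw [qTrace_eq_trace, qTrace_eq_trace, ← mul_assoc, diagonal_mul_strandR, mul_assoc, trace_mul_comm,
    mul_assoc]

/-- The weighted partial trace of `R` over its first strand is the scalar `q ^ N`. The sum
telescopes: each letter `a < b` contributes q^(N-2a) - q^(N-2a-2), the letter `b` contributes
q^(N-2b), and larger letters contribute nothing. -/
lemma sum_rho_mul_rDiag (hq : q ≠ 0) {N : ℕ} (b : Fin N) :
    ∑ a : Fin N, q ^ ((N : ℤ) - 1 - 2 * ((a : ℕ) : ℤ)) * rDiag q a b = q ^ N := by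
  have key : ∀ n : ℕ, ∑ a ∈ Finset.range n, q ^ ((N : ℤ) - 1 - 2 * (a : ℤ)) *
      (if a = b then q else if a < b then q - q⁻¹ else 0) =
      q ^ (N : ℤ) - if n ≤ b then q ^ ((N : ℤ) - 2 * n) else 0 := by
    intro n
    induction n with
    | zero => simp
    | succ n ih =>
      rw [Finset.sum_range_succ, ih]
      have e1 : q ^ ((N : ℤ) - 1 - 2 * (n : ℤ)) = q ^ ((N : ℤ) - 2 * n) * q⁻¹ := by
        rw [← zpow_sub_one₀ hq]; congr 1; ring
      have e2 : q ^ ((N : ℤ) - 2 * ((n + 1 : ℕ) : ℤ)) = q ^ ((N : ℤ) - 2 * n) * q⁻¹ * q⁻¹ := by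
        rw [← zpow_sub_one₀ hq, ← zpow_sub_one₀ hq]; congr 1; push_cast; ring
      rw [e1, e2]
      rcases lt_trichotomy n b with h | h | h
      · rw [if_neg h.ne, if_pos h, if_pos h.le, if_pos (Nat.succ_le_of_lt h)]
        field_simp; ring
      · rw [if_pos h, if_pos h.le, if_neg (by omega)]
        field_simp; ring
      · rw [if_neg h.ne', if_neg h.not_gt, if_neg (by omega), if_neg (by omega)]
        ring
  have := key N
  rw [if_neg (by omega), sub_zero, zpow_natCast, ← Fin.sum_univ_eq_sum_range (fun a =>
    q ^ ((N : ℤ) - 1 - 2 * (a : ℤ)) * (if a = (b : ℕ) then q else if a < b then q - q⁻¹ else 0))]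
    at this
  simpa only [rDiag, Fin.ext_iff, Fin.lt_def] using this

lemma sum_rho (h : Generic q) (N : ℕ) :
    ∑ a : Fin N, q ^ ((N : ℤ) - 1 - 2 * ((a : ℕ) : ℤ)) = br (q ^ N) / br q := by
  have hq := h.ne_zero
  rw [eq_div_iff h.br_ne_zero]
  have key : ∀ n : ℕ, (∑ a ∈ Finset.range n, q ^ ((N : ℤ) - 1 - 2 * (a : ℤ))) * br q =
      q ^ (N : ℤ) - q ^ ((N : ℤ) - 2 * n) := by
    intro n
    induction n with
    | zero => simp
    | succ n ih =>
      rw [Finset.sum_range_succ, add_mul, ih]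
      have e1 : q ^ ((N : ℤ) - 1 - 2 * (n : ℤ)) = q ^ ((N : ℤ) - 2 * n) * q⁻¹ := by
        rw [← zpow_sub_one₀ hq]; congr 1; ring
      have e2 : q ^ ((N : ℤ) - 2 * ((n + 1 : ℕ) : ℤ)) = q ^ ((N : ℤ) - 2 * n) * q⁻¹ * q⁻¹ := by
        rw [← zpow_sub_one₀ hq, ← zpow_sub_one₀ hq]; congr 1; push_cast; ring
      rw [e1, e2, br]
      field_simp; ring
  rw [Fin.sum_univ_eq_sum_range (fun a => q ^ ((N : ℤ) - 1 - 2 * (a : ℤ))), key, br, zpow_natCast,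
    ← zpow_natCast, ← _root_.zpow_neg]
  congr 2; ring

/-- The matrix acts as the identity on the strand `k`. -/
def FixesStrand {N : ℕ} (k : Fin 4) (M : Matrix (Idx N) (Idx N) ℂ) : Prop :=
  ∃ m : Matrix (Fin 3 → Fin N) (Fin 3 → Fin N) ℂ,
    ∀ x y, M x y = if x k = y k then m (k.removeNth x) (k.removeNth y) else 0

lemma sum_idx {N : ℕ} (k : Fin 4) (f : Idx N → ℂ) :
    ∑ x, f x = ∑ z : Fin 3 → Fin N, ∑ a, f (k.insertNth a z) := by
  rw [← (Fin.insertNthEquiv (fun _ => Fin N) k).sum_comp, Fintype.sum_prod_type, Finset.sum_comm]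
  rfl

lemma FixesStrand.mul {N : ℕ} {k : Fin 4} {M M' : Matrix (Idx N) (Idx N) ℂ}
    (h : FixesStrand k M) (h' : FixesStrand k M') : FixesStrand k (M * M') := by
  obtain ⟨m, hm⟩ := h
  obtain ⟨m', hm'⟩ := h'
  refine ⟨m * m', fun x y => ?_⟩
  rw [mul_apply, sum_idx k]
  simp only [hm, hm', Fin.insertNth_apply_same, Fin.removeNth_insertNth]
  by_cases hk : x k = y k
  · simp [hk, mul_apply]
  · simp [hk]

lemma rhoWeight_insertNth {N : ℕ} (k : Fin 4) (a : Fin N) (z : Fin 3 → Fin N) :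
    rhoWeight q (k.insertNth a z : Idx N) = q ^ ((N : ℤ) - 1 - 2 * ((a : ℕ) : ℤ)) *
      ∏ j, q ^ ((N : ℤ) - 1 - 2 * ((z j : ℕ) : ℤ)) := by
  rw [rhoWeight, Fin.prod_univ_succAbove _ k]
  simp

/-- Markov property with denominators cleared: summing over the letter on the strand that `M` fixes
gives `q ^ N` when `R` is present and the quantum dimension [N] when it is not. -/
theorem qTrace_strandR_mul (h : Generic q) {N : ℕ} (μ : Fin 3) {M : Matrix (Idx N) (Idx N) ℂ}
    (hM : FixesStrand μ.castSucc M) :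
    qTrace N q (strandR N q μ * M) * (br (q ^ N) / br q) = q ^ N * qTrace N q M := by
  obtain ⟨m, hm⟩ := hM
  -- The swapping part of `R` drops out. `M` preserves the letter on strand `μ`, so it could
  -- contribute only when the two swapped letters are equal, and then its entry is zero.
  have hdiag : ∀ x, (strandR N q μ * M) x x = rDiag q (x μ.castSucc) (x μ.succ) * M x x := by
    intro x
    simp only [mul_apply, strandR_apply, add_mul, Finset.sum_add_distrib, ite_mul, zero_mul,
      one_mul, Finset.sum_ite_eq, Finset.mem_univ, if_true]
    rw [add_eq_left]
    split_ifs with hx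
    · rfl
    · rw [hm, if_neg]
      simpa [swapAt] using Ne.symm hx
  change (∑ x, rhoWeight q x * (strandR N q μ * M) x x) * _ = _ * ∑ x, rhoWeight q x * M x x
  simp only [hdiag, hm, if_true]
  rw [sum_idx μ.castSucc, sum_idx μ.castSucc, Finset.sum_mul, Finset.mul_sum]
  refine Finset.sum_congr rfl fun z _ => ?_
  have hsucc : ∀ a : Fin N, (μ.castSucc.insertNth a z : Idx N) μ.succ = z μ := by
    intro a
    rw [← Fin.succAbove_castSucc_self, Fin.insertNth_apply_succAbove]
  simp only [rhoWeight_insertNth, Fin.insertNth_apply_same, Fin.removeNth_insertNth, hsucc]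
  set W := ∏ j, q ^ ((N : ℤ) - 1 - 2 * ((z j : ℕ) : ℤ))
  have e1 : ∑ a : Fin N, q ^ ((N : ℤ) - 1 - 2 * ((a : ℕ) : ℤ)) * W * (rDiag q a (z μ) * m z z) =
      q ^ N * (W * m z z) := by
    rw [← sum_rho_mul_rDiag h.ne_zero (z μ), Finset.sum_mul]
    exact Finset.sum_congr rfl fun a _ => by ring
  have e2 : ∑ a : Fin N, q ^ ((N : ℤ) - 1 - 2 * ((a : ℕ) : ℤ)) * W * m z z =
      (br (q ^ N) / br q) * (W * m z z) := by
    rw [← sum_rho h, Finset.sum_mul]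
    exact Finset.sum_congr rfl fun a _ => by ring
  rw [e1, e2]
  ring

lemma eq_iff_removeNth {N : ℕ} (k : Fin 4) (x y : Idx N) :
    x = y ↔ x k = y k ∧ k.removeNth x = k.removeNth y := by
  constructor
  · rintro rfl; exact ⟨rfl, rfl⟩
  · rintro ⟨h1, h2⟩
    rw [← Fin.insertNth_self_removeNth k x, ← Fin.insertNth_self_removeNth k y, h1, h2]

lemma fixesStrand_one {N : ℕ} (k : Fin 4) : FixesStrand k (1 : Matrix (Idx N) (Idx N) ℂ) := by
  refine ⟨1, fun x y => ?_⟩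
  simp only [one_apply, eq_iff_removeNth k x y, ite_and]

lemma fixesStrand_strandR {N : ℕ} {k : Fin 4} {μ : Fin 3} (h : k < μ.castSucc) :
    FixesStrand k (strandR N q μ) := by
  have h' : k < μ.succ := h.trans Fin.castSucc_lt_succ
  -- `i` and `j` are the positions of the two braided strands after strand `k` has been removed.
  obtain ⟨i, hi⟩ := Fin.exists_succAbove_eq h.ne'
  obtain ⟨j, hj⟩ := Fin.exists_succAbove_eq h'.ne'
  refine ⟨fun z z' => (if z = z' then rDiag q (z i) (z j) else 0) +
    (if z ∘ Equiv.swap i j = z' then (if z i = z j then 0 else 1) else 0), fun x y => ?_⟩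
  have h1 : swapAt μ x k = x k := by
    rw [swapAt, Function.comp_apply, Equiv.swap_apply_of_ne_of_ne h.ne h'.ne]
  have h2 : k.removeNth (swapAt μ x) = k.removeNth x ∘ Equiv.swap i j := by
    ext1 l
    simp only [swapAt, Fin.removeNth, Function.comp_apply, ← hi, ← hj]
    rw [Fin.succAbove_right_injective.swap_apply]
  rw [strandR_apply]
  simp only [eq_iff_removeNth k _ y, h1, h2, ← hi, ← hj, Fin.removeNth]
  by_cases hk : x k = y k
  · simp [hk]; congr
  · simp [hk]

lemma qTrace_one (h : Generic q) (N : ℕ) : qTrace N q 1 = (br (q ^ N) / br q) ^ 4 := by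
  rw [← sum_rho h]
  simp only [qTrace, one_apply_eq, mul_one]
  rw [← Fintype.piFinset_univ, ← Finset.prod_univ_sum (fun _ => Finset.univ)
    (fun (_ : Fin 4) (a : Fin N) => q ^ ((N : ℤ) - 1 - 2 * ((a : ℕ) : ℤ)))]
  simp

/-- The strands are removed from the left: in each representative the later generators fix the first
strand of the leftmost one. The hypothesis `1 ≤ N` makes the quantum dimension nonzero, so that it
can be cancelled. -/
theorem classValues_qTrace (h : Generic q) {N : ℕ} (hN : 1 ≤ N) :
    classValues (qTrace N q) (strandR N q) =
      ![(br (q ^ N) / br q) ^ 4, q ^ N * (br (q ^ N) / br q) ^ 3,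
        (q ^ N) ^ 2 * (br (q ^ N) / br q) ^ 2, (q ^ N) ^ 2 * (br (q ^ N) / br q) ^ 2,
        (q ^ N) ^ 3 * (br (q ^ N) / br q)] := by
  have hx : br (q ^ N) / br q ≠ 0 := div_ne_zero (h.br_pow_ne_zero hN) h.br_ne_zero
  have h1 := qTrace_one h N
  set x := br (q ^ N) / br q
  have single : ∀ μ, qTrace N q (strandR N q μ) = q ^ N * x ^ 3 := by
    intro μ
    have := qTrace_strandR_mul h μ (fixesStrand_one (N := N) μ.castSucc)
    rw [mul_one, h1] at this
    exact mul_right_cancel₀ hx (by rw [this]; ring)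
  have pair : ∀ μ ν : Fin 3, μ < ν → qTrace N q (strandR N q μ * strandR N q ν) =
      (q ^ N) ^ 2 * x ^ 2 := by
    intro μ ν hμ
    have := qTrace_strandR_mul h μ (fixesStrand_strandR (N := N) (q := q) (μ := ν) (k := μ.castSucc)
      (by simpa using hμ))
    rw [single] at this
    exact mul_right_cancel₀ hx (by rw [this]; ring)
  have triple : qTrace N q (strandR N q 0 * (strandR N q 1 * strandR N q 2)) =
      (q ^ N) ^ 3 * x := by
    have f : ∀ ν : Fin 3, 0 < ν → FixesStrand (Fin.castSucc 0) (strandR N q ν) := fun ν hν =>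
      fixesStrand_strandR (by simpa using hν)
    have := qTrace_strandR_mul h 0 ((f 1 (by decide)).mul (f 2 (by decide)))
    rw [pair 1 2 (by decide)] at this
    exact mul_right_cancel₀ hx (by rw [this]; ring)
  rw [classValues, h1, single, pair 0 1 (by decide), pair 0 2 (by decide), triple]

end

/-! ### The functions `S_Q^*` and the five identities behind the trace formula. -/

section

variable {q s t : ℂ}

/-- Row and column lengths are replaced by cardinalities, so that for a concrete diagram the cells
and the hook lengths `f` can be found by `decide`. -/
lemma schurStar_of_cells {Q : YoungDiagram} {S : Finset (ℕ × ℕ)} (hS : Q.cells = S)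
    (f : ℕ × ℕ → ℕ) (hf : ∀ c ∈ S, (Q.row c.1).card - (c.2 + 1) +
      ((Q.col c.2).card - (c.1 + 1)) + 1 = f c) (q A : ℂ) :
    schurStar Q q A = ∏ c ∈ S, br (A * q ^ ((c.2 : ℤ) - (c.1 : ℤ))) / br (q ^ f c) := by
  rw [schurStar, hS]
  refine Finset.prod_congr rfl fun c hc => ?_
  rw [← hf c hc, hookLength, YoungDiagram.rowLen_eq_card, YoungDiagram.colLen_eq_card]

lemma schurStar_Y4 (q A : ℂ) : schurStar Y4 q A =
    br A / br (q ^ 4) * (br (A * q) / br (q ^ 3)) * (br (A * q ^ 2) / br (q ^ 2)) *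
      (br (A * q ^ 3) / br q) := by
  rw [schurStar_of_cells (S := {(0, 0), (0, 1), (0, 2), (0, 3)}) (by decide) (fun c => 4 - c.2)
    (by decide)]
  simp
  ring

lemma schurStar_Y31 (q A : ℂ) : schurStar Y31 q A =
    br A / br (q ^ 4) * (br (A * q) / br (q ^ 2)) * (br (A * q ^ 2) / br q) *
      (br (A * q⁻¹) / br q) := by
  rw [schurStar_of_cells (S := {(0, 0), (0, 1), (0, 2), (1, 0)}) (by decide)
    (fun c => if c = (0, 0) then 4 else if c = (0, 1) then 2 else 1) (by decide)]
  simp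
  ring

lemma schurStar_Y22 (q A : ℂ) : schurStar Y22 q A =
    br A / br (q ^ 3) * (br (A * q) / br (q ^ 2)) * (br A / br q) *
      (br (A * q⁻¹) / br (q ^ 2)) := by
  rw [schurStar_of_cells (S := {(0, 0), (0, 1), (1, 1), (1, 0)}) (by decide)
    (fun c => 3 - c.1 - c.2) (by decide)]
  simp
  ring

lemma schurStar_Y211 (q A : ℂ) : schurStar Y211 q A =
    br A / br (q ^ 4) * (br (A * q) / br q) * (br (A * q⁻¹) / br (q ^ 2)) *
      (br (A * (q ^ 2)⁻¹) / br q) := by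
  rw [schurStar_of_cells (S := {(0, 0), (0, 1), (1, 0), (2, 0)}) (by decide)
    (fun c => if c = (0, 0) then 4 else if c = (1, 0) then 2 else 1) (by decide)]
  simp [_root_.zpow_neg]
  ring

lemma schurStar_Y1111 (q A : ℂ) : schurStar Y1111 q A =
    br A / br (q ^ 4) * (br (A * q⁻¹) / br (q ^ 3)) * (br (A * (q ^ 2)⁻¹) / br (q ^ 2)) *
      (br (A * (q ^ 3)⁻¹) / br q) := by
  rw [schurStar_of_cells (S := {(0, 0), (1, 0), (2, 0), (3, 0)}) (by decide) (fun c => 4 - c.1)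
    (by decide)]
  simp [_root_.zpow_neg]
  ring

lemma br_inv (x : ℂ) : br x⁻¹ = -br x := by simp [br]

lemma br_neg (x : ℂ) : br (-x) = -br x := by simp [br, inv_neg]; ring

/-- Transposing a diagram negates contents and preserves hook lengths. Under `q → -1/q` a content k
gives the sign (-1)^k and a hook h the sign (-1)^(h+1); over the whole diagram the signs cancel. -/
lemma schurStar_Y211_eq (A : ℂ) : schurStar Y211 q A = schurStar Y31 (-1 / q) A := by
  have e1 : -1 / q = -q⁻¹ := by rw [neg_div, one_div]
  have e4 : br ((-q⁻¹) ^ 4) = -br (q ^ 4) := by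
    rw [Even.neg_pow (by decide), inv_pow, br_inv]
  have e2 : br ((-q⁻¹) ^ 2) = -br (q ^ 2) := by rw [neg_sq, inv_pow, br_inv]
  rw [schurStar_Y211, schurStar_Y31, e1, e4, e2, br_neg q⁻¹, br_inv, mul_neg, br_neg, inv_neg,
    inv_inv, mul_neg, br_neg, neg_sq, inv_pow, neg_neg]
  ring

lemma schurStar_Y1111_eq (A : ℂ) : schurStar Y1111 q A = schurStar Y4 (-1 / q) A := by
  have e1 : -1 / q = -q⁻¹ := by rw [neg_div, one_div]
  have e4 : br ((-q⁻¹) ^ 4) = -br (q ^ 4) := by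
    rw [Even.neg_pow (by decide), inv_pow, br_inv]
  have e2 : br ((-q⁻¹) ^ 2) = -br (q ^ 2) := by rw [neg_sq, inv_pow, br_inv]
  have e3 : br ((-q⁻¹) ^ 3) = br (q ^ 3) := by
    rw [Odd.neg_pow (by decide), inv_pow, br_neg, br_inv, neg_neg]
  rw [schurStar_Y1111, schurStar_Y4, e1, e4, e2, e3, br_neg q⁻¹, br_inv, mul_neg, br_neg,
    Odd.neg_pow (n := 3) (by decide), mul_neg, br_neg, neg_sq, inv_pow, inv_pow, neg_neg]
  ring

/-- The right-hand side of the trace formula on the five conjugacy class representatives. -/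
theorem sum_schurStar_mul_classValues (h : Generic q) (hs : s ^ 2 = qNum 3 q)
    (ht : t ^ 2 = q ^ 2 + (q ^ 2)⁻¹) {A : ℂ} (hA : A ≠ 0) (i : Fin 5) :
    classValues trace (sector4 q).hatR i * schurStar Y4 q A +
    classValues trace (sector31 q s t).hatR i * schurStar Y31 q A +
    classValues trace (sector22 q s).hatR i * schurStar Y22 q A +
    classValues trace (sector31 (-1 / q) s t).hatR i * schurStar Y211 q A +
    classValues trace (sector4 (-1 / q)).hatR i * schurStar Y1111 q A =
      (![(br A / br q) ^ 4, A * (br A / br q) ^ 3, A ^ 2 * (br A / br q) ^ 2,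
        A ^ 2 * (br A / br q) ^ 2, A ^ 3 * (br A / br q)] : Fin 5 → ℂ) i := by
  have h0 := h.ne_zero
  have h1 := h.sq_sub_one_ne_zero
  have h2 := h.two_ne_zero
  have h3 := h.three_ne_zero
  have h3' := h.three_ne_zero'
  have h4 := h.four_ne_zero
  have b1 : br q = (q ^ 2 - 1) / q := by rw [br]; field_simp
  have b2 : br (q ^ 2) = (q ^ 2 - 1) * (q ^ 2 + 1) / q ^ 2 := by rw [br]; field_simp; ring
  have b3 : br (q ^ 3) = (q ^ 2 - 1) * (q ^ 4 + q ^ 2 + 1) / q ^ 3 := by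
    rw [br]; field_simp; ring
  have b4 : br (q ^ 4) = (q ^ 2 - 1) * (q ^ 2 + 1) * (q ^ 4 + 1) / q ^ 4 := by
    rw [br]; field_simp; ring
  rw [classValues_sector4, classValues_sector4, classValues_sector31 h hs ht,
    classValues_sector31 h.neg_inv (by rw [hs, h.qNum_three_neg_inv]) (by rw [ht, neg_inv_sq]),
    classValues_sector22 h hs, schurStar_Y4, schurStar_Y31, schurStar_Y22, schurStar_Y211,
    schurStar_Y1111, b1, b2, b3, b4]
  have c0 : br A = (A ^ 2 - 1) / A := by rw [br]; field_simp
  have c1 : br (A * q) = (A ^ 2 * q ^ 2 - 1) / (A * q) := by rw [br]; field_simp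
  have c2 : br (A * q ^ 2) = (A ^ 2 * q ^ 4 - 1) / (A * q ^ 2) := by rw [br]; field_simp
  have c3 : br (A * q ^ 3) = (A ^ 2 * q ^ 6 - 1) / (A * q ^ 3) := by rw [br]; field_simp
  have d1 : br (A * q⁻¹) = (A ^ 2 - q ^ 2) / (A * q) := by rw [br]; field_simp
  have d2 : br (A * (q ^ 2)⁻¹) = (A ^ 2 - q ^ 4) / (A * q ^ 2) := by rw [br]; field_simp
  have d3 : br (A * (q ^ 3)⁻¹) = (A ^ 2 - q ^ 6) / (A * q ^ 3) := by rw [br]; field_simp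
  rw [c0, c1, c2, c3, d1, d2, d3]
  clear c0 c1 c2 c3 d1 d2 d3 b1 b2 b3 b4 hs ht
  fin_cases i <;> simp <;> field_simp <;> ring

end

/-! ### The character expansion; existence and uniqueness of the Laurent polynomial. -/

section

variable {q s t : ℂ}

/-- The character expansion of the HOMFLY polynomial of a four-strand braid. -/
def characterSum (q s t : ℂ) (w : List (ℤ × ℤ × ℤ)) (A : ℂ) : ℂ :=
  (braidValue (sector4 q).hatR w).trace * schurStar Y4 q A +
  (braidValue (sector31 q s t).hatR w).trace * schurStar Y31 q A +
  (braidValue (sector22 q s).hatR w).trace * schurStar Y22 q A +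
  (braidValue (sector31 (-1 / q) s t).hatR w).trace * schurStar Y211 q A +
  (braidValue (sector4 (-1 / q)).hatR w).trace * schurStar Y1111 q A

/-- The difference of the two sides is a trace functional on the product of the six matrix algebras,
in which the six triples of `R`-matrices form one Hecke triple. It vanishes on the five class
representatives, hence on every braid. -/
theorem qTrace_braidValue (h : Generic q) (hs : s ^ 2 = qNum 3 q)
    (ht : t ^ 2 = q ^ 2 + (q ^ 2)⁻¹) {N : ℕ} (hN : 1 ≤ N) (w : List (ℤ × ℤ × ℤ)) :
    qTrace N q (braidValue (strandR N q) w) = characterSum q s t w (q ^ N) := by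
  have k0 := isHecke_strandR N h.ne_zero
  have k1 := isHecke_sector4 h.ne_zero
  have k2 := isHecke_sector31 h hs ht
  have k3 := isHecke_sector22 h hs
  have k4 : IsHecke q (sector31 (-1 / q) s t).hatR :=
    (isHecke_sector31 h.neg_inv (by rw [hs, h.qNum_three_neg_inv])
      (by rw [ht, neg_inv_sq])).of_neg_inv
  have k5 : IsHecke q (sector4 (-1 / q)).hatR := (isHecke_sector4 h.neg_inv.ne_zero).of_neg_inv
  have K := k0.prodMk (k1.prodMk (k2.prodMk (k3.prodMk (k4.prodMk k5))))
  set g := fun μ => (strandR N q μ, (sector4 q).hatR μ, (sector31 q s t).hatR μ,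
    (sector22 q s).hatR μ, (sector31 (-1 / q) s t).hatR μ, (sector4 (-1 / q)).hatR μ) with hg
  let p0 := AlgHom.fst ℂ (Matrix (Idx N) (Idx N) ℂ) (Matrix (Fin 1) (Fin 1) ℂ ×
    Matrix (Fin 3) (Fin 3) ℂ × Matrix (Fin 2) (Fin 2) ℂ × Matrix (Fin 3) (Fin 3) ℂ ×
    Matrix (Fin 1) (Fin 1) ℂ)
  let r0 := AlgHom.snd ℂ (Matrix (Idx N) (Idx N) ℂ) (Matrix (Fin 1) (Fin 1) ℂ ×
    Matrix (Fin 3) (Fin 3) ℂ × Matrix (Fin 2) (Fin 2) ℂ × Matrix (Fin 3) (Fin 3) ℂ ×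
    Matrix (Fin 1) (Fin 1) ℂ)
  let p1 := (AlgHom.fst ℂ _ _).comp r0
  let r1 := (AlgHom.snd ℂ _ _).comp r0
  let p2 := (AlgHom.fst ℂ _ _).comp r1
  let r2 := (AlgHom.snd ℂ _ _).comp r1
  let p3 := (AlgHom.fst ℂ _ _).comp r2
  let r3 := (AlgHom.snd ℂ _ _).comp r2
  let p4 := (AlgHom.fst ℂ _ _).comp r3
  let p5 := (AlgHom.snd ℂ _ _).comp r3
  let tr (n : ℕ) := traceLinearMap (Fin n) ℂ ℂ
  set A := q ^ N with hA
  let τ := qTraceLinear N q ∘ₗ p0.toLinearMap - (schurStar Y4 q A • tr 1 ∘ₗ p1.toLinearMap +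
    schurStar Y31 q A • tr 3 ∘ₗ p2.toLinearMap + schurStar Y22 q A • tr 2 ∘ₗ p3.toLinearMap +
    schurStar Y211 q A • tr 3 ∘ₗ p4.toLinearMap + schurStar Y1111 q A • tr 1 ∘ₗ p5.toLinearMap)
  have τ_apply : ∀ x, τ x = qTrace N q (p0 x) - ((p1 x).trace * schurStar Y4 q A +
      (p2 x).trace * schurStar Y31 q A + (p3 x).trace * schurStar Y22 q A +
      (p4 x).trace * schurStar Y211 q A + (p5 x).trace * schurStar Y1111 q A) := by
    intro x
    rw [← qTraceLinear_apply]
    simp only [τ, tr, LinearMap.sub_apply, LinearMap.add_apply, LinearMap.smul_apply,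
      LinearMap.comp_apply, AlgHom.toLinearMap_apply, traceLinearMap_apply, smul_eq_mul, mul_comm]
  have τ_comm : ∀ μ x, τ (g μ * x) = τ (x * g μ) := by
    intro μ x
    simp only [τ_apply, map_mul]
    rw [show p0 (g μ) = strandR N q μ from rfl, qTrace_strandR_mul_comm, trace_mul_comm (p1 _),
      trace_mul_comm (p2 _), trace_mul_comm (p3 _), trace_mul_comm (p4 _), trace_mul_comm (p5 _)]
  have τ_class : ∀ i, classValues τ g i = 0 := by
    intro i
    have e1 := congrFun (classValues_qTrace h hN) i
    have e2 := sum_schurStar_mul_classValues h hs ht (pow_ne_zero N h.ne_zero) i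
    rw [← e1] at e2
    fin_cases i
    all_goals
      rw [classValues] at e2 ⊢
      simp only [τ_apply]
      exact sub_eq_zero.2 e2.symm
  have := K.trace_eq_zero τ τ_comm (τ_class 0) (τ_class 1) (τ_class 2) (τ_class 3) (τ_class 4)
    (heckeBraid_mem_adjoin (q := q) g w)
  rw [τ_apply, sub_eq_zero] at this
  simp only [map_heckeBraid] at this
  rw [characterSum, ← k0.heckeBraid_eq_braidValue, ← k1.heckeBraid_eq_braidValue,
    ← k2.heckeBraid_eq_braidValue, ← k3.heckeBraid_eq_braidValue, ← k4.heckeBraid_eq_braidValue,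
    ← k5.heckeBraid_eq_braidValue]
  exact this

open LaurentPolynomial in
lemma exists_laurent_schurStar (q : ℂ) (Q : YoungDiagram) :
    ∃ P : LaurentPolynomial ℂ, ∀ A : ℂˣ, eval₂ (RingHom.id ℂ) A P = schurStar Q q A := by
  refine ⟨∏ c ∈ Q.cells, C (br (q ^ hookLength Q c))⁻¹ *
    (C (q ^ ((c.2 : ℤ) - (c.1 : ℤ))) * T 1 - C (q ^ ((c.2 : ℤ) - (c.1 : ℤ)))⁻¹ * T (-1)),
    fun A => ?_⟩
  rw [map_prod, schurStar]
  refine Finset.prod_congr rfl fun c _ => ?_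
  simp only [map_mul, map_sub, eval₂_C, eval₂_T, RingHom.id_apply, br, mul_inv, zpow_one, _root_.zpow_neg,
    Units.val_inv_eq_inv_val]
  ring

open LaurentPolynomial in
lemma exists_laurent_characterSum (q s t : ℂ) (w : List (ℤ × ℤ × ℤ)) :
    ∃ P : LaurentPolynomial ℂ, ∀ A : ℂˣ,
      eval₂ (RingHom.id ℂ) A P = characterSum q s t w A := by
  obtain ⟨P1, h1⟩ := exists_laurent_schurStar q Y4
  obtain ⟨P2, h2⟩ := exists_laurent_schurStar q Y31
  obtain ⟨P3, h3⟩ := exists_laurent_schurStar q Y22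
  obtain ⟨P4, h4⟩ := exists_laurent_schurStar q Y211
  obtain ⟨P5, h5⟩ := exists_laurent_schurStar q Y1111
  refine ⟨C (braidValue (sector4 q).hatR w).trace * P1 +
    C (braidValue (sector31 q s t).hatR w).trace * P2 +
    C (braidValue (sector22 q s).hatR w).trace * P3 +
    C (braidValue (sector31 (-1 / q) s t).hatR w).trace * P4 +
    C (braidValue (sector4 (-1 / q)).hatR w).trace * P5, fun A => ?_⟩
  simp only [map_mul, map_add, eval₂_C, RingHom.id_apply, h1, h2, h3, h4, h5, characterSum]

lemma Generic.pow_injective (h : Generic q) : Function.Injective fun n : ℕ => q ^ n := by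
  have key : ∀ m n : ℕ, q ^ m = q ^ (m + (n + 1)) → False := by
    intro m n e
    rw [pow_add] at e
    exact h.pow_ne_one (n + 1) n.succ_pos
      (mul_left_cancel₀ (pow_ne_zero m h.ne_zero) (by rw [← e, mul_one]))
  intro m n e
  rcases lt_trichotomy m n with hl | hl | hl
  · obtain ⟨k, rfl⟩ := Nat.exists_eq_add_of_lt hl
    exact (key m k e).elim
  · exact hl
  · obtain ⟨k, rfl⟩ := Nat.exists_eq_add_of_lt hl
    exact (key n k e.symm).elim

open LaurentPolynomial in
lemma laurent_ext_of_pow (h : Generic q) {P P' : LaurentPolynomial ℂ}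
    (hP : ∀ N : ℕ, 1 ≤ N → ∀ A : ℂˣ, (A : ℂ) = q ^ N →
      eval₂ (RingHom.id ℂ) A P = eval₂ (RingHom.id ℂ) A P') : P = P' := by
  rw [← sub_eq_zero]
  -- Multiplication by a power of `T`, which is a unit, turns the difference into a polynomial with
  -- the infinitely many roots `q ^ (k + 1)`.
  obtain ⟨n, f, hf⟩ := exists_T_pow (P - P')
  have hz : f = 0 := by
    refine Polynomial.eq_zero_of_infinite_isRoot f
      (Set.Infinite.mono (s := Set.range fun k : ℕ => q ^ (k + 1)) ?_ (Set.infinite_range_of_injective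
        fun a b e => Nat.succ_injective (h.pow_injective e)))
    rintro _ ⟨k, rfl⟩
    let A : ℂˣ := Units.mk0 (q ^ (k + 1)) (pow_ne_zero _ h.ne_zero)
    have := congrArg (eval₂ (RingHom.id ℂ) A) hf
    rw [eval₂_toLaurent, map_mul, map_sub, hP (k + 1) (by omega) A rfl, sub_self, zero_mul] at this
    exact this
  rw [hz, map_zero] at hf
  exact ((isUnit_T (R := ℂ) n).mul_left_eq_zero).1 hf.symm

end

/-! ### Commutation with the raising operators, and bases of multiplicity spaces. -/

section

variable {q : ℂ} {N : ℕ}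

lemma transpose_strandR (μ : Fin 3) : (strandR N q μ)ᵀ = strandR N q μ := by
  have hs : ∀ x : Idx N, swapAt μ (swapAt μ x) = x := fun x => by
    ext1 k; simp [swapAt]
  ext x y
  rw [transpose_apply, strandR_apply, strandR_apply]
  congr 1
  · by_cases h : x = y
    · rw [h]
    · rw [if_neg h, if_neg (Ne.symm h)]
  · by_cases h : swapAt μ x = y
    · have h' : swapAt μ y = x := by rw [← h, hs]
      rw [if_pos h, if_pos h', ← h]
      simp [swapAt, eq_comm]
    · have h' : swapAt μ y ≠ x := by rintro rfl; exact h (hs y)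
      rw [if_neg h, if_neg h']

lemma sum_words (f : Idx N → ℂ) : ∑ x, f x = ∑ a, ∑ b, ∑ c, ∑ d, f ![a, b, c, d] := by
  let e : Fin N × Fin N × Fin N × Fin N ≃ Idx N :=
    { toFun := fun p => ![p.1, p.2.1, p.2.2.1, p.2.2.2]
      invFun := fun x => (x 0, x 1, x 2, x 3)
      left_inv := fun p => rfl
      right_inv := fun x => (eq_cons x).symm }
  rw [← e.sum_comp]
  simp only [Fintype.sum_prod_type]
  rfl

/-- The diagonal entries of `q^(-2H)` for the simple root with letters `α`, `β`. -/
def cartanEntry (q : ℂ) (α β a : Fin N) : ℂ := if a = α then q⁻¹ else if a = β then q else 1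

/-- The indicator of the letter `α`. -/
def letterInd (α a : Fin N) : ℂ := if a = α then 1 else 0

lemma raiseTensor_mulVec {i : ℕ} (hi : i + 1 < N) {α β : Fin N} (hα : (α : ℕ) = i)
    (hβ : (β : ℕ) = i + 1) (v : Idx N → ℂ) (a b c d : Fin N) :
    (raiseTensor N q i *ᵥ v) ![a, b, c, d] =
      letterInd α a * cartanEntry q α β b * cartanEntry q α β c * cartanEntry q α β d *
          v ![β, b, c, d] +
        letterInd α b * cartanEntry q α β c * cartanEntry q α β d * v ![a, β, c, d] +
        letterInd α c * cartanEntry q α β d * v ![a, b, β, d] +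
        letterInd α d * v ![a, b, c, β] := by
  have hr : ∀ a b, raise N i a b = letterInd α a * (if β = b then 1 else 0) := by
    intro a b
    simp only [raise, letterInd, Fin.ext_iff, hα, hβ, ite_and, ite_mul, one_mul, zero_mul]
    simp only [eq_comm]
  have hc : ∀ a b, cartanInv N q i a b = cartanEntry q α β a * (if a = b then 1 else 0) := by
    intro a b
    simp only [cartanInv, diagonal_apply, cartanEntry, Fin.ext_iff, hα, hβ, mul_ite, mul_one,
      mul_zero]
  have ht : ∀ (B : Fin 4 → Matrix (Fin N) (Fin N) ℂ) (a b c d a' b' c' d' : Fin N),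
      tensorOp B ![a, b, c, d] ![a', b', c', d'] = B 0 a a' * B 1 b b' * B 2 c c' * B 3 d d' :=
    fun B _ _ _ _ _ _ _ _ => Fin.prod_univ_four _
  simp only [raiseTensor, Fin.sum_univ_four, add_mulVec, Pi.add_apply]
  simp only [mulVec, dotProduct, sum_words, ht]
  simp [hr, hc, one_apply]

lemma raiseTensor_of_le {i : ℕ} (hi : N ≤ i + 1) : raiseTensor N q i = 0 := by
  refine Finset.sum_eq_zero fun k _ => ?_
  ext x y
  refine Finset.prod_eq_zero (Finset.mem_univ k) ?_
  simp only [lt_irrefl, if_false, if_true, raise]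
  rw [if_neg]
  omega

/-- This is R Δ(E) = Δ(E) R on two strands, read at the word `ab`, with `F` the coordinates of the
vector. -/
lemma two_strand_commute (hq : q ≠ 0) {α β : Fin N} (hαβ : (β : ℕ) = α + 1)
    (F : Fin N → Fin N → ℂ) (a b : Fin N) :
    rDiag q a b * (letterInd α a * cartanEntry q α β b * F β b + letterInd α b * F a β) +
      (if a = b then 0 else letterInd α b * cartanEntry q α β a * F β a + letterInd α a * F b β) =
    letterInd α a * cartanEntry q α β b * (rDiag q β b * F β b + if β = b then 0 else F b β) +
      letterInd α b * (rDiag q a β * F a β + if a = β then 0 else F β a) := by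
  have hlt : α < β := by rw [Fin.lt_def]; omega
  by_cases ha : a = α <;> by_cases hb : b = α
  · subst ha; subst hb
    simp [letterInd, rDiag, cartanEntry, LT.lt.ne, LT.lt.ne', LT.lt.not_gt, *]
    field_simp; ring
  · subst ha
    rcases lt_trichotomy b β with h | h | h
    · have h' : b < a := by rw [Fin.lt_def] at h ⊢; omega
      simp [letterInd, rDiag, cartanEntry, LT.lt.ne, LT.lt.ne', LT.lt.not_gt, *]
    · subst h
      simp [letterInd, rDiag, cartanEntry, LT.lt.ne, LT.lt.ne', LT.lt.not_gt, *]
      field_simp; ring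
    · have h' := hlt.trans h
      simp [letterInd, rDiag, cartanEntry, LT.lt.ne, LT.lt.ne', LT.lt.not_gt, *]
  · subst hb
    rcases lt_trichotomy a β with h | h | h
    · have h' : a < b := by rw [Fin.lt_def] at h ⊢; omega
      simp [letterInd, rDiag, cartanEntry, LT.lt.ne, LT.lt.ne', LT.lt.not_gt, *]
    · subst h
      simp [letterInd, rDiag, cartanEntry, LT.lt.ne, LT.lt.ne', LT.lt.not_gt, *]
    · have h' := hlt.trans h
      simp [letterInd, rDiag, cartanEntry, LT.lt.ne, LT.lt.ne', LT.lt.not_gt, *]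
  · simp [letterInd, ha, hb]

/-- When `E` acts outside the braided pair, the pair sees either the identity or `q^(-2H)` on both
strands, which is symmetric under the swap. When `E` acts inside, the two-strand identity applies,
multiplied by the Cartan entries of the strands to the right. -/
lemma raiseTensor_strandR (hq : q ≠ 0) (i : ℕ) (μ : Fin 3) (v : Idx N → ℂ) :
    raiseTensor N q i *ᵥ (strandR N q μ *ᵥ v) = strandR N q μ *ᵥ (raiseTensor N q i *ᵥ v) := by
  rcases le_or_gt N (i + 1) with hi | hi
  · rw [raiseTensor_of_le hi, zero_mulVec, zero_mulVec, mulVec_zero]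
  let α : Fin N := ⟨i, by omega⟩
  let β : Fin N := ⟨i + 1, hi⟩
  have two := two_strand_commute hq (show (β : ℕ) = α + 1 from rfl)
  have hE := fun v => raiseTensor_mulVec (q := q) hi (show (α : ℕ) = i from rfl)
    (show (β : ℕ) = i + 1 from rfl) v
  ext1 x
  rw [eq_cons x]
  generalize x 0 = a
  generalize x 1 = b
  generalize x 2 = c
  generalize x 3 = d
  fin_cases μ
  · have h := two (fun x y => v ![x, y, c, d]) a b
    simp only [Fin.zero_eta, strandR_zero_mulVec, hE] at h ⊢
    split_ifs at h ⊢ <;> linear_combination -(cartanEntry q α β c * cartanEntry q α β d) * h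
  · have h := two (fun x y => v ![a, x, y, d]) b c
    simp only [Fin.mk_one, strandR_one_mulVec, hE] at h ⊢
    split_ifs at h ⊢ <;> linear_combination -(cartanEntry q α β d) * h
  · have h := two (fun x y => v ![a, b, x, y]) c d
    simp only [Fin.reduceFinMk, strandR_two_mulVec, hE] at h ⊢
    split_ifs at h ⊢ <;> linear_combination -h

lemma card_filter_swapAt (μ : Fin 3) (x : Idx N) (i : Fin N) :
    (Finset.univ.filter fun k => swapAt μ x k = i).card =
      (Finset.univ.filter fun k => x k = i).card := by
  refine Finset.card_bij (fun k _ => Equiv.swap μ.castSucc μ.succ k) ?_ ?_ ?_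
  · intro k hk; exact Finset.mem_filter.2 ⟨Finset.mem_univ _, (Finset.mem_filter.1 hk).2⟩
  · intro k _ l _ h; exact (Equiv.swap _ _).injective h
  · intro k hk
    refine ⟨Equiv.swap μ.castSucc μ.succ k, Finset.mem_filter.2 ⟨Finset.mem_univ _, ?_⟩, by simp⟩
    rw [swapAt, Function.comp_apply, Equiv.swap_apply_self]
    exact (Finset.mem_filter.1 hk).2

theorem strandR_mulVec_mem (hq : q ≠ 0) {Q : YoungDiagram} (μ : Fin 3) {v : Idx N → ℂ}
    (hv : v ∈ multSpace N q Q) : strandR N q μ *ᵥ v ∈ multSpace N q Q := by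
  refine ⟨fun x hx => ?_, fun i => ?_⟩
  · rw [strandR_mulVec, hv.1 x hx, hv.1 (swapAt μ x)]
    · simp
    · obtain ⟨i, hi⟩ := hx
      exact ⟨i, by rwa [card_filter_swapAt]⟩
  · rw [raiseTensor_strandR hq, hv.2 i, mulVec_zero]

/-- A family of words on which the vectors of the multiplicity space are determined. -/
def Determines (N : ℕ) (q : ℂ) (Q : YoungDiagram) {n : ℕ} (p : Fin n → Idx N) : Prop :=
  ∀ v ∈ multSpace N q Q, (∀ j, v (p j) = 0) → v = 0

lemma Determines.ext {Q : YoungDiagram} {n : ℕ} {p : Fin n → Idx N} (hp : Determines N q Q p)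
    {u v : Idx N → ℂ} (hu : u ∈ multSpace N q Q) (hv : v ∈ multSpace N q Q)
    (h : ∀ j, u (p j) = v (p j)) : u = v :=
  sub_eq_zero.1 (hp _ (sub_mem hu hv) fun j => sub_eq_zero.2 (h j))

/-- Orthonormality gives independence of the `n` vectors, and the `n` determining words bound the
dimension by `n`; hence the vectors form a basis. -/
theorem Mixing.represents_of_orthonormal {Q : YoungDiagram} {n : ℕ} {D : Mixing n}
    {p : Fin n → Idx N} (hp : Determines N q Q p) (e : Fin n → Idx N → ℂ)
    (he : ∀ j, e j ∈ multSpace N q Q) (horth : ∀ i j, e i ⬝ᵥ e j = if i = j then 1 else 0)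
    (hR : ∀ μ j, strandR N q μ *ᵥ e j = ∑ i, D.hatR μ i j • e i) : D.Represents N q Q := by
  let b : Fin n → multSpace N q Q := fun j => ⟨e j, he j⟩
  have hb : LinearIndependent ℂ b := by
    rw [Fintype.linearIndependent_iff]
    intro c hc i
    have h0 : ∑ j, c j • e j = 0 := by
      have := congrArg (multSpace N q Q).subtype hc
      simpa [b] using this
    have h1 := congrArg (fun v => e i ⬝ᵥ v) h0
    simpa [dotProduct_sum, horth] using h1
  let ev : multSpace N q Q →ₗ[ℂ] (Fin n → ℂ) :=
    LinearMap.pi fun j => LinearMap.proj (p j) ∘ₗ (multSpace N q Q).subtype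
  have hev : Function.Injective ev := by
    rw [← LinearMap.ker_eq_bot, LinearMap.ker_eq_bot']
    intro v hv
    exact Subtype.ext (hp v v.2 fun j => congrFun hv j)
  have hdim : Module.finrank ℂ (multSpace N q Q) = n := by
    refine le_antisymm ?_ ?_
    · simpa using LinearMap.finrank_le_finrank_of_injective hev
    · simpa using hb.fintype_card_le_finrank
  rcases Nat.eq_zero_or_pos n with rfl | hn
  · have : Subsingleton (multSpace N q Q) :=
      hev.subsingleton
    exact ⟨Module.Basis.empty _, fun i => i.elim0, fun _ j => j.elim0⟩
  have : Nonempty (Fin n) := ⟨⟨0, hn⟩⟩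
  refine ⟨basisOfLinearIndependentOfCardEqFinrank hb (by simp [hdim]), fun i j => ?_,
    fun μ j => ?_⟩
  · simp only [coe_basisOfLinearIndependentOfCardEqFinrank]
    exact horth i j
  · simp only [coe_basisOfLinearIndependentOfCardEqFinrank]
    exact hR μ j

end

/-! ### Orthonormal bases generated by one vector of a symmetric Hecke triple. -/

section

lemma dotProduct_mulVec_of_symm {ι : Type*} [Fintype ι] {M : Matrix ι ι ℂ} (hM : Mᵀ = M) (u v : ι → ℂ) :
    (M *ᵥ u) ⬝ᵥ v = u ⬝ᵥ (M *ᵥ v) := by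
  rw [dotProduct_mulVec, ← mulVec_transpose, hM]

/-- Eigenvectors of a symmetric matrix for distinct eigenvalues are orthogonal. -/
lemma dotProduct_eq_zero_of_eigen {ι : Type*} [Fintype ι] {M : Matrix ι ι ℂ} (hM : Mᵀ = M) {u v : ι → ℂ} {a b : ℂ}
    (hab : a ≠ b) (hu : M *ᵥ u = a • u) (hv : M *ᵥ v = b • v) : u ⬝ᵥ v = 0 := by
  have := dotProduct_mulVec_of_symm hM u v
  rw [hu, hv, smul_dotProduct, dotProduct_smul, smul_eq_mul, smul_eq_mul] at this
  by_contra h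
  exact hab (mul_right_cancel₀ h this)

variable {ι : Type*} [Fintype ι] [DecidableEq ι] {p s t : ℂ} {g : Fin 3 → Matrix ι ι ℂ}

lemma IsHecke.mulVec_mulVec_self (h : IsHecke p g) (μ : Fin 3) (v : ι → ℂ) :
    g μ *ᵥ (g μ *ᵥ v) = v + (p - p⁻¹) • g μ *ᵥ v := by
  rw [mulVec_mulVec, h.sq, add_mulVec, one_mulVec, smul_mulVec]

/-- Applying the quadratic relation to `u` and dividing by `k` gives the second column. The
condition on `k` says that the symmetric two by two block has determinant -1. -/
lemma IsHecke.mulVec_second (h : IsHecke p g) (μ : Fin 3) {u v : ι → ℂ} {m k : ℂ} (hk : k ≠ 0)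
    (hkk : k ^ 2 = 1 + (p - p⁻¹) * m - m ^ 2) (hu : g μ *ᵥ u = m • u - k • v) :
    g μ *ᵥ v = (p - p⁻¹ - m) • v - k • u := by
  have h2 := h.mulVec_mulVec_self μ u
  rw [hu, mulVec_sub, mulVec_smul, mulVec_smul, hu] at h2
  have : k • (g μ *ᵥ v - ((p - p⁻¹ - m) • v - k • u)) = 0 := by
    have e : k • (g μ *ᵥ v - ((p - p⁻¹ - m) • v - k • u)) =
      (u + (p - p⁻¹) • (m • u - k • v)) - (m • (m • u - k • v) - k • g μ *ᵥ v) +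
        (k ^ 2 - (1 + (p - p⁻¹) * m - m ^ 2)) • u := by module
    rw [e, h2, hkk]; simp
  exact sub_eq_zero.1 ((smul_eq_zero_iff_right hk).1 this)

/-- If a symmetric matrix mixes the unit vector `u` with an orthogonal `v`, then `v` is normalized. -/
lemma IsHecke.dotProduct_second (h : IsHecke p g) (μ : Fin 3) (hsym : (g μ)ᵀ = g μ)
    {u v : ι → ℂ} {m k : ℂ} (hk : k ≠ 0) (hkk : k ^ 2 = 1 + (p - p⁻¹) * m - m ^ 2)
    (hu : g μ *ᵥ u = m • u - k • v) (huu : u ⬝ᵥ u = 1) (huv : u ⬝ᵥ v = 0) : v ⬝ᵥ v = 1 := by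
  have e1 : (g μ *ᵥ u) ⬝ᵥ (g μ *ᵥ u) = m ^ 2 + k ^ 2 * (v ⬝ᵥ v) := by
    rw [hu]
    simp only [sub_dotProduct, dotProduct_sub, smul_dotProduct, dotProduct_smul, huu, huv,
      dotProduct_comm v u, smul_eq_mul]
    ring
  have e2 : (g μ *ᵥ u) ⬝ᵥ (g μ *ᵥ u) = 1 + (p - p⁻¹) * m := by
    rw [dotProduct_mulVec_of_symm hsym, h.mulVec_mulVec_self, hu]
    simp only [dotProduct_add, dotProduct_sub, dotProduct_smul, huu, huv, smul_eq_mul]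
    ring
  have : k ^ 2 * (v ⬝ᵥ v) = k ^ 2 * 1 := by linear_combination e2 - e1 - hkk
  exact mul_left_cancel₀ (pow_ne_zero 2 hk) this

/-- A unit vector fixed up to `p` by the first two generators and killed by the symmetrizer spans
the three-dimensional sector. -/
theorem IsHecke.exists_basis_sector31 (h : IsHecke p g) (hsym : ∀ μ, (g μ)ᵀ = g μ)
    (hp : Generic p) (hs : s ^ 2 = qNum 3 p) (ht : t ^ 2 = p ^ 2 + (p ^ 2)⁻¹)
    (S : Submodule ℂ (ι → ℂ)) (hS : ∀ μ, ∀ v ∈ S, g μ *ᵥ v ∈ S) {f : ι → ℂ} (hf : f ∈ S)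
    (hff : f ⬝ᵥ f = 1) (f0 : g 0 *ᵥ f = p • f) (f1 : g 1 *ᵥ f = p • f)
    (hrel : f + p • g 2 *ᵥ f + p ^ 2 • g 1 *ᵥ (g 2 *ᵥ f) +
      p ^ 3 • g 0 *ᵥ (g 1 *ᵥ (g 2 *ᵥ f)) = 0) :
    ∃ e : Fin 3 → ι → ℂ, (∀ j, e j ∈ S) ∧ (∀ i j, e i ⬝ᵥ e j = if i = j then 1 else 0) ∧
      ∀ μ j, g μ *ᵥ e j = ∑ i, (sector31 p s t).hatR μ i j • e i := by
  have p0 := hp.ne_zero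
  have p2 := hp.two_ne_zero
  have p3 := hp.three_ne_zero
  have p3' := hp.three_ne_zero'
  have p4 := hp.four_ne_zero
  have r1 := sector31_hatR_one (t := t) hp hs
  have r2 := sector31_hatR_two hp hs ht
  replace hs := sq_mul_sq_of_qNum hp hs
  replace ht := sq_mul_sq_of_add_inv hp ht
  have s0 : s ≠ 0 := by rintro rfl; exact p3 (by rw [← hs]; ring)
  have t0 : t ≠ 0 := by rintro rfl; exact p4 (by rw [← ht]; ring)
  rw [hp.qNum_two] at r1
  rw [hp.qNum_two, hp.qNum_three] at r2
  -- `m`, `k` are the entries of the block of R₃, and `m'`, `k'` those of the block of R₂. Only the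
  -- identities `a1` to `a4` and the two determinant conditions between them are needed afterwards.
  obtain ⟨m, hm⟩ : ∃ m, m = -(1 / (p ^ 3 * ((p ^ 4 + p ^ 2 + 1) / p ^ 2))) := ⟨_, rfl⟩
  obtain ⟨k, hk⟩ : ∃ k, k = (p ^ 2 + 1) / p * t / ((p ^ 4 + p ^ 2 + 1) / p ^ 2) := ⟨_, rfl⟩
  obtain ⟨m', hm'⟩ : ∃ m', m' = -(1 / (p ^ 2 * ((p ^ 2 + 1) / p))) := ⟨_, rfl⟩
  obtain ⟨k', hk'⟩ : ∃ k', k' = s / ((p ^ 2 + 1) / p) := ⟨_, rfl⟩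
  have d2 : p ^ 3 / ((p ^ 4 + p ^ 2 + 1) / p ^ 2) = p - p⁻¹ - m := by
    rw [hm]; field_simp; ring
  have d1 : p ^ 2 / ((p ^ 2 + 1) / p) = p - p⁻¹ - m' := by
    rw [hm']; field_simp; ring
  rw [← hm', ← hk', d1] at r1
  rw [← hm, ← hk, d2] at r2
  have k0 : k ≠ 0 := by rw [hk]; positivity
  have k0' : k' ≠ 0 := by rw [hk']; positivity
  have kk : k ^ 2 = 1 + (p - p⁻¹) * m - m ^ 2 := by 
    rw [hk, hm]; clear * - p0 p2 p3 p3' ht; field_simp; grind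
  have kk' : k' ^ 2 = 1 + (p - p⁻¹) * m' - m' ^ 2 := by 
    rw [hk', hm']; clear * - p0 p2 p3 p3' hs; field_simp; grind
  have a1 : m * (1 + p ^ 2 + p ^ 4) * p + 1 = 0 := by rw [hm]; field_simp; ring
  have a2 : m' * (p ^ 2 + 1) * p + 1 = 0 := by rw [hm']; field_simp; ring
  have a3 : m' * (p - p⁻¹ - m) + m * p = p * m' := by rw [hm, hm']; field_simp; ring
  have a4 : m * p = (p⁻¹ + m) * m' := by rw [hm, hm']; field_simp; ring
  clear hk hm hk' hm' hs ht d1 d2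
  -- In the pairing of `f` with `hrel`, symmetry moves g₀ and g₁ onto `f`, where they act by `p`.
  -- What remains is 1 + (p + p³ + p⁵)⟨f, g₂f⟩ = 0.
  have hfm : f ⬝ᵥ (g 2 *ᵥ f) = m := by
    have e := congrArg (fun v => f ⬝ᵥ v) hrel
    simp only [dotProduct_add, dotProduct_smul, dotProduct_zero, smul_eq_mul] at e
    rw [← dotProduct_mulVec_of_symm (hsym 0), f0, smul_dotProduct,
      ← dotProduct_mulVec_of_symm (hsym 1), f1, smul_dotProduct, hff, smul_eq_mul, smul_eq_mul] at e
    have hz : p * (1 + p ^ 2 + p ^ 4) ≠ 0 := by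
      rw [show 1 + p ^ 2 + p ^ 4 = p ^ 4 + p ^ 2 + 1 by ring]; positivity
    refine mul_left_cancel₀ hz ?_
    linear_combination e - a1
  obtain ⟨e2, he2⟩ : ∃ e2, e2 = k⁻¹ • (m • f - g 2 *ᵥ f) := ⟨_, rfl⟩
  have g2f : g 2 *ᵥ f = m • f - k • e2 := by
    rw [he2, smul_smul, mul_inv_cancel₀ k0, one_smul, sub_sub_cancel]
  have g2e2 := h.mulVec_second 2 k0 kk g2f
  have g0e2 : g 0 *ᵥ e2 = p • e2 := by
    have : g 0 *ᵥ (g 2 *ᵥ f) = p • g 2 *ᵥ f := by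
      rw [mulVec_mulVec, h.comm, ← mulVec_mulVec, f0, mulVec_smul]
    rw [he2, mulVec_smul, mulVec_sub, mulVec_smul, f0, this]
    module
  obtain ⟨e3, he3⟩ : ∃ e3, e3 = k'⁻¹ • (m' • e2 - g 1 *ᵥ e2) := ⟨_, rfl⟩
  have g1e2 : g 1 *ᵥ e2 = m' • e2 - k' • e3 := by
    rw [he3, smul_smul, mul_inv_cancel₀ k0', one_smul, sub_sub_cancel]
  have g1e3 := h.mulVec_second 1 k0' kk' g1e2
  have hY : g 1 *ᵥ (g 2 *ᵥ f) = (m * p) • f - (k * m') • e2 + (k * k') • e3 := by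
    rw [g2f, mulVec_sub, mulVec_smul, mulVec_smul, f1, g1e2]; module
  have kkne : k * k' ≠ 0 := mul_ne_zero k0 k0'
  -- By the braid relation g₂g₁g₂f = g₁g₂g₁f = p g₁g₂f; the part of this along `e3` is the claim.
  have g2e3 : g 2 *ᵥ e3 = p • e3 := by
    have e : g 2 *ᵥ (g 1 *ᵥ (g 2 *ᵥ f)) = p • g 1 *ᵥ (g 2 *ᵥ f) := by
      rw [mulVec_mulVec f, mulVec_mulVec f, h.braid_two_one, ← mulVec_mulVec, ← mulVec_mulVec, f1,
        mulVec_smul, mulVec_smul, ← mulVec_mulVec]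
    rw [hY, mulVec_add, mulVec_sub, mulVec_smul, mulVec_smul, mulVec_smul, g2f, g2e2] at e
    have : (k * k') • (g 2 *ᵥ e3 - p • e3) = 0 := by
      have e' : (k * k') • (g 2 *ᵥ e3 - p • e3) =
        ((m * p) • (m • f - k • e2) - (k * m') • ((p - p⁻¹ - m) • e2 - k • f) +
          (k * k') • g 2 *ᵥ e3) - p • ((m * p) • f - (k * m') • e2 + (k * k') • e3) +
        ((k * (m' * (p - p⁻¹ - m) + m * p - p * m')) • e2 +
          (m * p * (p - m) - k ^ 2 * m') • f) := by module
      have c : m * p * (p - m) - k ^ 2 * m' = 0 := by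
        rw [kk, a4]; field_simp; ring
      rw [e', e, c, a3]; simp
    exact sub_eq_zero.1 ((smul_eq_zero_iff_right kkne).1 this)
  -- In `hrel` every term but g₀`e3` is now known in the basis, so the relation can be solved for
  -- it.
  have g0e3 : g 0 *ᵥ e3 = (-1 / p) • e3 := by
    have e := hrel
    rw [hY, g2f, mulVec_add, mulVec_sub, mulVec_smul, mulVec_smul, mulVec_smul, f0, g0e2] at e
    have hne : p ^ 3 * (k * k') ≠ 0 := mul_ne_zero (pow_ne_zero 3 p0) kkne
    have : (p ^ 3 * (k * k')) • (g 0 *ᵥ e3 - (-1 / p) • e3) = 0 := by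
      have e' : (p ^ 3 * (k * k')) • (g 0 *ᵥ e3 - (-1 / p) • e3) =
        (f + p • (m • f - k • e2) + p ^ 2 • ((m * p) • f - (k * m') • e2 + (k * k') • e3) +
          p ^ 3 • ((m * p) • p • f - (k * m') • p • e2 + (k * k') • g 0 *ᵥ e3)) -
        ((m * (1 + p ^ 2 + p ^ 4) * p + 1) • f - (k * p * (m' * (p ^ 2 + 1) * p + 1)) • e2) := by
        match_scalars <;> field_simp <;> ring
      rw [e', e, a1, a2]; simp
    exact sub_eq_zero.1 ((smul_eq_zero_iff_right hne).1 this)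
  have pp : p ≠ -1 / p := by
    intro e
    field_simp at e
    exact p2 (by linear_combination e)
  -- The value of ⟨f, g₂f⟩ makes `e2` orthogonal to `f`. The vector `e3` is orthogonal to both
  -- because its eigenvalue under g₀ is different.
  have o12 : f ⬝ᵥ e2 = 0 := by
    rw [he2, dotProduct_smul, dotProduct_sub, dotProduct_smul, hff, hfm]; simp
  have o13 : f ⬝ᵥ e3 = 0 := dotProduct_eq_zero_of_eigen (hsym 0) pp f0 g0e3
  have o23 : e2 ⬝ᵥ e3 = 0 := dotProduct_eq_zero_of_eigen (hsym 0) pp g0e2 g0e3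
  have o22 := h.dotProduct_second 2 (hsym 2) k0 kk g2f hff o12
  have o33 := h.dotProduct_second 1 (hsym 1) k0' kk' g1e2 o22 o23
  have m2 : e2 ∈ S := he2 ▸ S.smul_mem _ (sub_mem (S.smul_mem _ hf) (hS 2 f hf))
  have m3 : e3 ∈ S := he3 ▸ S.smul_mem _ (sub_mem (S.smul_mem _ m2) (hS 1 e2 m2))
  refine ⟨![f, e2, e3], ?_, ?_, ?_⟩
  · intro j; fin_cases j <;> assumption
  · intro i j
    fin_cases i <;> fin_cases j <;> simp [hff, o12, o13, o22, o23, o33, dotProduct_comm e2 f,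
      dotProduct_comm e3 f, dotProduct_comm e3 e2]
  · intro μ j
    fin_cases μ
    · simp only [Fin.zero_eta, sector31_hatR_zero, Fin.sum_univ_three]
      fin_cases j <;> simp [f0, g0e2, g0e3]
    · simp only [Fin.mk_one, r1, Fin.sum_univ_three]
      fin_cases j <;> simp [f1, g1e2, g1e3] <;> module
    · simp only [Fin.reduceFinMk, r2, Fin.sum_univ_three]
      fin_cases j <;> simp [g2f, g2e2, g2e3] <;> module

/-- A unit vector on which the outer generators act by `-p⁻¹` spans, with its image under the middle
generator, the two-dimensional sector. -/
theorem IsHecke.exists_basis_sector22 (h : IsHecke p g) (hsym : ∀ μ, (g μ)ᵀ = g μ)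
    (hp : Generic p) (hs : s ^ 2 = qNum 3 p)
    (S : Submodule ℂ (ι → ℂ)) (hS : ∀ μ, ∀ v ∈ S, g μ *ᵥ v ∈ S) {f : ι → ℂ} (hf : f ∈ S)
    (hff : f ⬝ᵥ f = 1) (f0 : g 0 *ᵥ f = (-1 / p) • f) (f2 : g 2 *ᵥ f = (-1 / p) • f)
    (w0 : g 0 *ᵥ (g 1 *ᵥ f - (p ^ 2 / qNum 2 p) • f) =
      p • (g 1 *ᵥ f - (p ^ 2 / qNum 2 p) • f))
    (w2 : g 2 *ᵥ (g 1 *ᵥ f - (p ^ 2 / qNum 2 p) • f) =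
      p • (g 1 *ᵥ f - (p ^ 2 / qNum 2 p) • f)) :
    ∃ e : Fin 2 → ι → ℂ, (∀ j, e j ∈ S) ∧ (∀ i j, e i ⬝ᵥ e j = if i = j then 1 else 0) ∧
      ∀ μ j, g μ *ᵥ e j = ∑ i, (sector22 p s).hatR μ i j • e i := by
  have p0 := hp.ne_zero
  have p2 := hp.two_ne_zero
  have p3 := hp.three_ne_zero
  have r1 := sector22_hatR_one hp hs
  have r2 : (sector22 p s).hatR 2 = (sector22 p s).hatR 0 := sector22_hatR_two hp hs
  replace hs := sq_mul_sq_of_qNum hp hs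
  have s0 : s ≠ 0 := by rintro rfl; exact p3 (by rw [← hs]; ring)
  rw [hp.qNum_two] at r1 w0 w2
  obtain ⟨m, hm⟩ : ∃ m, m = p ^ 2 / ((p ^ 2 + 1) / p) := ⟨_, rfl⟩
  obtain ⟨k, hk⟩ : ∃ k, k = s / ((p ^ 2 + 1) / p) := ⟨_, rfl⟩
  have d1 : -(1 / (p ^ 2 * ((p ^ 2 + 1) / p))) = p - p⁻¹ - m := by
    rw [hm]; field_simp; ring
  rw [← hm, ← hk, d1] at r1
  rw [← hm] at w0 w2
  have k0 : k ≠ 0 := by rw [hk]; positivity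
  have kk : k ^ 2 = 1 + (p - p⁻¹) * m - m ^ 2 := by
    rw [hk, hm]; clear * - p0 p2 hs; field_simp; grind
  clear hk hm hs d1
  obtain ⟨e, he⟩ : ∃ e, e = (-k⁻¹) • (g 1 *ᵥ f - m • f) := ⟨_, rfl⟩
  have g1f : g 1 *ᵥ f = m • f - k • e := by
    rw [he, smul_smul, mul_neg, mul_inv_cancel₀ k0]; module
  have g1e := h.mulVec_second 1 k0 kk g1f
  have g0e : g 0 *ᵥ e = p • e := by rw [he, mulVec_smul, w0, smul_comm]
  have g2e : g 2 *ᵥ e = p • e := by rw [he, mulVec_smul, w2, smul_comm]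
  have pp : -1 / p ≠ p := by
    intro e
    field_simp at e
    exact p2 (by linear_combination -e)
  have o12 : f ⬝ᵥ e = 0 := dotProduct_eq_zero_of_eigen (hsym 0) pp f0 g0e
  have o22 := h.dotProduct_second 1 (hsym 1) k0 kk g1f hff o12
  have m2 : e ∈ S := he ▸ S.smul_mem _ (sub_mem (hS 1 f hf) (S.smul_mem _ hf))
  -- The given vector comes second, because R₁ = diag(p, -1/p) in this sector.
  refine ⟨![e, f], ?_, ?_, ?_⟩
  · intro j; fin_cases j <;> assumption
  · intro i j
    fin_cases i <;> fin_cases j <;> simp [hff, o12, o22, dotProduct_comm e f]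
  · intro μ j
    fin_cases μ
    · simp only [Fin.zero_eta, sector22_hatR_zero, Fin.sum_univ_two]
      fin_cases j <;> simp [f0, g0e]
    · simp only [Fin.mk_one, r1, Fin.sum_univ_two]
      fin_cases j <;> simp [g1f, g1e] <;> module
    · simp only [Fin.reduceFinMk, r2, sector22_hatR_zero, Fin.sum_univ_two]
      fin_cases j <;> simp [f2, g2e]

end

/-! ### Highest weight equations in coordinates, and `q`-alternating vectors. -/

section

variable {q : ℂ} {N : ℕ}

lemma rowLen_eq_zero_of_le {w : List ℕ} (hw : w.SortedGE) {i : ℕ} (hi : w.length ≤ i) :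
    (YoungDiagram.ofRowLens w hw).rowLen i = 0 := by
  by_contra h
  have := YoungDiagram.mem_iff_lt_rowLen.2 (Nat.pos_of_ne_zero h)
  obtain ⟨h', -⟩ := YoungDiagram.mem_ofRowLens.1 this
  omega

lemma rowLen_Y4 (i : ℕ) : Y4.rowLen i = if i = 0 then 4 else 0 := by
  match i with
  | 0 => rw [YoungDiagram.rowLen_eq_card]; decide
  | i + 1 => simpa [Y4] using rowLen_eq_zero_of_le (w := [4]) (by decide) (i := i + 1) (by simp)

lemma rowLen_Y31 (i : ℕ) : Y31.rowLen i = if i = 0 then 3 else if i = 1 then 1 else 0 := by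
  match i with
  | 0 | 1 => rw [YoungDiagram.rowLen_eq_card]; decide
  | i + 2 => simpa [Y31] using rowLen_eq_zero_of_le (w := [3, 1]) (by decide) (i := i + 2) (by simp)

lemma rowLen_Y22 (i : ℕ) : Y22.rowLen i = if i < 2 then 2 else 0 := by
  match i with
  | 0 | 1 => rw [YoungDiagram.rowLen_eq_card]; decide
  | i + 2 => simpa [Y22] using rowLen_eq_zero_of_le (w := [2, 2]) (by decide) (i := i + 2) (by simp)

lemma rowLen_Y211 (i : ℕ) : Y211.rowLen i = if i = 0 then 2 else if i < 3 then 1 else 0 := by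
  match i with
  | 0 | 1 | 2 => rw [YoungDiagram.rowLen_eq_card]; decide
  | i + 3 => simpa [Y211] using rowLen_eq_zero_of_le (w := [2, 1, 1]) (by decide) (i := i + 3) (by simp)

lemma rowLen_Y1111 (i : ℕ) : Y1111.rowLen i = if i < 4 then 1 else 0 := by
  match i with
  | 0 | 1 | 2 | 3 => rw [YoungDiagram.rowLen_eq_card]; decide
  | i + 4 =>
    simpa [Y1111] using rowLen_eq_zero_of_le (w := [1, 1, 1, 1]) (by decide) (i := i + 4) (by simp)

lemma card_filter_words (a b c d i : Fin N) :
    (Finset.univ.filter fun k => (![a, b, c, d] : Idx N) k = i).card =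
      (if (a : ℕ) = i then 1 else 0) + (if (b : ℕ) = i then 1 else 0) +
        (if (c : ℕ) = i then 1 else 0) + (if (d : ℕ) = i then 1 else 0) := by
  rw [Finset.card_filter, Fin.sum_univ_four]
  simp only [Fin.ext_iff]
  rfl

/-- The words in which each letter `i` occurs `Q_i` times. -/
def HasContent (Q : YoungDiagram) (a b c d : Fin N) : Prop :=
  ∀ i : Fin N, (if (a : ℕ) = i then 1 else 0) + (if (b : ℕ) = i then 1 else 0) +
    (if (c : ℕ) = i then 1 else 0) + (if (d : ℕ) = i then 1 else 0) = Q.rowLen i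

lemma apply_eq_zero_of_not_hasContent {Q : YoungDiagram} {v : Idx N → ℂ}
    (hv : v ∈ multSpace N q Q) {a b c d : Fin N} (h : ¬HasContent Q a b c d) :
    v ![a, b, c, d] = 0 := by
  refine hv.1 _ ?_
  rw [HasContent, not_forall] at h
  obtain ⟨i, hi⟩ := h
  exact ⟨i, by rwa [card_filter_words]⟩

lemma mem_multSpace_of_words {Q : YoungDiagram} {v : Idx N → ℂ}
    (h : ∀ a b c d, v ![a, b, c, d] ≠ 0 → HasContent Q a b c d)
    (hE : ∀ i, raiseTensor N q i *ᵥ v = 0) : v ∈ multSpace N q Q := by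
  refine ⟨fun x ⟨i, hi⟩ => ?_, hE⟩
  rw [eq_cons x] at hi ⊢
  by_contra hne
  exact hi (by rw [card_filter_words]; exact h _ _ _ _ hne i)

lemma Determines.of_words {Q : YoungDiagram} {n : ℕ} {p : Fin n → Idx N}
    (h : ∀ v ∈ multSpace N q Q, (∀ j, v (p j) = 0) →
      ∀ a b c d, HasContent Q a b c d → v ![a, b, c, d] = 0) : Determines N q Q p := by
  intro v hv hp
  ext1 x
  rw [eq_cons x]
  by_cases hc : HasContent Q (x 0) (x 1) (x 2) (x 3)
  · exact h v hv hp _ _ _ _ hc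
  · exact apply_eq_zero_of_not_hasContent hv hc

lemma raise_eq_zero {Q : YoungDiagram} {v : Idx N → ℂ} (hv : v ∈ multSpace N q Q) {i : ℕ}
    (hi : i < N) (hi' : i + 1 < N) (a b c d : Fin N) :
    letterInd ⟨i, hi⟩ a * cartanEntry q ⟨i, hi⟩ ⟨i + 1, hi'⟩ b *
        cartanEntry q ⟨i, hi⟩ ⟨i + 1, hi'⟩ c * cartanEntry q ⟨i, hi⟩ ⟨i + 1, hi'⟩ d *
          v ![⟨i + 1, hi'⟩, b, c, d] +
        letterInd ⟨i, hi⟩ b * cartanEntry q ⟨i, hi⟩ ⟨i + 1, hi'⟩ c *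
          cartanEntry q ⟨i, hi⟩ ⟨i + 1, hi'⟩ d * v ![a, ⟨i + 1, hi'⟩, c, d] +
        letterInd ⟨i, hi⟩ c * cartanEntry q ⟨i, hi⟩ ⟨i + 1, hi'⟩ d * v ![a, b, ⟨i + 1, hi'⟩, d] +
        letterInd ⟨i, hi⟩ d * v ![a, b, c, ⟨i + 1, hi'⟩] = 0 := by
  rw [← raiseTensor_mulVec (i := i) hi' rfl rfl, hv.2 i, Pi.zero_apply]

lemma HasContent.lt {Q : YoungDiagram} {r : ℕ} {a b c d : Fin N} (h : HasContent Q a b c d)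
    (hQ : ∀ i, r ≤ i → Q.rowLen i = 0) :
    (a : ℕ) < r ∧ (b : ℕ) < r ∧ (c : ℕ) < r ∧ (d : ℕ) < r := by
  have key : ∀ i : Fin N, (i = a ∨ i = b ∨ i = c ∨ i = d) → (i : ℕ) < r := by
    intro i hi
    by_contra hlt
    have hc := h i
    rw [hQ i (by omega)] at hc
    rcases hi with rfl | rfl | rfl | rfl <;> simp at hc
  exact ⟨key a (by simp), key b (by simp), key c (by simp), key d (by simp)⟩

/-- Interchanging the letters `i` and `i + 1` on two strands, when neither occurs elsewhere. -/
lemma apply_eq_zero_iff_of_letters (hq : q ≠ 0) {Q : YoungDiagram} {v : Idx N → ℂ}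
    (hv : v ∈ multSpace N q Q) {α β : Fin N} (hβ : (β : ℕ) = α + 1) {c d : Fin N}
    (hc : c ≠ α ∧ c ≠ β) (hd : d ≠ α ∧ d ≠ β) :
    (v ![β, α, c, d] = 0 ↔ v ![α, β, c, d] = 0) ∧ (v ![β, c, α, d] = 0 ↔ v ![α, c, β, d] = 0) ∧
      (v ![β, c, d, α] = 0 ↔ v ![α, c, d, β] = 0) ∧ (v ![c, β, α, d] = 0 ↔ v ![c, α, β, d] = 0) ∧
      (v ![c, β, d, α] = 0 ↔ v ![c, α, d, β] = 0) ∧ (v ![c, d, β, α] = 0 ↔ v ![c, d, α, β] = 0) := by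
  obtain ⟨i, hi⟩ := α
  obtain ⟨j, hj⟩ := β
  obtain rfl : j = i + 1 := hβ
  -- At a word with two letters `α` the highest weight equation has two terms, one for each `α`
  -- raised to `β`. The factor `q⁻¹` is the Cartan entry of the remaining `α` to the right; the
  -- other strands contribute 1.
  have key : ∀ x y : ℂ, q⁻¹ * x + y = 0 → (x = 0 ↔ y = 0) := by
    intro x y h
    constructor
    · rintro rfl; simpa using h
    · rintro rfl; simpa [hq] using h
  refine ⟨key _ _ ?_, key _ _ ?_, key _ _ ?_, key _ _ ?_, key _ _ ?_, key _ _ ?_⟩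
  · simpa [letterInd, cartanEntry, hc, hd] using raise_eq_zero hv hi hj ⟨i, hi⟩ ⟨i, hi⟩ c d
  · simpa [letterInd, cartanEntry, hc, hd] using raise_eq_zero hv hi hj ⟨i, hi⟩ c ⟨i, hi⟩ d
  · simpa [letterInd, cartanEntry, hc, hd] using raise_eq_zero hv hi hj ⟨i, hi⟩ c d ⟨i, hi⟩
  · simpa [letterInd, cartanEntry, hc, hd] using raise_eq_zero hv hi hj c ⟨i, hi⟩ ⟨i, hi⟩ d
  · simpa [letterInd, cartanEntry, hc, hd] using raise_eq_zero hv hi hj c ⟨i, hi⟩ d ⟨i, hi⟩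
  · simpa [letterInd, cartanEntry, hc, hd] using raise_eq_zero hv hi hj c d ⟨i, hi⟩ ⟨i, hi⟩

/-! ### Alternating vectors -/

/-- The `q`-alternating function of two letters. -/
def altEntry (q : ℂ) (a b : Fin N) : ℂ := if a < b then 1 else if b < a then -q else 0

lemma rDiag_mul_altEntry (hq : q ≠ 0) (a b : Fin N) :
    rDiag q a b * altEntry q a b + (if a = b then 0 else altEntry q b a) =
      (-1 / q) * altEntry q a b := by
  rcases lt_trichotomy a b with h | rfl | h
  · simp [rDiag, altEntry, LT.lt.ne, LT.lt.not_gt, *]; field_simp; ring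
  · simp [altEntry]
  · simp [rDiag, altEntry, LT.lt.ne', LT.lt.not_gt, *]

lemma altEntry_ne_zero {a b : Fin N} (h : altEntry q a b ≠ 0) : (a : ℕ) ≠ b := by
  intro e
  apply h
  rw [Fin.ext e]
  simp [altEntry]

/-- On equal letters `R` multiplies the coordinate by `q`, and `q ≠ -1/q`. -/
lemma apply_eq_zero_of_alternating (hq : Generic q) {μ : Fin 3} {u : Idx N → ℂ}
    (hu : strandR N q μ *ᵥ u = (-1 / q) • u) {x : Idx N} (hx : x μ.castSucc = x μ.succ) :
    u x = 0 := by
  have h0 := hq.ne_zero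
  have := congrFun hu x
  rw [strandR_mulVec, if_pos hx, rDiag, if_pos hx, Pi.smul_apply, smul_eq_mul] at this
  have h2 : (q ^ 2 + 1) * u x = 0 := by field_simp at this; linear_combination this
  exact (mul_eq_zero.1 h2).resolve_left hq.two_ne_zero

lemma apply_eq_zero_of_swapAt (hq : Generic q) {μ : Fin 3} {u : Idx N → ℂ}
    (hu : strandR N q μ *ᵥ u = (-1 / q) • u) {x : Idx N} (hx : u (swapAt μ x) = 0) :
    u x = 0 := by
  have h0 := hq.ne_zero
  by_cases he : x μ.castSucc = x μ.succ
  · exact apply_eq_zero_of_alternating hq hu he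
  have := congrFun hu x
  rw [strandR_mulVec, if_neg he, rDiag, if_neg he, hx, Pi.smul_apply, smul_eq_mul] at this
  split_ifs at this
  · field_simp at this
    simpa [h0] using (show q ^ 2 * u x = 0 by linear_combination this)
  · field_simp at this
    simpa using this

/-- A vector of weight `Q` is a highest weight vector if, for every letter `α + 1` in a word of its
support, the letter `α` stands on another strand in which the vector is alternating. -/
lemma raiseTensor_eq_zero_of_alternating (hq : Generic q) {f : Idx N → ℂ} (J : Set (Fin 3))
    (L : Fin 4 → Fin 4 → Prop) (hJ : ∀ μ ∈ J, strandR N q μ *ᵥ f = (-1 / q) • f)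
    (hL : ∀ u : Idx N → ℂ, (∀ μ ∈ J, strandR N q μ *ᵥ u = (-1 / q) • u) →
      ∀ x, u x ≠ 0 → ∀ j k, L j k → x j ≠ x k)
    (hf : ∀ y, f y ≠ 0 → ∀ k α, (y k : ℕ) = α + 1 → ∃ j, j ≠ k ∧ L j k ∧ (y j : ℕ) = α) (i : ℕ) :
    raiseTensor N q i *ᵥ f = 0 := by
  rcases le_or_gt N (i + 1) with hi | hi
  · rw [raiseTensor_of_le hi, zero_mulVec]
  -- The raised vector is again alternating, because `E` commutes with `R`. A nonzero term at `x`
  -- would put the letter `i` on strand `k` and on another strand related to it by `L`, where an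
  -- alternating vector vanishes.
  have hE := hL (raiseTensor N q i *ᵥ f) fun μ hμ => by
    rw [← raiseTensor_strandR hq.ne_zero, hJ μ hμ, mulVec_smul]
  ext1 x
  by_contra hx
  have key : ∀ k, letterInd ⟨i, by omega⟩ (x k) * f (Function.update x k ⟨i + 1, hi⟩) = 0 := by
    intro k
    rw [letterInd]
    split_ifs with hk
    · rw [one_mul]
      by_contra hne
      obtain ⟨j, hjk, hj, hji⟩ := hf _ hne k i (by simp)
      rw [Function.update_of_ne hjk] at hji
      exact hE x hx j k hj (by rw [hk]; exact Fin.ext hji)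
    · rw [zero_mul]
  apply hx
  rw [eq_cons x, raiseTensor_mulVec (α := ⟨i, by omega⟩) (β := ⟨i + 1, hi⟩) hi rfl rfl]
  have e : ∀ (k : Fin 4) (y : Idx N), Function.update x k ⟨i + 1, hi⟩ = y →
      letterInd ⟨i, by omega⟩ (x k) * f y = 0 := fun k y hy => hy ▸ key k
  have e0 := e 0 ![⟨i + 1, hi⟩, x 1, x 2, x 3] (by ext1 l; fin_cases l <;> simp)
  have e1 := e 1 ![x 0, ⟨i + 1, hi⟩, x 2, x 3] (by ext1 l; fin_cases l <;> simp)
  have e2 := e 2 ![x 0, x 1, ⟨i + 1, hi⟩, x 3] (by ext1 l; fin_cases l <;> simp)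
  have e3 := e 3 ![x 0, x 1, x 2, ⟨i + 1, hi⟩] (by ext1 l; fin_cases l <;> simp)
  simp only [Pi.zero_apply]
  set κ := cartanEntry q (⟨i, by omega⟩ : Fin N) ⟨i + 1, hi⟩
  linear_combination (κ (x 1) * κ (x 2) * κ (x 3)) * e0 + (κ (x 2) * κ (x 3)) * e1 +
    κ (x 3) * e2 + e3

/-- The indicator of the first `n` letters. -/
def initInd (n : ℕ) (a : Fin N) : ℂ := if (a : ℕ) < n then 1 else 0

lemma initInd_ne_zero {n : ℕ} {a : Fin N} (h : initInd n a ≠ 0) : (a : ℕ) < n := by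
  by_contra h'
  exact h (if_neg h')

/-- The norm is reduced to the case `N = r`, where it is an explicit finite sum. -/
lemma dotProduct_self_of_init {r : ℕ} (hr : r ≤ N) (f : Idx N → ℂ) (f' : Idx r → ℂ)
    (hf : ∀ y, f (fun k => Fin.castLE hr (y k)) = f' y)
    (hf0 : ∀ x, f x ≠ 0 → ∀ k, (x k : ℕ) < r) : f ⬝ᵥ f = f' ⬝ᵥ f' := by
  symm
  refine Finset.sum_of_injOn (fun y k => Fin.castLE hr (y k)) ?_ (by simp) ?_ ?_
  · intro y _ z _ h
    ext1 k
    exact Fin.castLE_injective hr (congrFun h k)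
  · intro x _ hx
    by_contra hne
    have hx0 : f x ≠ 0 := fun e => hne (by rw [e, zero_mul])
    exact hx ⟨fun k => ⟨x k, hf0 x hx0 k⟩, by simp, rfl⟩
  · intro y _
    rw [hf]

/-- The form is bilinear, not Hermitian, so a nonzero vector may be isotropic. Each generating
vector therefore has its norm computed and shown nonzero from the genericity of `q`. -/
lemma exists_smul_dotProduct_self {ι : Type*} [Fintype ι] {f : ι → ℂ} (h : f ⬝ᵥ f ≠ 0) :
    ∃ c : ℂ, (c • f) ⬝ᵥ (c • f) = 1 := by
  obtain ⟨c, hc⟩ := IsAlgClosed.exists_pow_nat_eq (f ⬝ᵥ f)⁻¹ (n := 2) (by norm_num)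
  refine ⟨c, ?_⟩
  rw [smul_dotProduct, dotProduct_smul, smul_smul, ← sq, hc, smul_eq_mul, inv_mul_cancel₀ h]

end

/-! ### The sector `[4]`. -/

section

variable {q s t : ℂ} {N : ℕ}

lemma represents_sector4_Y4 (hq : q ≠ 0) (hN : 1 ≤ N) : (sector4 q).Represents N q Y4 := by
  have l0 : 0 < N := hN
  let f : Idx N → ℂ := fun x => initInd 1 (x 0) * initInd 1 (x 1) * initInd 1 (x 2) * initInd 1 (x 3)
  have hf : ∀ a b c d : Fin N, f ![a, b, c, d] =
    initInd 1 a * initInd 1 b * initInd 1 c * initInd 1 d := fun _ _ _ _ => rfl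
  have hfne : ∀ a b c d : Fin N, f ![a, b, c, d] ≠ 0 →
      (a : ℕ) = 0 ∧ (b : ℕ) = 0 ∧ (c : ℕ) = 0 ∧ (d : ℕ) = 0 := by
    intro a b c d h
    simp only [hf, mul_ne_zero_iff] at h
    have := initInd_ne_zero h.1.1.1
    have := initInd_ne_zero h.1.1.2
    have := initInd_ne_zero h.1.2
    have := initInd_ne_zero h.2
    omega
  have hmem : f ∈ multSpace N q Y4 := by
    refine mem_multSpace_of_words (fun a b c d h i => ?_) fun i => ?_
    · obtain ⟨h1, h2, h3, h4⟩ := hfne a b c d h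
      rw [h1, h2, h3, h4, rowLen_Y4]
      split_ifs <;> omega
    · rcases le_or_gt N (i + 1) with hi | hi
      · rw [raiseTensor_of_le hi, zero_mulVec]
      · ext1 x
        rw [eq_cons x, raiseTensor_mulVec (α := ⟨i, by omega⟩) (β := ⟨i + 1, hi⟩) hi rfl rfl]
        simp [hf, initInd]
  have hdet : Determines N q Y4 (n := 1) ![![⟨0, l0⟩, ⟨0, l0⟩, ⟨0, l0⟩, ⟨0, l0⟩]] := by
    refine Determines.of_words fun v hv hp a b c d h => ?_
    have hlt := h.lt (r := 1) fun i hi => by rw [rowLen_Y4, if_neg (by omega)]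
    have : a = ⟨0, l0⟩ ∧ b = ⟨0, l0⟩ ∧ c = ⟨0, l0⟩ ∧ d = ⟨0, l0⟩ := by
      simp only [Fin.ext_iff]; omega
    rw [this.1, this.2.1, this.2.2.1, this.2.2.2]
    exact hp 0
  refine Mixing.represents_of_orthonormal hdet (fun _ => f) (fun _ => hmem) (fun i j => ?_)
    fun μ j => ?_
  · rw [Subsingleton.elim i j, if_pos rfl, dotProduct_self_of_init (r := 1) hN f (fun _ => 1)]
    · simp [dotProduct]
    · intro y; simp [f, initInd]
    · intro x hx k
      have := hfne (x 0) (x 1) (x 2) (x 3) (by rwa [← eq_cons x])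
      fin_cases k <;> simp <;> omega
  · rw [sector4_hatR, Fin.sum_univ_one]
    refine hdet.ext (strandR_mulVec_mem hq μ hmem) (Submodule.smul_mem _ _ hmem) fun k => ?_
    fin_cases j; fin_cases k; fin_cases μ
    · simp [strandR_zero_mulVec, rDiag]
    · simp [strandR_one_mulVec, rDiag]
    · simp [strandR_two_mulVec, rDiag]

/-! ### The sector `[31]` -/

/-- The highest weight vector of weight `[31]` that is `q`-symmetric in the first three strands. -/
def symVec31 (N : ℕ) (q : ℂ) : Idx N → ℂ := fun x =>
  if (x 0 : ℕ) = 1 ∧ (x 1 : ℕ) = 0 ∧ (x 2 : ℕ) = 0 ∧ (x 3 : ℕ) = 0 then 1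
  else if (x 0 : ℕ) = 0 ∧ (x 1 : ℕ) = 1 ∧ (x 2 : ℕ) = 0 ∧ (x 3 : ℕ) = 0 then q
  else if (x 0 : ℕ) = 0 ∧ (x 1 : ℕ) = 0 ∧ (x 2 : ℕ) = 1 ∧ (x 3 : ℕ) = 0 then q ^ 2
  else if (x 0 : ℕ) = 0 ∧ (x 1 : ℕ) = 0 ∧ (x 2 : ℕ) = 0 ∧ (x 3 : ℕ) = 1 then
    -(q + q⁻¹ + (q ^ 3)⁻¹)
  else 0

lemma symVec31_apply (a b c d : Fin N) : symVec31 N q ![a, b, c, d] =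
    if (a : ℕ) = 1 ∧ (b : ℕ) = 0 ∧ (c : ℕ) = 0 ∧ (d : ℕ) = 0 then 1
    else if (a : ℕ) = 0 ∧ (b : ℕ) = 1 ∧ (c : ℕ) = 0 ∧ (d : ℕ) = 0 then q
    else if (a : ℕ) = 0 ∧ (b : ℕ) = 0 ∧ (c : ℕ) = 1 ∧ (d : ℕ) = 0 then q ^ 2
    else if (a : ℕ) = 0 ∧ (b : ℕ) = 0 ∧ (c : ℕ) = 0 ∧ (d : ℕ) = 1 then
      -(q + q⁻¹ + (q ^ 3)⁻¹)
    else 0 := rfl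

/-- The coefficients 1, q, q² enter the only nontrivial highest weight equation as q⁻³ + q⁻¹ + q,
which the fourth coefficient cancels. -/
lemma symVec31_mem (hq : q ≠ 0) : symVec31 N q ∈ multSpace N q Y31 := by
  refine mem_multSpace_of_words (fun a b c d h i => ?_) fun i => ?_
  · rw [symVec31_apply] at h
    rw [rowLen_Y31]
    split_ifs at h with h1 h2 h3 h4
    · rw [h1.1, h1.2.1, h1.2.2.1, h1.2.2.2]; split_ifs <;> omega
    · rw [h2.1, h2.2.1, h2.2.2.1, h2.2.2.2]; split_ifs <;> omega
    · rw [h3.1, h3.2.1, h3.2.2.1, h3.2.2.2]; split_ifs <;> omega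
    · rw [h4.1, h4.2.1, h4.2.2.1, h4.2.2.2]; split_ifs <;> omega
    · exact absurd rfl h
  · rcases le_or_gt N (i + 1) with hi | hi
    · rw [raiseTensor_of_le hi, zero_mulVec]
    ext1 x
    rw [eq_cons x, raiseTensor_mulVec (α := ⟨i, by omega⟩) (β := ⟨i + 1, hi⟩) hi rfl rfl]
    generalize x 0 = a
    generalize x 1 = b
    generalize x 2 = c
    generalize x 3 = d
    rcases Nat.eq_zero_or_pos i with rfl | hpos
    · simp only [symVec31_apply, letterInd, cartanEntry, Fin.ext_iff]
      by_cases ha : (a : ℕ) = 0 <;> by_cases hb : (b : ℕ) = 0 <;> by_cases hc : (c : ℕ) = 0 <;>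
        by_cases hd : (d : ℕ) = 0 <;> simp [ha, hb, hc, hd]
      field_simp; ring
    · have : i ≠ 0 := hpos.ne'
      simp [symVec31_apply, this]

/-- Only four words have this content, and the highest weight equation at `0000` gives the remaining
coordinate from the other three. -/
lemma determines_Y31 (l0 : 0 < N) (l1 : 1 < N) : Determines N q Y31
    ![![⟨1, l1⟩, ⟨0, l0⟩, ⟨0, l0⟩, ⟨0, l0⟩], ![⟨0, l0⟩, ⟨1, l1⟩, ⟨0, l0⟩, ⟨0, l0⟩],
      ![⟨0, l0⟩, ⟨0, l0⟩, ⟨1, l1⟩, ⟨0, l0⟩]] := by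
  refine Determines.of_words fun v hv hp a b c d h => ?_
  have p0 := hp 0
  have p1 := hp 1
  have p2 := hp 2
  have hE := raise_eq_zero hv l0 l1 ⟨0, l0⟩ ⟨0, l0⟩ ⟨0, l0⟩ ⟨0, l0⟩
  simp [letterInd] at p0 p1 p2 hE
  simp [p0, p1, p2] at hE
  have hlt := h.lt (r := 2) fun i hi => by rw [rowLen_Y31, if_neg (by omega), if_neg (by omega)]
  have hl : ∀ i : Fin N, (i : ℕ) < 2 → i = ⟨0, l0⟩ ∨ i = ⟨1, l1⟩ := by
    intro i hi
    simp only [Fin.ext_iff]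
    omega
  have h0 := h ⟨0, l0⟩
  rw [rowLen_Y31] at h0
  rcases hl a hlt.1 with rfl | rfl <;> rcases hl b hlt.2.1 with rfl | rfl <;>
    rcases hl c hlt.2.2.1 with rfl | rfl <;> rcases hl d hlt.2.2.2 with rfl | rfl <;>
    first | assumption | (exfalso; simp at h0)

lemma symVec31_dotProduct_ne_zero (hq : Generic q) (hN : 2 ≤ N) :
    symVec31 N q ⬝ᵥ symVec31 N q ≠ 0 := by
  rw [dotProduct_self_of_init hN (symVec31 N q) (symVec31 2 q) (fun y => rfl)]
  · have h0 := hq.ne_zero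
    have h2 := hq.two_ne_zero
    have h3 := hq.three_ne_zero
    have h4 := hq.four_ne_zero
    have : symVec31 2 q ⬝ᵥ symVec31 2 q =
        (q ^ 4 + q ^ 2 + 1) * (q ^ 2 + 1) * (q ^ 4 + 1) / q ^ 6 := by
      rw [dotProduct, sum_words]
      simp [Fin.sum_univ_two, symVec31_apply]
      field_simp; ring
    rw [this]
    positivity
  · intro x hx k
    rw [symVec31] at hx
    split_ifs at hx <;> first | (fin_cases k <;> simp <;> omega) | exact absurd rfl hx

theorem represents_sector31_Y31 (hq : Generic q) (hs : s ^ 2 = qNum 3 q)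
    (ht : t ^ 2 = q ^ 2 + (q ^ 2)⁻¹) (hN : 2 ≤ N) : (sector31 q s t).Represents N q Y31 := by
  have h0 := hq.ne_zero
  obtain ⟨c, hc⟩ := exists_smul_dotProduct_self (symVec31_dotProduct_ne_zero hq hN)
  have hd := determines_Y31 (q := q) (show 0 < N by omega) (show 1 < N by omega)
  have hm := symVec31_mem (N := N) h0
  have hR : ∀ μ, ∀ v ∈ multSpace N q Y31, strandR N q μ *ᵥ v ∈ multSpace N q Y31 :=
    fun μ v hv => strandR_mulVec_mem h0 μ hv
  have hsm : ∀ (b : ℂ), ∀ v ∈ multSpace N q Y31, b • v ∈ multSpace N q Y31 :=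
    fun b v hv => Submodule.smul_mem _ _ hv
  have f0 : strandR N q 0 *ᵥ symVec31 N q = q • symVec31 N q := by
    refine hd.ext (hR _ _ hm) (hsm _ _ hm) fun j => ?_
    fin_cases j <;> simp [strandR_zero_mulVec, rDiag, symVec31_apply] <;> field_simp <;> ring
  have f1 : strandR N q 1 *ᵥ symVec31 N q = q • symVec31 N q := by
    refine hd.ext (hR _ _ hm) (hsm _ _ hm) fun j => ?_
    fin_cases j <;> simp [strandR_one_mulVec, rDiag, symVec31_apply] <;> field_simp <;> ring
  -- Composed with the symmetrizer of H_3, this sum over coset representatives is the symmetrizer of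
  -- H_4. Both sides lie in the multiplicity space, so the three determining coordinates suffice for
  -- the check.
  have hrel : symVec31 N q + q • strandR N q 2 *ᵥ symVec31 N q +
      q ^ 2 • strandR N q 1 *ᵥ (strandR N q 2 *ᵥ symVec31 N q) +
      q ^ 3 • strandR N q 0 *ᵥ (strandR N q 1 *ᵥ (strandR N q 2 *ᵥ symVec31 N q)) = 0 := by
    refine hd.ext (add_mem (add_mem (add_mem hm (hsm _ _ (hR _ _ hm)))
      (hsm _ _ (hR _ _ (hR _ _ hm)))) (hsm _ _ (hR _ _ (hR _ _ (hR _ _ hm)))))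
      (Submodule.zero_mem _) fun j => ?_
    fin_cases j <;> simp [-mulVec_mulVec, strandR_zero_mulVec, strandR_one_mulVec,
      strandR_two_mulVec, rDiag,
      symVec31_apply] <;> field_simp <;> ring
  obtain ⟨e, he, ho, ha⟩ := (isHecke_strandR N h0).exists_basis_sector31 transpose_strandR hq hs ht
    (multSpace N q Y31) hR (hsm c _ hm) hc (by rw [mulVec_smul, f0, smul_comm])
    (by rw [mulVec_smul, f1, smul_comm]) (by
      simp only [mulVec_smul]
      simp only [smul_comm _ c, ← smul_add, hrel, smul_zero])
  exact Mixing.represents_of_orthonormal hd e he ho ha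

end

section

variable {q s t : ℂ} {N : ℕ}

lemma strandR_mulVec_of_alternating (hq : q ≠ 0) {μ : Fin 3} {f : Idx N → ℂ} (G : Idx N → ℂ)
    (hf : ∀ x, f x = altEntry q (x μ.castSucc) (x μ.succ) * G x)
    (hG : ∀ x, G (swapAt μ x) = G x) : strandR N q μ *ᵥ f = (-1 / q) • f := by
  ext1 x
  have h1 : swapAt μ x μ.castSucc = x μ.succ := by simp [swapAt]
  have h2 : swapAt μ x μ.succ = x μ.castSucc := by simp [swapAt]
  rw [strandR_mulVec, Pi.smul_apply, smul_eq_mul, hf, hf, hG, h1, h2, ← mul_assoc, ← mul_assoc,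
    ← rDiag_mul_altEntry hq]
  split_ifs <;> ring

/-! ### The sector `[22]` -/

/-- The highest weight vector of weight `[22]` that is `q`-alternating in the first two and in the
last two strands. -/
def altVec22 (N : ℕ) (q : ℂ) : Idx N → ℂ := fun x =>
  altEntry q (x 0) (x 1) * altEntry q (x 2) (x 3) *
    (initInd 2 (x 0) * initInd 2 (x 1) * initInd 2 (x 2) * initInd 2 (x 3))

lemma altVec22_apply (a b c d : Fin N) : altVec22 N q ![a, b, c, d] =
    altEntry q a b * altEntry q c d *
      (initInd 2 a * initInd 2 b * initInd 2 c * initInd 2 d) := rfl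

lemma altVec22_support {x : Idx N} (h : altVec22 N q x ≠ 0) :
    ((x 0 : ℕ) ≠ x 1 ∧ (x 2 : ℕ) ≠ x 3) ∧
      (x 0 : ℕ) < 2 ∧ (x 1 : ℕ) < 2 ∧ (x 2 : ℕ) < 2 ∧ (x 3 : ℕ) < 2 := by
  simp only [altVec22, mul_ne_zero_iff] at h
  exact ⟨⟨altEntry_ne_zero h.1.1, altEntry_ne_zero h.1.2⟩, initInd_ne_zero h.2.1.1.1,
    initInd_ne_zero h.2.1.1.2, initInd_ne_zero h.2.1.2, initInd_ne_zero h.2.2⟩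

lemma strandR_zero_altVec22 (hq : q ≠ 0) :
    strandR N q 0 *ᵥ altVec22 N q = (-1 / q) • altVec22 N q := by
  refine strandR_mulVec_of_alternating hq (fun x => altEntry q (x 2) (x 3) *
    (initInd 2 (x 0) * initInd 2 (x 1) * initInd 2 (x 2) * initInd 2 (x 3)))
    (fun x => by simp only [altVec22, Fin.castSucc_zero, Fin.succ_zero_eq_one]; ring) fun x => ?_
  rw [eq_cons x, swapAt_zero]
  change altEntry q (x 2) (x 3) * (initInd 2 (x 1) * initInd 2 (x 0) * initInd 2 (x 2) *
    initInd 2 (x 3)) = altEntry q (x 2) (x 3) * (initInd 2 (x 0) * initInd 2 (x 1) *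
    initInd 2 (x 2) * initInd 2 (x 3))
  ring

lemma strandR_two_altVec22 (hq : q ≠ 0) :
    strandR N q 2 *ᵥ altVec22 N q = (-1 / q) • altVec22 N q := by
  refine strandR_mulVec_of_alternating hq (fun x => altEntry q (x 0) (x 1) *
    (initInd 2 (x 0) * initInd 2 (x 1) * initInd 2 (x 2) * initInd 2 (x 3)))
    (fun x => ?_) fun x => ?_
  · change _ = altEntry q (x 2) (x 3) * _
    rw [altVec22]; ring
  · rw [eq_cons x, swapAt_two]
    change altEntry q (x 0) (x 1) * (initInd 2 (x 0) * initInd 2 (x 1) * initInd 2 (x 3) *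
      initInd 2 (x 2)) = altEntry q (x 0) (x 1) * (initInd 2 (x 0) * initInd 2 (x 1) *
      initInd 2 (x 2) * initInd 2 (x 3))
    ring

lemma altVec22_mem (hq : Generic q) : altVec22 N q ∈ multSpace N q Y22 := by
  refine mem_multSpace_of_words (fun a b c d h i => ?_) ?_
  · obtain ⟨⟨h1, h2⟩, h3, h4, h5, h6⟩ := altVec22_support h
    simp at h1 h2 h3 h4 h5 h6
    rw [rowLen_Y22]
    split_ifs <;> omega
  · refine raiseTensor_eq_zero_of_alternating hq {0, 2}
      (fun j k => (j = 0 ∧ k = 1) ∨ (j = 1 ∧ k = 0) ∨ (j = 2 ∧ k = 3) ∨ (j = 3 ∧ k = 2)) ?_ ?_ ?_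
    · rintro μ (rfl | rfl)
      · exact strandR_zero_altVec22 hq.ne_zero
      · exact strandR_two_altVec22 hq.ne_zero
    · intro u hu x hx
      have h01 : x 0 ≠ x 1 := fun e => hx (apply_eq_zero_of_alternating hq (hu 0 (by simp)) e)
      have h23 : x 2 ≠ x 3 := fun e => hx (apply_eq_zero_of_alternating hq (hu 2 (by simp)) e)
      rintro j k (⟨rfl, rfl⟩ | ⟨rfl, rfl⟩ | ⟨rfl, rfl⟩ | ⟨rfl, rfl⟩)
      exacts [h01, h01.symm, h23, h23.symm]
    · intro y hy k α hk
      have := altVec22_support hy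
      fin_cases k <;> simp at hk
      · exact ⟨1, by decide, by decide, by omega⟩
      · exact ⟨0, by decide, by decide, by omega⟩
      · exact ⟨3, by decide, by decide, by omega⟩
      · exact ⟨2, by decide, by decide, by omega⟩

/-- Six words have this content, and the four equations of E₀ leave two free coordinates. -/
lemma determines_Y22 (hq : Generic q) (l0 : 0 < N) (l1 : 1 < N) : Determines N q Y22
    ![![⟨1, l1⟩, ⟨1, l1⟩, ⟨0, l0⟩, ⟨0, l0⟩], ![⟨1, l1⟩, ⟨0, l0⟩, ⟨1, l1⟩, ⟨0, l0⟩]] := by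
  refine Determines.of_words fun v hv hp a b c d h => ?_
  have q0 := hq.ne_zero
  have q2 := hq.two_ne_zero
  have p0 := hp 0
  have p1 := hp 1
  have e0 := raise_eq_zero hv l0 l1 ⟨1, l1⟩ ⟨0, l0⟩ ⟨0, l0⟩ ⟨0, l0⟩
  have e1 := raise_eq_zero hv l0 l1 ⟨0, l0⟩ ⟨1, l1⟩ ⟨0, l0⟩ ⟨0, l0⟩
  have e2 := raise_eq_zero hv l0 l1 ⟨0, l0⟩ ⟨0, l0⟩ ⟨1, l1⟩ ⟨0, l0⟩
  have e3 := raise_eq_zero hv l0 l1 ⟨0, l0⟩ ⟨0, l0⟩ ⟨0, l0⟩ ⟨1, l1⟩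
  simp [letterInd, cartanEntry] at p0 p1 e0 e1 e2 e3
  simp [p0, p1, q0] at e0 e1 e2 e3
  rw [e0] at e3
  -- With x, y, z the coordinates at `0110`, `0101`, `0011`, the equations are x/q + y = 0, x + z =
  -- 0 and y + qz = 0, whence (q² + 1)x = 0.
  have h12 : v ![⟨0, l0⟩, ⟨1, l1⟩, ⟨1, l1⟩, ⟨0, l0⟩] = 0 := by
    field_simp at e1 e2 e3
    refine (mul_eq_zero.1 (?_ : (q ^ 2 + 1) * _ = 0)).resolve_left q2
    grind
  have h13 : v ![⟨0, l0⟩, ⟨1, l1⟩, ⟨0, l0⟩, ⟨1, l1⟩] = 0 := by simpa [h12] using e1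
  have h23 : v ![⟨0, l0⟩, ⟨0, l0⟩, ⟨1, l1⟩, ⟨1, l1⟩] = 0 := by simpa [h12] using e2
  have hlt := h.lt (r := 2) fun i hi => by rw [rowLen_Y22, if_neg (by omega)]
  have hl : ∀ i : Fin N, (i : ℕ) < 2 → i = ⟨0, l0⟩ ∨ i = ⟨1, l1⟩ := by
    intro i hi
    simp only [Fin.ext_iff]
    omega
  have h0 := h ⟨0, l0⟩
  rw [rowLen_Y22] at h0
  rcases hl a hlt.1 with rfl | rfl <;> rcases hl b hlt.2.1 with rfl | rfl <;>
    rcases hl c hlt.2.2.1 with rfl | rfl <;> rcases hl d hlt.2.2.2 with rfl | rfl <;>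
    first | assumption | (exfalso; simp at h0)

lemma altVec22_dotProduct_ne_zero (hq : Generic q) (hN : 2 ≤ N) :
    altVec22 N q ⬝ᵥ altVec22 N q ≠ 0 := by
  rw [dotProduct_self_of_init hN (altVec22 N q) (altVec22 2 q) (fun y => rfl)]
  · have h2 := hq.two_ne_zero
    have : altVec22 2 q ⬝ᵥ altVec22 2 q = (q ^ 2 + 1) ^ 2 := by
      rw [dotProduct, sum_words]
      simp [Fin.sum_univ_two, altVec22_apply, altEntry, initInd]
      ring
    rw [this]
    positivity
  · intro x hx k
    have := altVec22_support hx
    fin_cases k <;> simp <;> omega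

theorem represents_sector22_Y22 (hq : Generic q) (hs : s ^ 2 = qNum 3 q) (hN : 2 ≤ N) :
    (sector22 q s).Represents N q Y22 := by
  have h0 := hq.ne_zero
  have h2 := hq.two_ne_zero
  obtain ⟨c, hc⟩ := exists_smul_dotProduct_self (altVec22_dotProduct_ne_zero hq hN)
  have hd := determines_Y22 hq (show 0 < N by omega) (show 1 < N by omega)
  have hm := altVec22_mem (N := N) hq
  have hR : ∀ μ, ∀ v ∈ multSpace N q Y22, strandR N q μ *ᵥ v ∈ multSpace N q Y22 :=
    fun μ v hv => strandR_mulVec_mem h0 μ hv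
  have hsm : ∀ (b : ℂ), ∀ v ∈ multSpace N q Y22, b • v ∈ multSpace N q Y22 :=
    fun b v hv => Submodule.smul_mem _ _ hv
  -- Up to scale `w` is the other basis vector; subtracting the diagonal coefficient of R₂ leaves
  -- the common eigenvector of the outer generators for `q`.
  set w : Idx N → ℂ := strandR N q 1 *ᵥ altVec22 N q - (q ^ 2 / qNum 2 q) • altVec22 N q with hw
  have hwm : w ∈ multSpace N q Y22 := sub_mem (hR _ _ hm) (hsm _ _ hm)
  have w0 : strandR N q 0 *ᵥ w = q • w := by
    refine hd.ext (hR _ _ hwm) (hsm _ _ hwm) fun j => ?_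
    fin_cases j <;> simp [hw, hq.qNum_two, strandR_zero_mulVec, strandR_one_mulVec, rDiag,
      altVec22_apply, altEntry, initInd] <;> field_simp <;> ring
  have w2 : strandR N q 2 *ᵥ w = q • w := by
    refine hd.ext (hR _ _ hwm) (hsm _ _ hwm) fun j => ?_
    fin_cases j <;> simp [hw, hq.qNum_two, strandR_two_mulVec, strandR_one_mulVec, rDiag,
      altVec22_apply, altEntry, initInd] <;> field_simp <;> ring
  have hcw : strandR N q 1 *ᵥ c • altVec22 N q - (q ^ 2 / qNum 2 q) • c • altVec22 N q = c • w := by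
    rw [hw, mulVec_smul, smul_sub, smul_comm c]
  obtain ⟨e, he, ho, ha⟩ := (isHecke_strandR N h0).exists_basis_sector22 transpose_strandR hq hs
    (multSpace N q Y22) hR (hsm c _ hm) hc
    (by rw [mulVec_smul, strandR_zero_altVec22 h0, smul_comm])
    (by rw [mulVec_smul, strandR_two_altVec22 h0, smul_comm])
    (by rw [hcw, mulVec_smul, w0, smul_comm]) (by rw [hcw, mulVec_smul, w2, smul_comm])
  exact Mixing.represents_of_orthonormal hd e he ho ha

end

section

variable {q s t : ℂ} {N : ℕ}

/-! ### The sector `[211]` -/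

/-- The highest weight vector of weight `[211]` that is `q`-alternating in the first three
strands. -/
def altVec211 (N : ℕ) (q : ℂ) : Idx N → ℂ := fun x =>
  altEntry q (x 0) (x 1) * altEntry q (x 0) (x 2) * altEntry q (x 1) (x 2) *
    (initInd 3 (x 0) * initInd 3 (x 1) * initInd 3 (x 2) * initInd 1 (x 3))

lemma altVec211_apply (a b c d : Fin N) : altVec211 N q ![a, b, c, d] =
    altEntry q a b * altEntry q a c * altEntry q b c *
      (initInd 3 a * initInd 3 b * initInd 3 c * initInd 1 d) := rfl

lemma altVec211_support {x : Idx N} (h : altVec211 N q x ≠ 0) :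
    ((x 0 : ℕ) ≠ x 1 ∧ (x 0 : ℕ) ≠ x 2 ∧ (x 1 : ℕ) ≠ x 2) ∧
      (x 0 : ℕ) < 3 ∧ (x 1 : ℕ) < 3 ∧ (x 2 : ℕ) < 3 ∧ (x 3 : ℕ) < 1 := by
  simp only [altVec211, mul_ne_zero_iff] at h
  exact ⟨⟨altEntry_ne_zero h.1.1.1, altEntry_ne_zero h.1.1.2, altEntry_ne_zero h.1.2⟩,
    initInd_ne_zero h.2.1.1.1, initInd_ne_zero h.2.1.1.2, initInd_ne_zero h.2.1.2,
    initInd_ne_zero h.2.2⟩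

lemma strandR_zero_altVec211 (hq : q ≠ 0) :
    strandR N q 0 *ᵥ altVec211 N q = (-1 / q) • altVec211 N q := by
  refine strandR_mulVec_of_alternating hq (fun x => altEntry q (x 0) (x 2) *
    altEntry q (x 1) (x 2) *
      (initInd 3 (x 0) * initInd 3 (x 1) * initInd 3 (x 2) * initInd 1 (x 3)))
    (fun x => ?_) fun x => ?_
  · change _ = altEntry q (x 0) (x 1) * _
    rw [altVec211]; ring
  · rw [eq_cons x, swapAt_zero]
    change altEntry q (x 1) (x 2) * altEntry q (x 0) (x 2) *
      (initInd 3 (x 1) * initInd 3 (x 0) * initInd 3 (x 2) * initInd 1 (x 3)) =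
      altEntry q (x 0) (x 2) * altEntry q (x 1) (x 2) *
      (initInd 3 (x 0) * initInd 3 (x 1) * initInd 3 (x 2) * initInd 1 (x 3))
    ring

lemma strandR_one_altVec211 (hq : q ≠ 0) :
    strandR N q 1 *ᵥ altVec211 N q = (-1 / q) • altVec211 N q := by
  refine strandR_mulVec_of_alternating hq (fun x => altEntry q (x 0) (x 1) *
    altEntry q (x 0) (x 2) *
      (initInd 3 (x 0) * initInd 3 (x 1) * initInd 3 (x 2) * initInd 1 (x 3)))
    (fun x => ?_) fun x => ?_
  · change _ = altEntry q (x 1) (x 2) * _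
    rw [altVec211]; ring
  · rw [eq_cons x, swapAt_one]
    change altEntry q (x 0) (x 2) * altEntry q (x 0) (x 1) *
      (initInd 3 (x 0) * initInd 3 (x 2) * initInd 3 (x 1) * initInd 1 (x 3)) =
      altEntry q (x 0) (x 1) * altEntry q (x 0) (x 2) *
      (initInd 3 (x 0) * initInd 3 (x 1) * initInd 3 (x 2) * initInd 1 (x 3))
    ring

lemma apply_eq_zero_of_alternating_zero_one (hq : Generic q) {u : Idx N → ℂ}
    (h0 : strandR N q 0 *ᵥ u = (-1 / q) • u) (h1 : strandR N q 1 *ᵥ u = (-1 / q) • u)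
    {x : Idx N} (hx : x 0 = x 2) : u x = 0 :=
  apply_eq_zero_of_swapAt hq h0 (apply_eq_zero_of_alternating hq h1 hx)

lemma apply_eq_zero_of_alternating_one_two (hq : Generic q) {u : Idx N → ℂ}
    (h1 : strandR N q 1 *ᵥ u = (-1 / q) • u) (h2 : strandR N q 2 *ᵥ u = (-1 / q) • u)
    {x : Idx N} (hx : x 1 = x 3) : u x = 0 :=
  apply_eq_zero_of_swapAt hq h1 (apply_eq_zero_of_alternating hq h2 hx)

lemma altVec211_mem (hq : Generic q) : altVec211 N q ∈ multSpace N q Y211 := by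
  refine mem_multSpace_of_words (fun a b c d h i => ?_) ?_
  · obtain ⟨⟨h1, h2, h2'⟩, h3, h4, h5, h6⟩ := altVec211_support h
    simp at h1 h2 h2' h3 h4 h5 h6
    rw [rowLen_Y211]
    split_ifs <;> omega
  · refine raiseTensor_eq_zero_of_alternating hq {0, 1}
      (fun j k => j ≠ k ∧ j ≠ 3 ∧ k ≠ 3) ?_ ?_ ?_
    · rintro μ (rfl | rfl)
      · exact strandR_zero_altVec211 hq.ne_zero
      · exact strandR_one_altVec211 hq.ne_zero
    · intro u hu x hx
      have h0 := hu 0 (by simp)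
      have h1 := hu 1 (by simp)
      have h01 : x 0 ≠ x 1 := fun e => hx (apply_eq_zero_of_alternating hq h0 e)
      have h12 : x 1 ≠ x 2 := fun e => hx (apply_eq_zero_of_alternating hq h1 e)
      have h02 : x 0 ≠ x 2 := fun e => hx (apply_eq_zero_of_alternating_zero_one hq h0 h1 e)
      intro j k hjk
      fin_cases j <;> fin_cases k <;>
        first | assumption | (apply Ne.symm; assumption) | simp at hjk
    · intro y hy k α hk
      have := altVec211_support hy
      have key : (y 0 : ℕ) = α ∨ (y 1 : ℕ) = α ∨ (y 2 : ℕ) = α := by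
        fin_cases k <;> simp at hk <;> omega
      have hk3 : k ≠ 3 := by rintro rfl; omega
      rcases key with h | h | h
      · exact ⟨0, by rintro rfl; omega, ⟨by rintro rfl; omega, by decide, hk3⟩, h⟩
      · exact ⟨1, by rintro rfl; omega, ⟨by rintro rfl; omega, by decide, hk3⟩, h⟩
      · exact ⟨2, by rintro rfl; omega, ⟨by rintro rfl; omega, by decide, hk3⟩, h⟩

/-- Of the twelve words, E₁ pairs those that differ by exchanging 1 and 2. The equations of E₀ then
give the coordinates with 1 on the last strand from those with 0 there. -/
lemma determines_Y211 (hq : q ≠ 0) (l0 : 0 < N) (l1 : 1 < N) (l2 : 2 < N) : Determines N q Y211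
    ![![⟨1, l1⟩, ⟨2, l2⟩, ⟨0, l0⟩, ⟨0, l0⟩], ![⟨1, l1⟩, ⟨0, l0⟩, ⟨2, l2⟩, ⟨0, l0⟩],
      ![⟨0, l0⟩, ⟨1, l1⟩, ⟨2, l2⟩, ⟨0, l0⟩]] := by
  refine Determines.of_words fun v hv hp a b c d h => ?_
  have p0 := hp 0
  have p1 := hp 1
  have p2 := hp 2
  have hsw := apply_eq_zero_iff_of_letters hq hv (α := ⟨1, l1⟩) (β := ⟨2, l2⟩) rfl
    (c := ⟨0, l0⟩) (d := ⟨0, l0⟩) (by simp) (by simp)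
  obtain ⟨s01, s02, s03, s12, s13, s23⟩ := hsw
  simp at p0 p1 p2
  have r0 := s01.2 p0
  have r1 := s02.2 p1
  have r2 := s12.2 p2
  have e0 := raise_eq_zero hv l0 l1 ⟨2, l2⟩ ⟨0, l0⟩ ⟨0, l0⟩ ⟨0, l0⟩
  have e1 := raise_eq_zero hv l0 l1 ⟨0, l0⟩ ⟨2, l2⟩ ⟨0, l0⟩ ⟨0, l0⟩
  have e2 := raise_eq_zero hv l0 l1 ⟨0, l0⟩ ⟨0, l0⟩ ⟨2, l2⟩ ⟨0, l0⟩
  simp [letterInd, cartanEntry, p0, p1, p2, r0, r1, r2] at e0 e1 e2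
  have u0 := s03.1 e0
  have u1 := s13.1 e1
  have u2 := s23.1 e2
  have hlt := h.lt (r := 3) fun i hi => by rw [rowLen_Y211, if_neg (by omega), if_neg (by omega)]
  have hl : ∀ i : Fin N, (i : ℕ) < 3 → i = ⟨0, l0⟩ ∨ i = ⟨1, l1⟩ ∨ i = ⟨2, l2⟩ := by
    intro i hi
    simp only [Fin.ext_iff]
    omega
  have h0 := h ⟨0, l0⟩
  have h1 := h ⟨1, l1⟩
  rw [rowLen_Y211] at h0 h1
  rcases hl a hlt.1 with rfl | rfl | rfl <;> rcases hl b hlt.2.1 with rfl | rfl | rfl <;>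
    rcases hl c hlt.2.2.1 with rfl | rfl | rfl <;> rcases hl d hlt.2.2.2 with rfl | rfl | rfl <;>
    first | assumption | (exfalso; simp at h0; done) | (exfalso; simp at h1)

lemma altVec211_dotProduct_ne_zero (hq : Generic q) (hN : 3 ≤ N) :
    altVec211 N q ⬝ᵥ altVec211 N q ≠ 0 := by
  rw [dotProduct_self_of_init hN (altVec211 N q) (altVec211 3 q) (fun y => rfl)]
  · have h2 := hq.two_ne_zero
    have h3 := hq.three_ne_zero
    have : altVec211 3 q ⬝ᵥ altVec211 3 q = (q ^ 2 + 1) * (q ^ 4 + q ^ 2 + 1) := by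
      rw [dotProduct, sum_words]
      simp [Fin.sum_univ_three, altVec211_apply, altEntry, initInd]
      ring
    rw [this]
    positivity
  · intro x hx k
    have := altVec211_support hx
    fin_cases k <;> simp <;> omega

theorem represents_sector31_Y211 (hq : Generic q) (hs : s ^ 2 = qNum 3 q)
    (ht : t ^ 2 = q ^ 2 + (q ^ 2)⁻¹) (hN : 3 ≤ N) :
    (sector31 (-1 / q) s t).Represents N q Y211 := by
  have h0 := hq.ne_zero
  have hinv : -1 / (-1 / q) = q := by field_simp
  -- For the parameter `p = -1/q` the alternating vector is an eigenvector for `p`, so the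
  -- construction of `[31]` applies.
  have hH : IsHecke (-1 / q) (strandR N q) :=
    IsHecke.of_neg_inv (by rw [hinv]; exact isHecke_strandR N h0)
  obtain ⟨c, hc⟩ := exists_smul_dotProduct_self (altVec211_dotProduct_ne_zero hq hN)
  have hd := determines_Y211 h0 (show 0 < N by omega) (show 1 < N by omega) (show 2 < N by omega)
  have hm := altVec211_mem (N := N) hq
  have hR : ∀ μ, ∀ v ∈ multSpace N q Y211, strandR N q μ *ᵥ v ∈ multSpace N q Y211 :=
    fun μ v hv => strandR_mulVec_mem h0 μ hv
  have hsm : ∀ (b : ℂ), ∀ v ∈ multSpace N q Y211, b • v ∈ multSpace N q Y211 :=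
    fun b v hv => Submodule.smul_mem _ _ hv
  have hrel : altVec211 N q + (-1 / q) • strandR N q 2 *ᵥ altVec211 N q +
      (-1 / q) ^ 2 • strandR N q 1 *ᵥ (strandR N q 2 *ᵥ altVec211 N q) +
      (-1 / q) ^ 3 • strandR N q 0 *ᵥ (strandR N q 1 *ᵥ (strandR N q 2 *ᵥ altVec211 N q)) = 0 := by
    refine hd.ext (add_mem (add_mem (add_mem hm (hsm _ _ (hR _ _ hm)))
      (hsm _ _ (hR _ _ (hR _ _ hm)))) (hsm _ _ (hR _ _ (hR _ _ (hR _ _ hm)))))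
      (Submodule.zero_mem _) fun j => ?_
    fin_cases j <;> simp [-mulVec_mulVec, strandR_zero_mulVec, strandR_one_mulVec,
      strandR_two_mulVec, rDiag, altVec211_apply, altEntry, initInd] <;> field_simp <;> ring
  obtain ⟨e, he, ho, ha⟩ := hH.exists_basis_sector31 transpose_strandR hq.neg_inv
    (hs.trans (hq.qNum_three_neg_inv).symm) (ht.trans (neg_inv_sq q).symm)
    (multSpace N q Y211) hR (hsm c _ hm) hc
    (by rw [mulVec_smul, strandR_zero_altVec211 h0, smul_comm])
    (by rw [mulVec_smul, strandR_one_altVec211 h0, smul_comm]) (by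
      simp only [mulVec_smul]
      simp only [smul_comm _ c, ← smul_add, hrel, smul_zero])
  exact Mixing.represents_of_orthonormal hd e he ho ha

end

section

variable {q s t : ℂ} {N : ℕ}

/-! ### The sector `[1111]` -/

/-- The highest weight vector of weight `[1111]`. -/
def altVec1111 (N : ℕ) (q : ℂ) : Idx N → ℂ := fun x =>
  altEntry q (x 0) (x 1) * altEntry q (x 0) (x 2) * altEntry q (x 0) (x 3) *
    (altEntry q (x 1) (x 2) * altEntry q (x 1) (x 3) * altEntry q (x 2) (x 3)) *
    (initInd 4 (x 0) * initInd 4 (x 1) * initInd 4 (x 2) * initInd 4 (x 3))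

lemma altVec1111_apply (a b c d : Fin N) : altVec1111 N q ![a, b, c, d] =
    altEntry q a b * altEntry q a c * altEntry q a d *
      (altEntry q b c * altEntry q b d * altEntry q c d) *
      (initInd 4 a * initInd 4 b * initInd 4 c * initInd 4 d) := rfl

lemma altVec1111_support {x : Idx N} (h : altVec1111 N q x ≠ 0) :
    (((x 0 : ℕ) ≠ x 1 ∧ (x 0 : ℕ) ≠ x 2 ∧ (x 0 : ℕ) ≠ x 3) ∧
      (x 1 : ℕ) ≠ x 2 ∧ (x 1 : ℕ) ≠ x 3 ∧ (x 2 : ℕ) ≠ x 3) ∧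
      (x 0 : ℕ) < 4 ∧ (x 1 : ℕ) < 4 ∧ (x 2 : ℕ) < 4 ∧ (x 3 : ℕ) < 4 := by
  simp only [altVec1111, mul_ne_zero_iff] at h
  exact ⟨⟨⟨altEntry_ne_zero h.1.1.1.1, altEntry_ne_zero h.1.1.1.2, altEntry_ne_zero h.1.1.2⟩,
    altEntry_ne_zero h.1.2.1.1, altEntry_ne_zero h.1.2.1.2, altEntry_ne_zero h.1.2.2⟩,
    initInd_ne_zero h.2.1.1.1, initInd_ne_zero h.2.1.1.2, initInd_ne_zero h.2.1.2,
    initInd_ne_zero h.2.2⟩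

lemma strandR_altVec1111 (hq : q ≠ 0) (μ : Fin 3) :
    strandR N q μ *ᵥ altVec1111 N q = (-1 / q) • altVec1111 N q := by
  fin_cases μ
  · refine strandR_mulVec_of_alternating hq (fun x => altEntry q (x 0) (x 2) *
      altEntry q (x 0) (x 3) *
      (altEntry q (x 1) (x 2) * altEntry q (x 1) (x 3) * altEntry q (x 2) (x 3)) *
      (initInd 4 (x 0) * initInd 4 (x 1) * initInd 4 (x 2) * initInd 4 (x 3)))
      (fun x => ?_) fun x => ?_
    · change _ = altEntry q (x 0) (x 1) * _
      rw [altVec1111]; ring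
    · change altEntry q (x 1) (x 2) * altEntry q (x 1) (x 3) *
        (altEntry q (x 0) (x 2) * altEntry q (x 0) (x 3) * altEntry q (x 2) (x 3)) *
        (initInd 4 (x 1) * initInd 4 (x 0) * initInd 4 (x 2) * initInd 4 (x 3)) = _
      ring
  · refine strandR_mulVec_of_alternating hq (fun x => altEntry q (x 0) (x 1) *
      altEntry q (x 0) (x 2) * altEntry q (x 0) (x 3) *
      (altEntry q (x 1) (x 3) * altEntry q (x 2) (x 3)) *
      (initInd 4 (x 0) * initInd 4 (x 1) * initInd 4 (x 2) * initInd 4 (x 3)))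
      (fun x => ?_) fun x => ?_
    · change _ = altEntry q (x 1) (x 2) * _
      rw [altVec1111]; ring
    · change altEntry q (x 0) (x 2) * altEntry q (x 0) (x 1) * altEntry q (x 0) (x 3) *
        (altEntry q (x 2) (x 3) * altEntry q (x 1) (x 3)) *
        (initInd 4 (x 0) * initInd 4 (x 2) * initInd 4 (x 1) * initInd 4 (x 3)) = _
      ring
  · refine strandR_mulVec_of_alternating hq (fun x => altEntry q (x 0) (x 1) *
      altEntry q (x 0) (x 2) * altEntry q (x 0) (x 3) *
      (altEntry q (x 1) (x 2) * altEntry q (x 1) (x 3)) *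
      (initInd 4 (x 0) * initInd 4 (x 1) * initInd 4 (x 2) * initInd 4 (x 3)))
      (fun x => ?_) fun x => ?_
    · change _ = altEntry q (x 2) (x 3) * _
      rw [altVec1111]; ring
    · change altEntry q (x 0) (x 1) * altEntry q (x 0) (x 3) * altEntry q (x 0) (x 2) *
        (altEntry q (x 1) (x 3) * altEntry q (x 1) (x 2)) *
        (initInd 4 (x 0) * initInd 4 (x 1) * initInd 4 (x 3) * initInd 4 (x 2)) = _
      ring

lemma altVec1111_mem (hq : Generic q) : altVec1111 N q ∈ multSpace N q Y1111 := by
  refine mem_multSpace_of_words (fun a b c d h i => ?_) ?_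
  · obtain ⟨⟨⟨h1, h2, h3⟩, h4, h5, h6⟩, h7, h8, h9, h10⟩ := altVec1111_support h
    simp at h1 h2 h3 h4 h5 h6 h7 h8 h9 h10
    rw [rowLen_Y1111]
    split_ifs <;> omega
  · refine raiseTensor_eq_zero_of_alternating hq Set.univ (fun j k => j ≠ k)
      (fun μ _ => strandR_altVec1111 hq.ne_zero μ) ?_ ?_
    · intro u hu x hx
      have h0 := hu 0 trivial
      have h1 := hu 1 trivial
      have h2 := hu 2 trivial
      have h01 : x 0 ≠ x 1 := fun e => hx (apply_eq_zero_of_alternating hq h0 e)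
      have h12 : x 1 ≠ x 2 := fun e => hx (apply_eq_zero_of_alternating hq h1 e)
      have h23 : x 2 ≠ x 3 := fun e => hx (apply_eq_zero_of_alternating hq h2 e)
      have h02 : x 0 ≠ x 2 := fun e => hx (apply_eq_zero_of_alternating_zero_one hq h0 h1 e)
      have h13 : x 1 ≠ x 3 := fun e => hx (apply_eq_zero_of_alternating_one_two hq h1 h2 e)
      have h03 : x 0 ≠ x 3 := fun e => hx
        (apply_eq_zero_of_swapAt hq h0 (apply_eq_zero_of_alternating_one_two hq h1 h2 e))
      intro j k hjk
      fin_cases j <;> fin_cases k <;>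
        first | assumption | (apply Ne.symm; assumption) | simp at hjk
    · intro y hy k α hk
      have := altVec1111_support hy
      have key : (y 0 : ℕ) = α ∨ (y 1 : ℕ) = α ∨ (y 2 : ℕ) = α ∨ (y 3 : ℕ) = α := by
        fin_cases k <;> simp at hk <;> omega
      rcases key with h | h | h | h
      · exact ⟨0, by rintro rfl; omega, by rintro rfl; omega, h⟩
      · exact ⟨1, by rintro rfl; omega, by rintro rfl; omega, h⟩
      · exact ⟨2, by rintro rfl; omega, by rintro rfl; omega, h⟩
      · exact ⟨3, by rintro rfl; omega, by rintro rfl; omega, h⟩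

/-- The words of this content are the permutations of `0123`. Exchanging two consecutive letters
preserves vanishing, and such exchanges sort every permutation. -/
lemma determines_Y1111 (hq : q ≠ 0) (l0 : 0 < N) (l1 : 1 < N) (l2 : 2 < N) (l3 : 3 < N) :
    Determines N q Y1111 (n := 1) ![![⟨0, l0⟩, ⟨1, l1⟩, ⟨2, l2⟩, ⟨3, l3⟩]] := by
  refine Determines.of_words fun v hv hp a b c d h => ?_
  have p0 : v ![⟨0, l0⟩, ⟨1, l1⟩, ⟨2, l2⟩, ⟨3, l3⟩] = 0 := hp 0
  have hlt := h.lt (r := 4) fun i hi => by rw [rowLen_Y1111, if_neg (by omega)]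
  have hl : ∀ i : Fin N, (i : ℕ) < 4 → i = ⟨0, l0⟩ ∨ i = ⟨1, l1⟩ ∨ i = ⟨2, l2⟩ ∨ i = ⟨3, l3⟩ := by
    intro i hi
    simp only [Fin.ext_iff]
    omega
  have h0 := h ⟨0, l0⟩
  have h1 := h ⟨1, l1⟩
  have h2 := h ⟨2, l2⟩
  rw [rowLen_Y1111] at h0 h1 h2
  have a23 := apply_eq_zero_iff_of_letters hq hv (α := ⟨0, l0⟩) (β := ⟨1, l1⟩) rfl
    (c := ⟨2, l2⟩) (d := ⟨3, l3⟩) (by simp) (by simp)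
  have a32 := apply_eq_zero_iff_of_letters hq hv (α := ⟨0, l0⟩) (β := ⟨1, l1⟩) rfl
    (c := ⟨3, l3⟩) (d := ⟨2, l2⟩) (by simp) (by simp)
  have b03 := apply_eq_zero_iff_of_letters hq hv (α := ⟨1, l1⟩) (β := ⟨2, l2⟩) rfl
    (c := ⟨0, l0⟩) (d := ⟨3, l3⟩) (by simp) (by simp)
  have b30 := apply_eq_zero_iff_of_letters hq hv (α := ⟨1, l1⟩) (β := ⟨2, l2⟩) rfl
    (c := ⟨3, l3⟩) (d := ⟨0, l0⟩) (by simp) (by simp)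
  have c01 := apply_eq_zero_iff_of_letters hq hv (α := ⟨2, l2⟩) (β := ⟨3, l3⟩) rfl
    (c := ⟨0, l0⟩) (d := ⟨1, l1⟩) (by simp) (by simp)
  rcases hl a hlt.1 with rfl | rfl | rfl | rfl <;>
    rcases hl b hlt.2.1 with rfl | rfl | rfl | rfl <;>
    rcases hl c hlt.2.2.1 with rfl | rfl | rfl | rfl <;>
    rcases hl d hlt.2.2.2 with rfl | rfl | rfl | rfl <;>
    first
    | (exfalso; simp at h0; done) | (exfalso; simp at h1; done) | (exfalso; simp at h2; done)
    | simp only [a23, a32, b03, b30, c01, p0]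

lemma altVec1111_dotProduct_ne_zero (hq : Generic q) (hN : 4 ≤ N) :
    altVec1111 N q ⬝ᵥ altVec1111 N q ≠ 0 := by
  rw [dotProduct_self_of_init hN (altVec1111 N q) (altVec1111 4 q) (fun y => rfl)]
  · have h2 := hq.two_ne_zero
    have h3 := hq.three_ne_zero
    have h4 := hq.four_ne_zero
    have : altVec1111 4 q ⬝ᵥ altVec1111 4 q =
        (q ^ 2 + 1) * (q ^ 4 + q ^ 2 + 1) * ((q ^ 2 + 1) * (q ^ 4 + 1)) := by
      rw [dotProduct, sum_words]
      simp [Fin.sum_univ_four, altVec1111_apply, altEntry, initInd]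
      ring
    rw [this]
    positivity
  · intro x hx k
    have := altVec1111_support hx
    fin_cases k <;> simp <;> omega

theorem represents_sector4_Y1111 (hq : Generic q) (hN : 4 ≤ N) :
    (sector4 (-1 / q)).Represents N q Y1111 := by
  have h0 := hq.ne_zero
  obtain ⟨c, hc⟩ := exists_smul_dotProduct_self (altVec1111_dotProduct_ne_zero hq hN)
  refine Mixing.represents_of_orthonormal (determines_Y1111 h0 (show 0 < N by omega)
    (show 1 < N by omega) (show 2 < N by omega) (show 3 < N by omega))
    (fun _ => c • altVec1111 N q) (fun _ => Submodule.smul_mem _ _ (altVec1111_mem hq))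
    (fun i j => ?_) fun μ j => ?_
  · rw [Subsingleton.elim i j, if_pos rfl, hc]
  · rw [sector4_hatR, Fin.sum_univ_one, mulVec_smul, strandR_altVec1111 h0, smul_comm c]
    fin_cases j
    simp

end

end FourStrand

end

/-! ### Assembly of the sectors and of the trace formula. -/

theorem mainTheorem4 (q s t : ℂ) (hq0 : q ≠ 0) (hq : ∀ n : ℕ, 0 < n → q ^ n ≠ 1)
    (hs : s ^ 2 = FourStrand.qNum 3 q) (ht : t ^ 2 = q ^ 2 + (q ^ 2)⁻¹) :
    -- the `R`-matrices are invertible, the mixing matrices orthogonal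
    (∀ (N : ℕ) (μ : Fin 3), IsUnit (FourStrand.strandR N q μ)) ∧
    (FourStrand.sector31 q s t).Orthogonal ∧
    (FourStrand.sector22 q s).Orthogonal ∧
    (FourStrand.sector31 (-1 / q) s t).Orthogonal ∧
    -- action of `R₁, R₂, R₃` in the five multiplicity spaces
    (∀ N : ℕ, 1 ≤ N → (FourStrand.sector4 q).Represents N q FourStrand.Y4) ∧
    (∀ N : ℕ, 2 ≤ N → (FourStrand.sector31 q s t).Represents N q FourStrand.Y31) ∧
    (∀ N : ℕ, 2 ≤ N → (FourStrand.sector22 q s).Represents N q FourStrand.Y22) ∧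
    (∀ N : ℕ, 3 ≤ N → (FourStrand.sector31 (-1 / q) s t).Represents N q FourStrand.Y211) ∧
    (∀ N : ℕ, 4 ≤ N → (FourStrand.sector4 (-1 / q)).Represents N q FourStrand.Y1111) ∧
    -- explicit form of `R₂`, `R₃`, and `V = U⁻²` in the sector `[22]`
    (FourStrand.sector31 q s t).hatR 1 =
      !![q, 0, 0;
         0, -(1 / (q ^ 2 * FourStrand.qNum 2 q)), -(s / FourStrand.qNum 2 q);
         0, -(s / FourStrand.qNum 2 q), q ^ 2 / FourStrand.qNum 2 q] ∧
    (FourStrand.sector31 q s t).hatR 2 =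
      !![-(1 / (q ^ 3 * FourStrand.qNum 3 q)),
           -(FourStrand.qNum 2 q * t / FourStrand.qNum 3 q), 0;
         -(FourStrand.qNum 2 q * t / FourStrand.qNum 3 q),
           q ^ 3 / FourStrand.qNum 3 q, 0;
         0, 0, q] ∧
    (FourStrand.sector22 q s).hatR 1 =
      !![-(1 / (q ^ 2 * FourStrand.qNum 2 q)), -(s / FourStrand.qNum 2 q);
         -(s / FourStrand.qNum 2 q), q ^ 2 / FourStrand.qNum 2 q] ∧
    (FourStrand.sector22 q s).hatR 2 = (FourStrand.sector22 q s).R1 ∧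
    (FourStrand.sector22 q s).V = (FourStrand.sector22 q s).U ^ (-2 : ℤ) ∧
    -- the symmetry `q → -1/q` of the Schur functions
    (∀ A : ℂˣ, FourStrand.schurStar FourStrand.Y211 q A =
        FourStrand.schurStar FourStrand.Y31 (-1 / q) A ∧
      FourStrand.schurStar FourStrand.Y1111 q A =
        FourStrand.schurStar FourStrand.Y4 (-1 / q) A) ∧
    -- the formula for the HOMFLY polynomial of an arbitrary braid
    ∀ w : List (ℤ × ℤ × ℤ),
      (∃! H : LaurentPolynomial ℂ, FourStrand.IsHomfly q w H) ∧
      (∀ H : LaurentPolynomial ℂ, FourStrand.IsHomfly q w H → ∀ A : ℂˣ,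
        LaurentPolynomial.eval₂ (RingHom.id ℂ) A H =
          (FourStrand.braidValue (FourStrand.sector4 q).hatR w).trace *
              FourStrand.schurStar FourStrand.Y4 q A +
          (FourStrand.braidValue (FourStrand.sector31 q s t).hatR w).trace *
              FourStrand.schurStar FourStrand.Y31 q A +
          (FourStrand.braidValue (FourStrand.sector22 q s).hatR w).trace *
              FourStrand.schurStar FourStrand.Y22 q A +
          (FourStrand.braidValue (FourStrand.sector31 (-1 / q) s t).hatR w).trace *
              FourStrand.schurStar FourStrand.Y211 q A +
          (FourStrand.braidValue (FourStrand.sector4 (-1 / q)).hatR w).trace *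
              FourStrand.schurStar FourStrand.Y1111 q A) ∧
      FourStrand.braidValue (FourStrand.sector4 q).hatR w =
        (FourStrand.sector4 q).mixedValue w ∧
      FourStrand.braidValue (FourStrand.sector31 q s t).hatR w =
        (FourStrand.sector31 q s t).mixedValue w ∧
      FourStrand.braidValue (FourStrand.sector22 q s).hatR w =
        (FourStrand.sector22 q s).mixedValue w ∧
      FourStrand.braidValue (FourStrand.sector31 (-1 / q) s t).hatR w =
        (FourStrand.sector31 (-1 / q) s t).mixedValue w ∧
      FourStrand.braidValue (FourStrand.sector4 (-1 / q)).hatR w =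
        (FourStrand.sector4 (-1 / q)).mixedValue w := by
  open FourStrand in
  have h : Generic q := ⟨hq0, hq⟩
  have hi := h.neg_inv
  have hs' : s ^ 2 = qNum 3 (-1 / q) := hs.trans h.qNum_three_neg_inv.symm
  have ht' : t ^ 2 = (-1 / q) ^ 2 + ((-1 / q) ^ 2)⁻¹ := ht.trans (neg_inv_sq q).symm
  have o31 := orthogonal_sector31 h hs ht
  have o22 := orthogonal_sector22 h hs
  have o211 := orthogonal_sector31 hi hs' ht'
  refine ⟨fun N μ => (isHecke_strandR N hq0).isUnit μ, o31, o22, o211,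
    fun N hN => represents_sector4_Y4 hq0 hN, fun N hN => represents_sector31_Y31 h hs ht hN,
    fun N hN => represents_sector22_Y22 h hs hN, fun N hN => represents_sector31_Y211 h hs ht hN,
    fun N hN => represents_sector4_Y1111 h hN, sector31_hatR_one h hs, sector31_hatR_two h hs ht,
    sector22_hatR_one h hs, sector22_hatR_two h hs, sector22_V_eq_zpow h hs,
    fun A => ⟨schurStar_Y211_eq A, schurStar_Y1111_eq A⟩, fun w => ?_⟩
  obtain ⟨P, hP⟩ := exists_laurent_characterSum q s t w
  have hom : IsHomfly q w P := fun N hN A hA => by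
    rw [hP, hA, qTrace_braidValue h hs ht hN]
  have uniq : ∀ H, IsHomfly q w H → H = P := fun H hH =>
    laurent_ext_of_pow h fun N hN A hA => (hH N hN A hA).trans (hom N hN A hA).symm
  refine ⟨⟨P, hom, uniq⟩, fun H hH A => ?_,
    Mixing.braidValue_eq_mixedValue orthogonal_sector4 ((isHecke_sector4 hq0).isUnit 0) w,
    Mixing.braidValue_eq_mixedValue o31 ((isHecke_sector31 h hs ht).isUnit 0) w,
    Mixing.braidValue_eq_mixedValue o22 ((isHecke_sector22 h hs).isUnit 0) w,
    Mixing.braidValue_eq_mixedValue o211 ((isHecke_sector31 hi hs' ht').isUnit 0) w,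
    Mixing.braidValue_eq_mixedValue orthogonal_sector4 ((isHecke_sector4 hi.ne_zero).isUnit 0) w⟩
  rw [uniq H hH, hP, characterSum]
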